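/- **Theorem 1.** Let $K\subset\mathbb R^3$ be a convex bounded polyhedron with non-empty interior and vertices $v^1,\dots,v^k$, and let $P=K\setminus\{v^1,\dots,v^k\}$. Let $F^1,\dots,F^f$ be the outward unit normals of the faces of $K$. A *continuous tangent unit-vector field* on $P$ is a continuous map $\mathbf n:P\to S^2$ such that $\mathbf n(x)\cdot F^c=0$ for every $c$ and every $x\in P$ on the $c$-th face. The *sectors* are the non-empty sets $S^\sigma=\{s\in S^2:\operatorname{sgn}(s\cdot F^c)=\sigma^c \text{ for all } c\}$, where $\sigma\in\{\pm1\}^f$; they are the open spherical polygons into which the great circles $\{s\in S^2: s\cdot F^c=0\}$ partition $S^2$. Let $A^\sigma$ be the area of $S^\sigma$ (with $S^2$ having area $4\pi$), $\chi^\sigma$ its characteristic function, and $\omega$ the area form of $S^2$, oriented by the outward normal. For a vertex $v^a$, let $C^a$ be a *cleaved surface*, i.e. the intersection of $K$ with a plane that strictly separates $v^a$ from the other vertices, oriented so that $v^a$ lies on its positive side. The *wrapping number* $w^{a\sigma}\in\mathbb Z$ of a continuous tangent unit-vector field $\mathbf n$ is the number of times that $\mathbf n|_{C^a}$ covers $S^\sigma$,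 counted with orientation: for $\mathbf n|_{C^a}$ continuously differentiable it is $$w^{a\sigma}=\frac1{A^\sigma}\int_{C^a}\mathbf n^*(\chi^\sigma\omega),$$ and in general it is the value of this expression at any continuously differentiable unit-vector field on $C^a$ that is homotopic to $\mathbf n|_{C^a}$ through continuous unit-vector fields on $C^a$ tangent to the faces of $K$ at the points of these faces. (This depends neither on the plane nor on the representative.) A family $h=\{w^{a\sigma}\}$ of integers is an *admissible topology* if the set $\mathcal C_P(h)$ of continuous tangent unit-vector fields on $P$ with wrapping numbers $h$ is not empty. Let $\mathcal{HC}_P(h)$ be the set of those $\mathbf n\in\mathcal C_P(h)$ whose weak gradient is square integrable on $P$, and let $$E(\mathbf n)=\int_P|\nabla\mathbf n|^2\,dV,\qquad E^{\inf}_P(h)=\inf_{\mathbf n\in\mathcal{HC}_P(h)}E(\mathbf n)\in[0,\infty],$$ where $|\nabla \mathbf n|^2=\sum_{i,j}(\partial_i n_j)^2$. For two $m$-tuples $\mathcal P=(a^1,\dots,a^m)$, $\mathcal N=(b^1,\dots,b^m)$ of points of $\mathbb R^3$, let $$L(\mathcal P,\mathcal N)=\min_{\pi\in S_m}\sum_{j=1}^m|a^j-b^{\pi(j)}|$$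 be the length of a minimal connection. (If the tuples had different lengths, $L$ would be $+\infty$, the infimum over the empty set.) If $h=\{w^{a\sigma}\}$ is an admissible topology, then $$E^{\inf}_P(h)\ \ge\ E^-_P(h):=\sum_\sigma 2A^\sigma\,L\big(\mathcal P^\sigma(h),\mathcal N^\sigma(h)\big),$$ where the sum is over all sectors and $\mathcal P^\sigma(h)$ (resp. $\mathcal N^\sigma(h)$) contains the vertices $v^a$ with $w^{a\sigma}>0$ (resp. $w^{a\sigma}<0$), each with multiplicity $|w^{a\sigma}|$. -/

import Mathlib

open MeasureTheory Set
open scoped ENNReal ContDiff RealInnerProductSpace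

noncomputable section

/-- Euclidean three-space. -/
abbrev E3 : Type := EuclideanSpace ℝ (Fin 3)

/-- The scalar triple product `a · (b × c)`.  As a two-form in `(b, c)` at a point `a` of the unit
sphere it is the area form `ω` of the sphere, oriented by the outward normal. -/
def tripleProduct (a b c : E3) : ℝ :=
  (Matrix.of ![a.ofLp, b.ofLp, c.ofLp]).det

/-- A convex bounded polyhedron with non-empty interior in three-space, given by the finite set of
its vertices (each of them a genuine vertex, i.e. not in the convex hull of the others). -/
structure ConvexPolyhedron where
  /-- the vertices -/
  vertices : Finset E3
  convexIndependent : ConvexIndependent ℝ (fun v : (vertices : Set E3) => (v : E3))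
  interior_nonempty : (interior (convexHull ℝ (vertices : Set E3))).Nonempty

namespace ConvexPolyhedron

variable (P : ConvexPolyhedron)

/-- The closed solid polyhedron, vertices included. -/
def body : Set E3 := convexHull ℝ (P.vertices : Set E3)

/-- The polyhedron with its vertices removed (interior, open faces and open edges are kept): the
domain of the unit-vector fields. -/
def domain : Set E3 := P.body \ (P.vertices : Set E3)

/-- The set of points of the polyhedron that are extreme in the direction `ν`. -/
def supportSet (ν : E3) : Set E3 := (innerSL ℝ ν).toExposed P.body

/-- The outward unit normals of the (two-dimensional, closed) faces.  Distinct faces have distinct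
outward unit normals, so this type indexes the faces; `P.supportSet c` is the face with
outward normal `c`. -/
def Face : Type :=
  {ν : E3 // ‖ν‖ = 1 ∧ Module.finrank ℝ (vectorSpan ℝ (P.supportSet ν)) = 2}

variable {P} in
/-- The outward unit normal of a face. -/
def Face.normal (c : P.Face) : E3 := c.1

variable {P} in
/-- The closed face itself. -/
def Face.carrier (c : P.Face) : Set E3 := P.supportSet c.normal

/-- The points `s` of the unit sphere with `sgn (s · F^c) = σ^c` for every face `c`. -/
def signRegion (σ : P.Face → SignType) : Set E3 :=
  {s | ‖s‖ = 1 ∧ ∀ c : P.Face, SignType.sign ⟪s, c.normal⟫ = σ c}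

/-- The sectors: the non-empty open spherical polygons into which the great circles of the faces
partition the unit sphere, labelled by their tuples of (non-zero) signs. -/
def Sector : Type :=
  {σ : P.Face → SignType // (∀ c, σ c ≠ 0) ∧ (P.signRegion σ).Nonempty}

variable {P} in
/-- The sector as a subset of the unit sphere. -/
def Sector.carrier (σ : P.Sector) : Set E3 := P.signRegion σ.1

variable {P} in
/-- The area of a sector; the whole unit sphere has area `4π`. -/
def Sector.area (σ : P.Sector) : ℝ≥0∞ :=
  (volume : Measure E3).toSphere (((↑) : Metric.sphere (0 : E3) 1 → E3) ⁻¹' σ.carrier)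

/-- Continuous tangent unit-vector fields on the polyhedron without its vertices.  (Values outside
the domain are irrelevant.) -/
structure IsTangentField (n : E3 → E3) : Prop where
  continuousOn : ContinuousOn n P.domain
  norm_eq_one : ∀ x ∈ P.domain, ‖n x‖ = 1
  tangent : ∀ c : P.Face, ∀ x ∈ c.carrier ∩ P.domain, ⟪n x, c.normal⟫ = 0

/-- A planar cleaved surface of the vertex `v`: the intersection of the polyhedron with the plane
`{x | u · x = offset}`, which has `v` strictly on its positive side and all other vertices strictly
on its negative side.  The orthonormal frame `e₁, e₂, u` is positively oriented, so that the
coordinates along `e₁, e₂` give the cleaved surface the orientation for which `v` lies on its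
positive side. -/
structure CleavedSurface (v : E3) where
  /-- first tangent vector -/
  e₁ : E3
  /-- second tangent vector -/
  e₂ : E3
  /-- unit normal -/
  u : E3
  /-- position of the plane -/
  offset : ℝ
  orthonormal : Orthonormal ℝ ![e₁, e₂, u]
  positive : tripleProduct e₁ e₂ u = 1
  lt_vertex : offset < ⟪u, v⟫
  other_lt : ∀ v' ∈ P.vertices, v' ≠ v → ⟪u, v'⟫ < offset

namespace CleavedSurface

variable {P} {v : E3} (C : P.CleavedSurface v)

/-- Cartesian coordinates on the plane of the cleaved surface. -/
def param (p : ℝ × ℝ) : E3 := C.offset • C.u + p.1 • C.e₁ + p.2 • C.e₂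

/-- The cleaved surface, in Cartesian coordinates (a compact convex polygon). -/
def region : Set (ℝ × ℝ) := {p | C.param p ∈ P.body}

/-- `g` is a unit-vector field on the cleaved surface that is tangent to each face of the
polyhedron at the points of that face. -/
def IsTangent (g : ℝ × ℝ → E3) : Prop :=
  (∀ p ∈ C.region, ‖g p‖ = 1) ∧
    ∀ c : P.Face, ∀ p ∈ C.region, C.param p ∈ c.carrier → ⟪g p, c.normal⟫ = 0

/-- Homotopy of tangent unit-vector fields on the cleaved surface, through such fields. -/
def TangentHomotopic (g₀ g₁ : ℝ × ℝ → E3) : Prop :=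
  ∃ H : ℝ × (ℝ × ℝ) → E3,
    ContinuousOn H (Icc (0 : ℝ) 1 ×ˢ C.region) ∧
    (∀ t ∈ Icc (0 : ℝ) 1, C.IsTangent fun p => H (t, p)) ∧
    (∀ p ∈ C.region, H (0, p) = g₀ p) ∧ ∀ p ∈ C.region, H (1, p) = g₁ p

/-- The integral over the cleaved surface of the pullback by `g` of `χ ω`, with `ω` the area form
of the unit sphere and `χ` the characteristic function of `S`. -/
def pullbackArea (g : ℝ × ℝ → E3) (S : Set E3) : ℝ :=
  ∫ p in C.region,
    S.indicator (fun s => tripleProduct s (fderiv ℝ g p (1, 0)) (fderiv ℝ g p (0, 1))) (g p)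

end CleavedSurface

/-- `w` is the wrapping number of the continuous tangent field `n` about the vertex `v` with respect
to the sector `σ`: the number of times that the restriction of `n` to a cleaved surface of `v`
covers the sector, counted with orientation.  For a differentiable field this number is
`(1 / A^σ) ∫_C n^*(χ^σ ω)`; for a continuous one it is that of a differentiable tangent field on the
cleaved surface that is homotopic to it.  (The number does not depend on the choices made.) -/
def IsWrappingNumber (n : E3 → E3) (v : E3) (σ : P.Sector) (w : ℤ) : Prop :=
  ∃ (C : P.CleavedSurface v) (g : ℝ × ℝ → E3),
    ContDiff ℝ 1 g ∧ C.IsTangent g ∧ C.TangentHomotopic (n ∘ C.param) g ∧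
    (w : ℝ) = 1 / σ.area.toReal * C.pullbackArea g σ.carrier

/-- Families `{w^{aσ}}` of integers indexed by vertices and sectors (candidate wrapping numbers). -/
abbrev WrappingNumbers : Type := P.vertices → P.Sector → ℤ

/-- `C_P(h)`: the continuous tangent unit-vector fields with wrapping numbers `h`. -/
def homotopyClass (h : P.WrappingNumbers) : Set (E3 → E3) :=
  {n | P.IsTangentField n ∧ ∀ (v : P.vertices) (σ : P.Sector), P.IsWrappingNumber n v σ (h v σ)}

/-- `h` is an admissible topology: it is realised by some continuous tangent unit-vector field. -/
def Admissible (h : P.WrappingNumbers) : Prop := (P.homotopyClass h).Nonempty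

/-- `G i` (for `i = 0, 1, 2`) is the weak partial derivative of `n` in the `i`-th coordinate
direction, in the interior of the polyhedron. -/
def IsWeakGradient (n : E3 → E3) (G : Fin 3 → E3 → E3) : Prop :=
  ∀ i, LocallyIntegrableOn (G i) (interior P.body) ∧
    ∀ φ : E3 → ℝ, ContDiff ℝ ∞ φ → HasCompactSupport φ → tsupport φ ⊆ interior P.body →
      ∫ x in interior P.body, (fderiv ℝ φ x (EuclideanSpace.single i 1)) • n x =
        - ∫ x in interior P.body, φ x • G i x

/-- The Dirichlet energy `∫_P |∇n|²` (the sum of the squares of all the first partial derivatives of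
the components of `n`).  Weak gradients are unique almost everywhere, so the infimum is over at most
one value; it is `∞` if there is no weak gradient or if the weak gradient is not square
integrable. -/
def energy (n : E3 → E3) : ℝ≥0∞ :=
  ⨅ (G : Fin 3 → E3 → E3) (_ : P.IsWeakGradient n G),
    ∫⁻ x in interior P.body, ∑ i, ‖G i x‖ₑ ^ 2

/-- `HC_P(h)`: the elements of `C_P(h)` with finite Dirichlet energy. -/
def finiteEnergyClass (h : P.WrappingNumbers) : Set (E3 → E3) :=
  {n ∈ P.homotopyClass h | P.energy n < ⊤}

/-- The infimum `E^inf_P(h)` of the Dirichlet energy over `HC_P(h)`. -/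
def infEnergy (h : P.WrappingNumbers) : ℝ≥0∞ :=
  ⨅ n ∈ P.finiteEnergyClass h, P.energy n

end ConvexPolyhedron

/-- The length of a minimal connection between two finite tuples of points: the minimum, over all
one-to-one pairings, of the sum of the distances between paired points (and `∞` if the tuples
do not have the same number of points). -/
def minimalConnection {α β : Type} [Fintype α] (p : α → E3) (q : β → E3) : ℝ≥0∞ :=
  ⨅ π : α ≃ β, ∑ j, edist (p j) (q (π j))

namespace ConvexPolyhedron

variable (P : ConvexPolyhedron)

/-- The tuple of the vertices with positive wrapping number in the sector `σ`, each repeated as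
often as its wrapping number says. -/
def positivePoints (h : P.WrappingNumbers) (σ : P.Sector) :
    (Σ v : P.vertices, Fin (h v σ).toNat) → E3 := fun j => j.1

/-- The tuple of the vertices with negative wrapping number in the sector `σ`, each repeated as
often as the absolute value of its wrapping number says. -/
def negativePoints (h : P.WrappingNumbers) (σ : P.Sector) :
    (Σ v : P.vertices, Fin (-h v σ).toNat) → E3 := fun j => j.1

/-- `E^-_P(h) = ∑_σ 2 A^σ L(P^σ(h), N^σ(h))`, the sum over all (finitely many) sectors. -/
def lowerEnergy (h : P.WrappingNumbers) : ℝ≥0∞ :=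
  ∑' σ : P.Sector, 2 * σ.area * minimalConnection (P.positivePoints h σ) (P.negativePoints h σ)

end ConvexPolyhedron

end

/-! This is a calibration argument of Brezis–Coron–Lieb type, run separately in each sector. For a
sector `σ` let `D` be the vector field dual to the two-form `n^*(χ^σ ω)`. It is divergence free away
from the vertices, and its flux through a cleaved surface of `v` is `A^σ w^{vσ}`. No flux crosses a
face, because `n` is tangent there and hence takes values on a great circle, off every open sector.
Pointwise `2 |D · ∇ξ| ≤ |∇n|²` when `|∇ξ| ≤ 1` (`two_mul_abs_flux_le`), and `D` vanishes unless `n`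
lies in the sector. Integration by parts therefore gives `2 A^σ ∑ ξ(v) w^{vσ} ≤ ∫_{n ∈ S^σ} |∇n|²`
for every 1-Lipschitz `ξ` that is constant near the vertices (`two_mul_area_mul_sum_le`).
Kantorovich duality (`exists_lipschitz_minimalConnection_le`) provides potentials for which the sum
is at least the length of a minimal connection, and the preimages of distinct sectors are disjoint,
so the bounds add up.

The field is only continuous with a weak gradient, so it is extended by zero and mollified, and
`χ^σ` is replaced by `C¹` weights `F` supported inside the cone over the sector. The weights are
homogeneous of degree `-3` away from the origin, which makes the pulled back form closed even though
mollified fields are not of unit length. What makes this work up to the boundary is convexity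
(`IsTameAt`): near every point other than a vertex the extended field takes values in a small ball
about a unit vector, or in a half-space where `F` vanishes, or is zero. Averages inherit each of
these, so the jump of the extension across a face is harmless.

The flux near a vertex is identified by gluing: the field above the cleaved surface is continued
below it, in a cylinder, by the homotopy to the differentiable representative `g`, and the flux is
measured where the glued field is `g` composed with the projection (`tendsto_integral_upperStep`).
-/

noncomputable section

/-! ### The weighted flux form: closedness and the pointwise energy inequality. -/

lemma tripleProduct_eq (a b c : E3) : tripleProduct a b c =
    a 0 * (b 1 * c 2 - b 2 * c 1) + a 1 * (b 2 * c 0 - b 0 * c 2)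
      + a 2 * (b 0 * c 1 - b 1 * c 0) := by
  simp [tripleProduct, Matrix.det_fin_three]
  ring

lemma E3.norm_sq_eq (a : E3) : ‖a‖ ^ 2 = a 0 ^ 2 + a 1 ^ 2 + a 2 ^ 2 := by
  simp [EuclideanSpace.norm_sq_eq, Fin.sum_univ_three]

lemma E3.inner_eq (a b : E3) : ⟪a, b⟫ = a 0 * b 0 + a 1 * b 1 + a 2 * b 2 := by
  simp [PiLp.inner_apply, Fin.sum_univ_three]
  ring

/-- The `i`-th partial derivative. -/
def partialDeriv {G : Type*} [NormedAddCommGroup G] [NormedSpace ℝ G] (i : Fin 3) (m : E3 → G)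
    (x : E3) : G := fderiv ℝ m x (EuclideanSpace.single i 1)

lemma E3.eq_sum_single (v : E3) : v = v 0 • (EuclideanSpace.single 0 1 : E3)
    + v 1 • (EuclideanSpace.single 1 1 : E3) + v 2 • (EuclideanSpace.single 2 1 : E3) := by
  ext i
  fin_cases i <;> simp

lemma fderiv_apply_eq_partialDeriv {G : Type*} [NormedAddCommGroup G] [NormedSpace ℝ G]
    (m : E3 → G) (x v : E3) : fderiv ℝ m x v =
      v 0 • partialDeriv 0 m x + v 1 • partialDeriv 1 m x + v 2 • partialDeriv 2 m x := by
  conv_lhs => rw [E3.eq_sum_single v]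
  simp [partialDeriv]

/-- The wedge product of `dφ` with the pullback by `m` of the two-form `F ω`. -/
def fluxDensity (F : E3 → ℝ) (m : E3 → E3) (φ : E3 → ℝ) (x : E3) : ℝ :=
  F (m x) * (partialDeriv 0 φ x * tripleProduct (m x) (partialDeriv 1 m x) (partialDeriv 2 m x)
    + partialDeriv 1 φ x * tripleProduct (m x) (partialDeriv 2 m x) (partialDeriv 0 m x)
    + partialDeriv 2 φ x * tripleProduct (m x) (partialDeriv 0 m x) (partialDeriv 1 m x))

lemma ContDiff.tripleProduct {G : Type*} [NormedAddCommGroup G] [NormedSpace ℝ G] {k : WithTop ℕ∞}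
    {a b c : G → E3} (ha : ContDiff ℝ k a) (hb : ContDiff ℝ k b) (hc : ContDiff ℝ k c) :
    ContDiff ℝ k fun x => tripleProduct (a x) (b x) (c x) := by
  simp only [tripleProduct_eq]
  have h : ∀ {f : G → E3}, ContDiff ℝ k f → ∀ i, ContDiff ℝ k fun x => f x i := fun hf i =>
    (contDiff_piLp 2).1 hf i
  have ha' := h ha; have hb' := h hb; have hc' := h hc
  exact ((((ha' 0).mul (((hb' 1).mul (hc' 2)).sub ((hb' 2).mul (hc' 1))))).add
    ((ha' 1).mul (((hb' 2).mul (hc' 0)).sub ((hb' 0).mul (hc' 2))))).add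
    ((ha' 2).mul (((hb' 0).mul (hc' 1)).sub ((hb' 1).mul (hc' 0))))

lemma Continuous.tripleProduct {G : Type*} [TopologicalSpace G]
    {a b c : G → E3} (ha : Continuous a) (hb : Continuous b) (hc : Continuous c) :
    Continuous fun x => tripleProduct (a x) (b x) (c x) := by
  simp only [tripleProduct_eq]
  fun_prop

lemma fderiv_tripleProduct_apply {a b c : E3 → E3} {x : E3} (ha : DifferentiableAt ℝ a x)
    (hb : DifferentiableAt ℝ b x) (hc : DifferentiableAt ℝ c x) (v : E3) :
    fderiv ℝ (fun x => tripleProduct (a x) (b x) (c x)) x v =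
      tripleProduct (fderiv ℝ a x v) (b x) (c x) + tripleProduct (a x) (fderiv ℝ b x v) (c x)
        + tripleProduct (a x) (b x) (fderiv ℝ c x v) := by
  have h : ∀ {f : E3 → E3}, DifferentiableAt ℝ f x → ∀ i,
      HasFDerivAt (fun x => f x i) ((EuclideanSpace.proj i : E3 →L[ℝ] ℝ) ∘L fderiv ℝ f x) x :=
    fun hf i => (EuclideanSpace.proj i : E3 →L[ℝ] ℝ).hasFDerivAt.comp x hf.hasFDerivAt
  have ha' := h ha; have hb' := h hb; have hc' := h hc
  simp only [tripleProduct_eq]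
  refine (DFunLike.congr_fun ((((((ha' 0).mul (((hb' 1).mul (hc' 2)).sub
    ((hb' 2).mul (hc' 1))))).add ((ha' 1).mul (((hb' 2).mul (hc' 0)).sub
    ((hb' 0).mul (hc' 2))))).add
    ((ha' 2).mul (((hb' 0).mul (hc' 1)).sub ((hb' 1).mul (hc' 0))))).fderiv) v).trans ?_
  simp
  ring

lemma contDiff_partialDeriv {G : Type*} [NormedAddCommGroup G] [NormedSpace ℝ G] {m : E3 → G}
    {k : ℕ} (hm : ContDiff ℝ (k + 1) m) (i : Fin 3) : ContDiff ℝ k (partialDeriv i m) :=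
  (hm.fderiv_right le_rfl).clm_apply contDiff_const

lemma partialDeriv_comm {m : E3 → E3} (hm : ContDiff ℝ 2 m) (i j : Fin 3) (x : E3) :
    partialDeriv i (partialDeriv j m) x = partialDeriv j (partialDeriv i m) x := by
  have h : ContDiffAt ℝ 2 m x := hm.contDiffAt
  have hs := h.isSymmSndFDerivAt (by simp)
  have hd : DifferentiableAt ℝ (fderiv ℝ m) x :=
    (hm.fderiv_right (m := 1) le_rfl).differentiable (by simp) x
  have key : ∀ i j : Fin 3, partialDeriv i (partialDeriv j m) x =
      fderiv ℝ (fderiv ℝ m) x (EuclideanSpace.single i 1) (EuclideanSpace.single j 1) := by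
    intro i j
    unfold partialDeriv
    rw [fderiv_clm_apply hd (differentiableAt_const _)]
    simp
  rw [key, key]
  exact hs.eq _ _

/-- The component of the flux field obtained from the partial derivatives `j` and `k`. -/
def fluxComponent (F : E3 → ℝ) (m : E3 → E3) (j k : Fin 3) (x : E3) : ℝ :=
  F (m x) * tripleProduct (m x) (partialDeriv j m x) (partialDeriv k m x)

lemma contDiff_fluxComponent {F : E3 → ℝ} {m : E3 → E3} (hF : ContDiff ℝ 1 F)
    (hm : ContDiff ℝ 2 m) (j k : Fin 3) : ContDiff ℝ 1 (fluxComponent F m j k) :=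
  (hF.comp (hm.of_le (by norm_num))).mul (ContDiff.tripleProduct (hm.of_le (by norm_num))
    (contDiff_partialDeriv (k := 1) hm j) (contDiff_partialDeriv (k := 1) hm k))

lemma hasCompactSupport_fluxComponent {F : E3 → ℝ} {m : E3 → E3} (hm : HasCompactSupport m)
    (j k : Fin 3) : HasCompactSupport (fluxComponent F m j k) := by
  refine hm.mono fun x hx => ?_
  contrapose! hx
  have h : m x = 0 := by simpa using hx
  simp [fluxComponent, tripleProduct_eq, h]

lemma integral_mul_partialDeriv {φ B : E3 → ℝ} (hφ : ContDiff ℝ 1 φ) (hB : ContDiff ℝ 1 B)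
    (hBc : HasCompactSupport B) (i : Fin 3) :
    Integrable (fun x => φ x * partialDeriv i B x) ∧
    Integrable (fun x => partialDeriv i φ x * B x) ∧
    ∫ x, φ x * partialDeriv i B x = - ∫ x, partialDeriv i φ x * B x := by
  have hB' : HasCompactSupport (partialDeriv i B) := hBc.fderiv_apply ℝ _
  have c1 : Continuous (partialDeriv i B) := (contDiff_partialDeriv (k := 0) hB i).continuous
  have c2 : Continuous (partialDeriv i φ) := (contDiff_partialDeriv (k := 0) hφ i).continuous
  have i1 : Integrable (fun x => φ x * partialDeriv i B x) :=
    (hφ.continuous.mul c1).integrable_of_hasCompactSupport hB'.mul_left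
  have i2 : Integrable (fun x => partialDeriv i φ x * B x) :=
    (c2.mul hB.continuous).integrable_of_hasCompactSupport hBc.mul_left
  refine ⟨i1, i2, ?_⟩
  exact integral_mul_fderiv_eq_neg_fderiv_mul_of_integrable (v := EuclideanSpace.single i 1) i2 i1
    ((hφ.continuous.mul hB.continuous).integrable_of_hasCompactSupport hBc.mul_left)
    (fun x _ => hφ.differentiable (by simp) x) (fun x _ => hB.differentiable (by simp) x)

/-- The second derivatives of `m` cancel by symmetry. Differentiating the factor `m` gives the same
determinant three times, and the terms with the derivative of `F` combine by Cramer's rule, which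
expands `m` in the three partial derivatives. What is left is Euler's expression for degree `-3`. -/
lemma divergence_fluxComponent {F : E3 → ℝ} {m : E3 → E3} (hF : ContDiff ℝ 1 F)
    (hm : ContDiff ℝ 2 m) (x : E3) :
    partialDeriv 0 (fluxComponent F m 1 2) x + partialDeriv 1 (fluxComponent F m 2 0) x
      + partialDeriv 2 (fluxComponent F m 0 1) x =
    (fderiv ℝ F (m x) (m x) + 3 * F (m x)) *
      tripleProduct (partialDeriv 0 m x) (partialDeriv 1 m x) (partialDeriv 2 m x) := by
  have dm : Differentiable ℝ m := hm.differentiable (by simp)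
  have dF : Differentiable ℝ F := hF.differentiable (by simp)
  have dp : ∀ j, Differentiable ℝ (partialDeriv j m) := fun j =>
    (contDiff_partialDeriv (k := 1) hm j).differentiable (by simp)
  have key : ∀ i j k : Fin 3, partialDeriv i (fluxComponent F m j k) x =
      F (m x) * (tripleProduct (partialDeriv i m x) (partialDeriv j m x) (partialDeriv k m x)
        + tripleProduct (m x) (partialDeriv i (partialDeriv j m) x) (partialDeriv k m x)
        + tripleProduct (m x) (partialDeriv j m x) (partialDeriv i (partialDeriv k m) x))
      + tripleProduct (m x) (partialDeriv j m x) (partialDeriv k m x)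
        * fderiv ℝ F (m x) (partialDeriv i m x) := by
    intro i j k
    have dT : DifferentiableAt ℝ
        (fun x => tripleProduct (m x) (partialDeriv j m x) (partialDeriv k m x)) x :=
      (ContDiff.tripleProduct (hm.of_le (by norm_num)) (contDiff_partialDeriv (k := 1) hm j)
        (contDiff_partialDeriv (k := 1) hm k)).differentiable (by simp) x
    unfold fluxComponent
    rw [partialDeriv, fderiv_fun_mul (c := fun x => F (m x)) ((dF _).comp x (dm x)) dT]
    simp only [add_apply, smul_apply, smul_eq_mul]
    rw [fderiv_tripleProduct_apply (dm x) (dp j x) (dp k x), fderiv_fun_comp x (dF _) (dm x)]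
    simp [partialDeriv]
  rw [key, key, key, partialDeriv_comm hm 1 0, partialDeriv_comm hm 2 0, partialDeriv_comm hm 2 1]
  simp only [fderiv_apply_eq_partialDeriv F, tripleProduct_eq, smul_eq_mul]
  ring

/-- The two-form pulled back is closed where `F` is homogeneous of degree `-3`. -/
lemma integral_fluxDensity_eq_zero {F : E3 → ℝ} {m : E3 → E3} {φ : E3 → ℝ} (hF : ContDiff ℝ 1 F)
    (hm : ContDiff ℝ 2 m) (hmc : HasCompactSupport m) (hφ : ContDiff ℝ 1 φ)
    (h : ∀ x ∈ tsupport φ, fderiv ℝ F (m x) (m x) + 3 * F (m x) = 0) :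
    ∫ x, fluxDensity F m φ x = 0 := by
  have H := fun i j k => integral_mul_partialDeriv hφ (contDiff_fluxComponent hF hm j k)
    (hasCompactSupport_fluxComponent (F := F) hmc j k) i
  obtain ⟨a0, b0, e0⟩ := H 0 1 2
  obtain ⟨a1, b1, e1⟩ := H 1 2 0
  obtain ⟨a2, b2, e2⟩ := H 2 0 1
  have : ∀ x, fluxDensity F m φ x = partialDeriv 0 φ x * fluxComponent F m 1 2 x
      + partialDeriv 1 φ x * fluxComponent F m 2 0 x
      + partialDeriv 2 φ x * fluxComponent F m 0 1 x := by
    intro x; simp only [fluxDensity, fluxComponent]; ring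
  simp only [this]
  -- Integration by parts in each coordinate turns the integrand into `φ` times the divergence of
  -- the flux field.
  rw [integral_add (by exact b0.add b1) b2, integral_add b0 b1, ← neg_eq_zero, neg_add, neg_add, ← e0, ← e1,
    ← e2, ← integral_add a0 a1, ← integral_add (by exact a0.add a1) a2]
  refine integral_eq_zero_of_ae (Filter.Eventually.of_forall fun x => ?_)
  have := divergence_fluxComponent hF hm x
  simp only [Pi.zero_apply]
  rw [← mul_add, ← mul_add, this]
  by_cases hx : x ∈ tsupport φ
  · rw [h x hx]; ring
  · rw [image_eq_zero_of_notMem_tsupport hx, zero_mul]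

lemma integrable_fluxDensity {F : E3 → ℝ} {m : E3 → E3} {φ : E3 → ℝ} (hF : ContDiff ℝ 1 F)
    (hm : ContDiff ℝ 2 m) (hmc : HasCompactSupport m) (hφ : ContDiff ℝ 1 φ) :
    Integrable (fluxDensity F m φ) := by
  have H := fun i j k => (integral_mul_partialDeriv hφ (contDiff_fluxComponent hF hm j k)
    (hasCompactSupport_fluxComponent (F := F) hmc j k) i).2.1
  refine (((H 0 1 2).add (H 1 2 0)).add (H 2 0 1)).congr (Filter.Eventually.of_forall fun x => ?_)
  simp only [fluxDensity, fluxComponent, Pi.add_apply]; ring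

lemma fluxDensity_sub {F : E3 → ℝ} {m : E3 → E3} {φ ψ : E3 → ℝ} {x : E3}
    (hφ : DifferentiableAt ℝ φ x) (hψ : DifferentiableAt ℝ ψ x) :
    fluxDensity F m (fun x => φ x - ψ x) x = fluxDensity F m φ x - fluxDensity F m ψ x := by
  simp only [fluxDensity, partialDeriv, fderiv_fun_sub hφ hψ, sub_apply]
  ring

lemma fluxDensity_sum {ι : Type*} (s : Finset ι) {F : E3 → ℝ} {m : E3 → E3} {φ : ι → E3 → ℝ}
    (c : ι → ℝ) {x : E3} (hφ : ∀ i ∈ s, DifferentiableAt ℝ (φ i) x) :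
    fluxDensity F m (fun x => ∑ i ∈ s, c i * φ i x) x
      = ∑ i ∈ s, c i * fluxDensity F m (φ i) x := by
  have : ∀ j, partialDeriv j (fun x => ∑ i ∈ s, c i * φ i x) x
      = ∑ i ∈ s, c i * partialDeriv j (φ i) x := by
    intro j
    unfold partialDeriv
    rw [fderiv_fun_sum fun i hi => (hφ i hi).const_mul (c i)]
    rw [sum_apply]
    refine Finset.sum_congr rfl fun i hi => ?_
    rw [fderiv_const_mul (hφ i hi)]; simp
  simp only [fluxDensity, this, Finset.sum_mul, ← Finset.sum_add_distrib, Finset.mul_sum]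
  refine Finset.sum_congr rfl fun i _ => ?_
  ring

/-- Lagrange's identity: the two sides differ by `⟪z, x⟫ ^ 2`. -/
lemma cross_mul_le (z x : E3) : (z 1 * x 2 - z 2 * x 1) ^ 2 + (z 2 * x 0 - z 0 * x 2) ^ 2
    + (z 0 * x 1 - z 1 * x 0) ^ 2 ≤ ‖z‖ ^ 2 * ‖x‖ ^ 2 := by
  rw [E3.norm_sq_eq, E3.norm_sq_eq]
  nlinarith [sq_nonneg (z 0 * x 0 + z 1 * x 1 + z 2 * x 2)]

/-- The algebraic inequality between the pulled back area form and the Dirichlet energy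
density. -/
lemma two_mul_abs_flux_le {z m a b c : E3} (hz : ‖z‖ ≤ 1) :
    2 * |z 0 * tripleProduct m b c + z 1 * tripleProduct m c a + z 2 * tripleProduct m a b|
      ≤ ‖m‖ * (‖a‖ ^ 2 + ‖b‖ ^ 2 + ‖c‖ ^ 2) := by
  set p : E3 := z 2 • b - z 1 • c with hp
  set q : E3 := z 0 • c - z 2 • a with hq
  set r : E3 := z 1 • a - z 0 • b with hr
  -- For each `i`, `(p i, q i, r i)` is the cross product of `(a i, b i, c i)` with `z`, so passing
  -- from `a, b, c` to `p, q, r` does not increase the total square length. On the right each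
  -- determinant occurs twice, which balances the factor `1 / 2` of the arithmetic-geometric mean
  -- inequality used in `T`.
  have key : 2 * (z 0 * tripleProduct m b c + z 1 * tripleProduct m c a
      + z 2 * tripleProduct m a b) =
      tripleProduct m a p + tripleProduct m b q + tripleProduct m c r := by
    simp [tripleProduct_eq, hp, hq, hr]; ring
  have T : ∀ x y : E3, |tripleProduct m x y| ≤ ‖m‖ * ((‖x‖ ^ 2 + ‖y‖ ^ 2) / 2) := by
    intro x y
    have h1 := cross_mul_le x y
    set w : E3 := !₂[x 1 * y 2 - x 2 * y 1, x 2 * y 0 - x 0 * y 2, x 0 * y 1 - x 1 * y 0] with hw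
    have h2 : tripleProduct m x y = ⟪m, w⟫ := by
      rw [tripleProduct_eq, E3.inner_eq]; simp [hw]
    have h3 : ‖w‖ ^ 2 ≤ (‖x‖ * ‖y‖) ^ 2 := by
      rw [mul_pow]; refine le_trans (le_of_eq ?_) h1; rw [E3.norm_sq_eq]; simp [hw]
    have h4 : ‖w‖ ≤ ‖x‖ * ‖y‖ := by
      exact (sq_le_sq₀ (norm_nonneg _) (by positivity)).1 h3
    rw [h2]
    refine (abs_real_inner_le_norm m w).trans (mul_le_mul_of_nonneg_left ?_ (norm_nonneg _))
    nlinarith [sq_nonneg (‖x‖ - ‖y‖)]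
  have hpqr : ‖p‖ ^ 2 + ‖q‖ ^ 2 + ‖r‖ ^ 2 ≤ ‖a‖ ^ 2 + ‖b‖ ^ 2 + ‖c‖ ^ 2 := by
    have hz2 : ‖z‖ ^ 2 ≤ 1 := by nlinarith [norm_nonneg z]
    have h : ∀ i, (p i) ^ 2 + (q i) ^ 2 + (r i) ^ 2 ≤ (a i) ^ 2 + (b i) ^ 2 + (c i) ^ 2 := by
      intro i
      have h1 := cross_mul_le z !₂[a i, b i, c i]
      rw [E3.norm_sq_eq !₂[a i, b i, c i]] at h1
      simp only [Matrix.cons_val_zero, Matrix.cons_val_one, Matrix.cons_val] at h1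
      have e1 : p i = z 2 * b i - z 1 * c i := by simp [hp]
      have e2 : q i = z 0 * c i - z 2 * a i := by simp [hq]
      have e3 : r i = z 1 * a i - z 0 * b i := by simp [hr]
      rw [e1, e2, e3]
      nlinarith [sq_nonneg (a i), sq_nonneg (b i), sq_nonneg (c i)]
    simp only [E3.norm_sq_eq]
    linarith [h 0, h 1, h 2]
  have : 2 * |z 0 * tripleProduct m b c + z 1 * tripleProduct m c a + z 2 * tripleProduct m a b|
      = |tripleProduct m a p + tripleProduct m b q + tripleProduct m c r| := by
    rw [← key, abs_mul, abs_two]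
  rw [this]
  refine (abs_add_three _ _ _).trans ?_
  nlinarith [T a p, T b q, T c r, norm_nonneg m]

lemma abs_fluxDensity_le {F : E3 → ℝ} {m : E3 → E3} {φ : E3 → ℝ} {x : E3}
    (hφ : ‖fderiv ℝ φ x‖ ≤ 1) :
    2 * |fluxDensity F m φ x| ≤ |F (m x)| * ‖m x‖ * ∑ i, ‖partialDeriv i m x‖ ^ 2 := by
  set z : E3 := !₂[partialDeriv 0 φ x, partialDeriv 1 φ x, partialDeriv 2 φ x] with hz
  have hz1 : ‖z‖ ≤ 1 := by
    have h1 : fderiv ℝ φ x z = ‖z‖ ^ 2 := by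
      rw [fderiv_apply_eq_partialDeriv, E3.norm_sq_eq]; simp [hz, sq]
    have h2 := (fderiv ℝ φ x).le_opNorm z
    rw [h1, Real.norm_of_nonneg (by positivity)] at h2
    by_contra! h
    nlinarith
  have := two_mul_abs_flux_le (m := m x) (a := partialDeriv 0 m x) (b := partialDeriv 1 m x)
    (c := partialDeriv 2 m x) hz1
  simp only [hz, Matrix.cons_val_zero, Matrix.cons_val_one, Matrix.cons_val,
    PiLp.toLp_apply] at this
  rw [fluxDensity, abs_mul, Fin.sum_univ_three]
  nlinarith [mul_le_mul_of_nonneg_left this (abs_nonneg (F (m x)))]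

/-- Equality in Cauchy–Schwarz: `e₁ × e₂` has length at most one, and its inner product with the
unit vector `u` is one. -/
lemma eq_cross_of_orthonormal {e₁ e₂ u : E3} (ho : Orthonormal ℝ ![e₁, e₂, u])
    (hpos : tripleProduct e₁ e₂ u = 1) :
    u 0 = e₁ 1 * e₂ 2 - e₁ 2 * e₂ 1 ∧ u 1 = e₁ 2 * e₂ 0 - e₁ 0 * e₂ 2 ∧
      u 2 = e₁ 0 * e₂ 1 - e₁ 1 * e₂ 0 := by
  have h1 : ‖e₁‖ = 1 := ho.1 0
  have h2 : ‖e₂‖ = 1 := ho.1 1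
  have h3 : ‖u‖ = 1 := ho.1 2
  set w : E3 := !₂[e₁ 1 * e₂ 2 - e₁ 2 * e₂ 1, e₁ 2 * e₂ 0 - e₁ 0 * e₂ 2,
    e₁ 0 * e₂ 1 - e₁ 1 * e₂ 0] with hw
  have hw1 : ‖w‖ ^ 2 ≤ 1 := by
    have := cross_mul_le e₁ e₂
    rw [h1, h2] at this
    rw [E3.norm_sq_eq]; simpa [hw] using this
  have hwu : ⟪u, w⟫ = 1 := by
    rw [← hpos, tripleProduct_eq, E3.inner_eq]; simp [hw]; ring
  have : ‖u - w‖ ^ 2 ≤ 0 := by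
    rw [norm_sub_sq_real, hwu, h3]; linarith
  have : u - w = 0 := by
    rw [← norm_eq_zero]; nlinarith [norm_nonneg (u - w)]
  have huw : u = w := sub_eq_zero.1 this
  simp [huw, hw]

/-- The gradient of the step is a multiple of `u = e₁ × e₂`, so only the flux through the planes
orthogonal to `u` remains. -/
lemma fluxDensity_comp_inner {F : E3 → ℝ} {m : E3 → E3} {θ : ℝ → ℝ} {e₁ e₂ u x : E3}
    (ho : Orthonormal ℝ ![e₁, e₂, u]) (hpos : tripleProduct e₁ e₂ u = 1)
    (hθ : DifferentiableAt ℝ θ ⟪u, x⟫) :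
    fluxDensity F m (fun x => θ ⟪u, x⟫) x =
      deriv θ ⟪u, x⟫ * (F (m x) * tripleProduct (m x) (fderiv ℝ m x e₁) (fderiv ℝ m x e₂)) := by
  obtain ⟨h0, h1, h2⟩ := eq_cross_of_orthonormal ho hpos
  have : ∀ i, partialDeriv i (fun x : E3 => θ ⟪u, x⟫) x = deriv θ ⟪u, x⟫ * u i := by
    intro i
    have hd : HasFDerivAt (fun x : E3 => ⟪u, x⟫) (innerSL ℝ u) x := (innerSL ℝ u).hasFDerivAt
    have := hθ.hasDerivAt.comp_hasFDerivAt x hd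
    unfold partialDeriv
    rw [HasFDerivAt.fderiv (f := fun x : E3 => θ ⟪u, x⟫) this]
    simp [E3.inner_eq]
    fin_cases i <;> simp
  simp only [fluxDensity, this, fderiv_apply_eq_partialDeriv m, tripleProduct_eq, h0, h1, h2]
  simp
  ring

/-! ### Mollification on three-space. -/

open Filter Topology in
lemma IsCompact.eventually_forall_of_eventually_prod {X ι : Type*} [TopologicalSpace X] {K : Set X}
    (hK : IsCompact K) {l : Filter ι} {p : ι → X → Prop}
    (h : ∀ x ∈ K, ∀ᶠ z : ι × X in l ×ˢ 𝓝 x, p z.1 z.2) : ∀ᶠ i in l, ∀ x ∈ K, p i x := by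
  have h' : ∀ᶠ z : ι × X in l ×ˢ 𝓝ˢ K, p z.1 z.2 := by
    rw [hK.prod_nhdsSet_eq_biSup]
    simpa only [eventually_iSup] using h
  exact h'.curry.mono fun _ h ↦ h.self_of_nhdsSet

/-- A fixed approximate identity on three-space. -/
def mollifier (k : ℕ) : ContDiffBump (0 : E3) where
  rIn := 1 / (k + 2)
  rOut := 1 / (k + 1)
  rIn_pos := by positivity
  rIn_lt_rOut := by gcongr; norm_num

/-- The normalized kernel of the approximate identity. -/
def kernel (k : ℕ) : E3 → ℝ := (mollifier k).normed volume

/-- The radius of the support of `kernel k`. -/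
def kernelRadius (k : ℕ) : ℝ := 1 / (k + 1)

lemma tendsto_kernelRadius : Filter.Tendsto kernelRadius Filter.atTop (nhds 0) :=
  tendsto_one_div_add_atTop_nhds_zero_nat

lemma kernel_nonneg (k : ℕ) (x : E3) : 0 ≤ kernel k x := (mollifier k).nonneg_normed x

lemma integral_kernel (k : ℕ) : ∫ x, kernel k x = 1 := (mollifier k).integral_normed

lemma integrable_kernel (k : ℕ) : Integrable (kernel k) := (mollifier k).integrable_normed

lemma contDiff_kernel (k : ℕ) : ContDiff ℝ ∞ (kernel k) :=
  ContDiffBump.contDiff_normed (n := ⊤) (mollifier k)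

lemma support_kernel (k : ℕ) : Function.support (kernel k) = Metric.ball 0 (kernelRadius k) :=
  (mollifier k).support_normed_eq

lemma hasCompactSupport_kernel (k : ℕ) : HasCompactSupport (kernel k) :=
  (mollifier k).hasCompactSupport_normed

lemma mem_ball_of_kernel_ne_zero {k : ℕ} {x y : E3} (h : kernel k (x - y) ≠ 0) :
    y ∈ Metric.ball x (kernelRadius k) := by
  have : x - y ∈ Metric.ball (0 : E3) (kernelRadius k) := by
    rw [← support_kernel]; exact h
  rw [Metric.mem_ball, dist_comm, dist_eq_norm]
  simpa using this

section Mollify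

variable {G : Type*} [NormedAddCommGroup G] [NormedSpace ℝ G]

/-- Convolution with the approximate identity. -/
def mollify (k : ℕ) (M : E3 → G) : E3 → G :=
  convolution (kernel k) M (ContinuousLinearMap.lsmul ℝ ℝ) volume

lemma mollify_apply (k : ℕ) (M : E3 → G) (x : E3) :
    mollify k M x = ∫ y, kernel k (x - y) • M y := convolution_lsmul_swap

lemma mollify_apply' (k : ℕ) (M : E3 → G) (x : E3) :
    mollify k M x = ∫ y, kernel k y • M (x - y) := rfl

lemma contDiff_mollify (k : ℕ) {M : E3 → G} (hM : LocallyIntegrable M) :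
    ContDiff ℝ ∞ (mollify k M) :=
  (hasCompactSupport_kernel k).contDiff_convolution_left (n := ⊤) _ (contDiff_kernel k) hM

lemma hasCompactSupport_mollify (k : ℕ) {M : E3 → G} (hM : HasCompactSupport M) :
    HasCompactSupport (mollify k M) := (hasCompactSupport_kernel k).convolution _ hM

lemma mollify_congr {k : ℕ} {M N : E3 → G} {x : E3}
    (h : ∀ y ∈ Metric.ball x (kernelRadius k), M y = N y) : mollify k M x = mollify k N x := by
  rw [mollify_apply, mollify_apply]
  congr 1
  ext y
  by_cases hy : kernel k (x - y) = 0
  · simp [hy]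
  · rw [h y (mem_ball_of_kernel_ne_zero hy)]

/-- The derivative has to fall on the kernel, since a field extended by zero jumps across the faces.
-/
lemma fderiv_mollify_apply (k : ℕ) {M : E3 → G} (hM : LocallyIntegrable M) (x v : E3) :
    fderiv ℝ (mollify k M) x v = ∫ y, fderiv ℝ (kernel k) (x - y) v • M y := by
  have h := (hasCompactSupport_kernel k).hasFDerivAt_convolution_left
    (ContinuousLinearMap.lsmul ℝ ℝ) ((contDiff_kernel k).of_le (by simp)) hM x
  have h2 := h.fderiv
  change fderiv ℝ (mollify k M) x = _ at h2
  rw [h2, convolution_eq_swap]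
  have hint : Integrable (fun t => (ContinuousLinearMap.precompL E3
      (ContinuousLinearMap.lsmul ℝ ℝ : ℝ →L[ℝ] G →L[ℝ] G)) (fderiv ℝ (kernel k) (x - t)) (M t)) :=
    (((hasCompactSupport_kernel k).fderiv ℝ).convolutionExists_left _
      ((contDiff_kernel k).continuous_fderiv (by simp)) hM x).integrable_swap
  rw [ContinuousLinearMap.integral_apply hint]
  simp

lemma fderiv_mollify_apply_eq_mollify (k : ℕ) {M : E3 → G} (hM : ContDiff ℝ 1 M)
    (hMc : HasCompactSupport M) (x v : E3) :
    fderiv ℝ (mollify k M) x v = mollify k (fun y => fderiv ℝ M y v) x := by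
  have h := hMc.hasFDerivAt_convolution_right
    (ContinuousLinearMap.lsmul ℝ ℝ) (integrable_kernel k).locallyIntegrable hM x
  have h2 := h.fderiv
  change fderiv ℝ (mollify k M) x = _ at h2
  rw [h2, convolution_precompR_apply _ (integrable_kernel k).locallyIntegrable (hMc.fderiv ℝ)
    (hM.continuous_fderiv one_ne_zero)]
  rfl

lemma tendsto_mollify {M : E3 → G} [CompleteSpace G] (hM : Continuous M) (x : E3) :
    Filter.Tendsto (fun k => mollify k M x) Filter.atTop (nhds (M x)) :=
  ContDiffBump.convolution_tendsto_right_of_continuous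
    (φ := mollifier) tendsto_kernelRadius hM x

/-- The probability measure with density `kernel k (x - ·)`. -/
def kernelMeasure (k : ℕ) (x : E3) : Measure E3 :=
  volume.withDensity fun y => ENNReal.ofReal (kernel k (x - y))

lemma measurable_ofReal_kernel (k : ℕ) (x : E3) :
    Measurable fun y => ENNReal.ofReal (kernel k (x - y)) :=
  ENNReal.measurable_ofReal.comp
    ((contDiff_kernel k).continuous.comp (continuous_const.sub continuous_id)).measurable

lemma lintegral_kernel (k : ℕ) (x : E3) : ∫⁻ y, ENNReal.ofReal (kernel k (x - y)) = 1 := by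
  rw [← ofReal_integral_eq_lintegral_ofReal ((integrable_kernel k).comp_sub_left x)
    (Filter.Eventually.of_forall fun y => kernel_nonneg k _), integral_sub_left_eq_self,
    integral_kernel, ENNReal.ofReal_one]

lemma lintegral_kernel' (k : ℕ) (y : E3) : ∫⁻ x, ENNReal.ofReal (kernel k (x - y)) = 1 := by
  rw [← ofReal_integral_eq_lintegral_ofReal ((integrable_kernel k).comp_sub_right y)
    (Filter.Eventually.of_forall fun y => kernel_nonneg k _), integral_sub_right_eq_self,
    integral_kernel, ENNReal.ofReal_one]

instance (k : ℕ) (x : E3) : IsProbabilityMeasure (kernelMeasure k x) :=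
  ⟨by rw [kernelMeasure, withDensity_apply _ MeasurableSet.univ, Measure.restrict_univ,
    lintegral_kernel]⟩

lemma mollify_eq_integral (k : ℕ) (M : E3 → G) (x : E3) :
    mollify k M x = ∫ y, M y ∂kernelMeasure k x := by
  rw [mollify_apply, kernelMeasure, integral_withDensity_eq_integral_toReal_smul
    (measurable_ofReal_kernel k x) (by simp)]
  simp [ENNReal.toReal_ofReal, kernel_nonneg]

lemma integrable_kernelMeasure (k : ℕ) {M : E3 → G} (hM : LocallyIntegrable M) (x : E3) :
    Integrable M (kernelMeasure k x) := by
  rw [kernelMeasure, integrable_withDensity_iff_integrable_smul' (measurable_ofReal_kernel k x)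
    (by simp)]
  simp only [ENNReal.toReal_ofReal, kernel_nonneg]
  refine hM.integrable_smul_left_of_hasCompactSupport
    ((contDiff_kernel k).continuous.comp (continuous_const.sub continuous_id)) ?_
  exact (hasCompactSupport_kernel k).comp_homeomorph (Homeomorph.subLeft x)

lemma ae_kernelMeasure (k : ℕ) (x : E3) {p : E3 → Prop}
    (h : ∀ y ∈ Metric.ball x (kernelRadius k), p y) : ∀ᵐ y ∂kernelMeasure k x, p y := by
  rw [kernelMeasure, ae_withDensity_iff (measurable_ofReal_kernel k x)]
  refine Filter.Eventually.of_forall fun y hy => h y (mem_ball_of_kernel_ne_zero ?_)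
  intro h0
  simp [h0] at hy

/-- The mollified value is the mean of `M` for a probability measure carried by the ball, so closed
convex constraints survive. -/
lemma mollify_mem [CompleteSpace G] {k : ℕ} {M : E3 → G} (hM : LocallyIntegrable M) {x : E3}
    {Q : Set G} (hQ : Convex ℝ Q) (hQc : IsClosed Q)
    (h : ∀ y ∈ Metric.ball x (kernelRadius k), M y ∈ Q) : mollify k M x ∈ Q := by
  rw [mollify_eq_integral]
  exact hQ.integral_mem hQc (ae_kernelMeasure k x h) (integrable_kernelMeasure k hM x)

open Filter Topology in
lemma eventually_ball_kernelRadius {x : E3} {N : Set E3} (hN : N ∈ 𝓝 x) :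
    ∀ᶠ z : ℕ × E3 in atTop ×ˢ 𝓝 x, Metric.ball z.2 (kernelRadius z.1) ⊆ N := by
  obtain ⟨r, hr, hrN⟩ := Metric.mem_nhds_iff.1 hN
  have h1 : ∀ᶠ k in atTop, kernelRadius k < r / 2 :=
    tendsto_kernelRadius.eventually_lt_const (by positivity)
  have h2 : ∀ᶠ y in 𝓝 x, dist y x < r / 2 := Metric.ball_mem_nhds x (by positivity)
  filter_upwards [h1.prod_mk h2] with z hz
  refine subset_trans (Metric.ball_subset_ball' ?_) hrN
  linarith [hz.1, hz.2]

open Filter Topology in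
lemma eventually_mollify_mem [CompleteSpace G] {M : E3 → G} (hM : LocallyIntegrable M) {x : E3}
    {Q : Set G} (hQ : Convex ℝ Q) (hQc : IsClosed Q) (h : ∀ᶠ y in 𝓝 x, M y ∈ Q) :
    ∀ᶠ z : ℕ × E3 in atTop ×ˢ 𝓝 x, mollify z.1 M z.2 ∈ Q := by
  filter_upwards [eventually_ball_kernelRadius h] with z hz
  exact mollify_mem hM hQ hQc fun y hy => hz hy

lemma norm_mollify_le [CompleteSpace G] {k : ℕ} {M : E3 → G} (hM : LocallyIntegrable M) {x : E3}
    {C : ℝ} (h : ∀ y, ‖M y‖ ≤ C) : ‖mollify k M x‖ ≤ C := by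
  have := mollify_mem (k := k) (x := x) hM (convex_closedBall (0 : G) C) Metric.isClosed_closedBall
    (fun y _ => by simpa using h y)
  simpa using this

/-- Jensen's inequality for an average. -/
lemma enorm_mollify_sq_le {k : ℕ} {M : E3 → G} (hM : LocallyIntegrable M) (x : E3) :
    ‖mollify k M x‖ₑ ^ 2 ≤ ∫⁻ y, ENNReal.ofReal (kernel k (x - y)) * ‖M y‖ₑ ^ 2 := by
  have hi := integrable_kernelMeasure k hM x
  have h1 : ‖mollify k M x‖ₑ ≤ eLpNorm M 2 (kernelMeasure k x) := by
    rw [mollify_eq_integral]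
    refine (enorm_integral_le_lintegral_enorm _).trans ?_
    rw [← eLpNorm_one_eq_lintegral_enorm]
    exact eLpNorm_le_eLpNorm_of_exponent_le (by norm_num) hi.aestronglyMeasurable
  have h2 : eLpNorm M 2 (kernelMeasure k x) ^ 2 = ∫⁻ y, ‖M y‖ₑ ^ 2 ∂kernelMeasure k x := by
    rw [eLpNorm_eq_lintegral_rpow_enorm_toReal (by norm_num) (by norm_num)]
    simp only [ENNReal.toReal_ofNat, ENNReal.rpow_ofNat]
    rw [← ENNReal.rpow_natCast, ← ENNReal.rpow_mul]
    norm_num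
  calc ‖mollify k M x‖ₑ ^ 2 ≤ eLpNorm M 2 (kernelMeasure k x) ^ 2 := by gcongr
    _ = _ := by
      rw [h2, kernelMeasure, lintegral_withDensity_eq_lintegral_mul_non_measurable _
        (measurable_ofReal_kernel k x) (by simp)]
      rfl

lemma lintegral_lintegral_kernel (k : ℕ) {h : E3 → ℝ≥0∞} (hh : AEMeasurable h) :
    ∫⁻ x, ∫⁻ y, ENNReal.ofReal (kernel k (x - y)) * h y = ∫⁻ y, h y := by
  rw [lintegral_lintegral_swap]
  · refine lintegral_congr fun y => ?_
    rw [lintegral_mul_const, lintegral_kernel', one_mul]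
    exact ENNReal.measurable_ofReal.comp
      ((contDiff_kernel k).continuous.comp (continuous_id.sub continuous_const)).measurable
  · refine AEMeasurable.mul ?_ hh.comp_snd
    exact (ENNReal.measurable_ofReal.comp ((contDiff_kernel k).continuous.comp
      (continuous_fst.sub continuous_snd)).measurable).aemeasurable

lemma lipschitzWith_mollify (k : ℕ) {f : E3 → ℝ} (hf : LipschitzWith 1 f) :
    LipschitzWith 1 (mollify k f) := by
  refine LipschitzWith.of_dist_le_mul fun x y => ?_
  have hi : ∀ x : E3, Integrable fun t => kernel k t • f (x - t) := fun x =>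
    ((contDiff_kernel k).continuous.smul
      (hf.continuous.comp (continuous_const.sub continuous_id))).integrable_of_hasCompactSupport
      (hasCompactSupport_kernel k).smul_right
  rw [dist_eq_norm, mollify_apply', mollify_apply', ← integral_sub (hi x) (hi y)]
  refine (norm_integral_le_of_norm_le ((integrable_kernel k).mul_const (dist x y))
    (Filter.Eventually.of_forall fun t => ?_)).trans ?_
  · rw [← smul_sub, norm_smul, Real.norm_of_nonneg (kernel_nonneg k t)]
    refine mul_le_mul_of_nonneg_left ?_ (kernel_nonneg k t)
    have := hf.dist_le_mul (x - t) (y - t)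
    simpa [dist_eq_norm] using this
  · rw [integral_mul_const, integral_kernel]; simp

namespace ConvexPolyhedron

/-- The extension of a field by zero. -/
def extend (P : ConvexPolyhedron) (n : E3 → E3) : E3 → E3 := P.domain.indicator n

/-- The reflected and translated kernel is itself a test function for the weak gradient; its support
lies in the interior, where the jump of the extension is not seen. -/
lemma partialDeriv_mollify_extend {P : ConvexPolyhedron} {n : E3 → E3} {G : Fin 3 → E3 → E3}
    (hP : interior P.body ⊆ P.domain) (hG : P.IsWeakGradient n G) (hn : LocallyIntegrable (P.extend n)) {k : ℕ} {x : E3}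
    (hx : Metric.closedBall x (kernelRadius k) ⊆ interior P.body) (i : Fin 3) :
    partialDeriv i (mollify k (P.extend n)) x =
      ∫ y in interior P.body, kernel k (x - y) • G i y := by
  set φ : E3 → ℝ := fun y => kernel k (x - y) with hφ
  have h1 : ContDiff ℝ ∞ φ := (contDiff_kernel k).comp (contDiff_const.sub contDiff_id)
  have h2 : HasCompactSupport φ :=
    (hasCompactSupport_kernel k).comp_homeomorph (Homeomorph.subLeft x)
  have h3 : tsupport φ ⊆ Metric.closedBall x (kernelRadius k) :=
    closure_minimal (fun y hy => Metric.ball_subset_closedBall (mem_ball_of_kernel_ne_zero hy))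
      Metric.isClosed_closedBall
  have h4 := (hG i).2 φ h1 h2 (h3.trans hx)
  have hd : ∀ y v, fderiv ℝ φ y v = - fderiv ℝ (kernel k) (x - y) v := by
    intro y v
    have e1 : HasFDerivAt (fun y : E3 => x - y) (-ContinuousLinearMap.id ℝ E3) y := 
      (hasFDerivAt_id y).const_sub x
    have e2 := (((contDiff_kernel k).differentiable (by simp)) (x - y)).hasFDerivAt.comp y e1
    rw [HasFDerivAt.fderiv (f := φ) e2]; simp
  rw [partialDeriv, fderiv_mollify_apply k hn, ← neg_inj, ← integral_neg, ← h4,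
    ← integral_indicator isOpen_interior.measurableSet]
  congr 1
  ext1 y
  by_cases hy : y ∈ interior P.body
  · rw [indicator_of_mem hy, hd, extend, indicator_of_mem (hP hy)]; simp
  · rw [indicator_of_notMem hy]
    have : y ∉ tsupport (fderiv ℝ φ) := fun h => hy (hx (h3 (tsupport_fderiv_subset ℝ h)))
    have h0 := image_eq_zero_of_notMem_tsupport this
    have := hd y (EuclideanSpace.single i 1)
    rw [h0] at this
    simp only [zero_apply] at this
    rw [← neg_smul, ← this, zero_smul]

end ConvexPolyhedron

end Mollify

/-! ### Faces and the boundary of the polyhedron. -/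

namespace ConvexPolyhedron

variable (P : ConvexPolyhedron)

lemma convex_body : Convex ℝ P.body := convex_convexHull ℝ _

lemma isCompact_body : IsCompact P.body := P.vertices.finite_toSet.isCompact_convexHull ℝ

lemma isClosed_body : IsClosed P.body := P.isCompact_body.isClosed

variable {P}

lemma mem_supportSet {ν x : E3} :
    x ∈ P.supportSet ν ↔ x ∈ P.body ∧ ∀ y ∈ P.body, ⟪ν, y⟫ ≤ ⟪ν, x⟫ := Iff.rfl

lemma inner_eq_of_mem_supportSet {ν x y : E3} (hx : x ∈ P.supportSet ν)
    (hy : y ∈ P.supportSet ν) : ⟪ν, x⟫ = ⟪ν, y⟫ :=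
  le_antisymm (hy.2 x hx.1) (hx.2 y hy.1)

lemma exists_inner_lt_of_mem_interior {ν x : E3} (hν : ν ≠ 0) (hx : x ∈ interior P.body) :
    ∃ y ∈ P.body, ⟪ν, x⟫ < ⟪ν, y⟫ := by
  have hc : Filter.Tendsto (fun t : ℝ => x + t • ν) (nhdsWithin 0 (Ioi 0)) (nhds x) := by
    have : Continuous fun t : ℝ => x + t • ν := by fun_prop
    have h := (this.tendsto 0).mono_left (nhdsWithin_le_nhds (s := Ioi 0))
    simpa using h
  have h1 := hc.eventually (mem_interior_iff_mem_nhds.1 hx)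
  obtain ⟨t, ht, ht0⟩ := (h1.and self_mem_nhdsWithin).exists
  refine ⟨_, ht, ?_⟩
  rw [inner_add_right, inner_smul_right, real_inner_self_eq_norm_sq]
  have := norm_pos_iff.2 hν
  have : 0 < t * ‖ν‖ ^ 2 := mul_pos ht0 (by positivity)
  linarith

lemma inner_le_of_forall_vertex {ν y : E3} {m : ℝ} (h : ∀ v ∈ P.vertices, ⟪ν, v⟫ ≤ m)
    (hy : y ∈ P.body) : ⟪ν, y⟫ ≤ m := by
  have hc : Convex ℝ {y : E3 | ⟪ν, y⟫ ≤ m} := convex_halfSpace_le (innerSL ℝ ν).isLinear m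
  exact convexHull_min (fun v hv => h v hv) hc hy

/-- A support set is spanned by the vertices that it contains. -/
lemma supportSet_eq_convexHull (ν : E3) :
    ∃ T : Finset E3, T ⊆ P.vertices ∧ P.supportSet ν = convexHull ℝ (T : Set E3) := by
  classical
  refine ⟨P.vertices.filter fun v => v ∈ P.supportSet ν, Finset.filter_subset _ _, ?_⟩
  refine Subset.antisymm (fun x hx => ?_) ?_
  · obtain ⟨w, hw0, hw1, hwx⟩ := Finset.mem_convexHull.1 hx.1
    have hx' : x = ∑ v ∈ P.vertices, w v • v := by
      rw [← hwx, Finset.centerMass_eq_of_sum_1 _ _ hw1]; rfl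
    -- If a convex combination of vertices is extreme in the direction `ν`, then so is each vertex
    -- of non-zero weight.
    have hsum : ∑ v ∈ P.vertices, w v * (⟪ν, x⟫ - ⟪ν, v⟫) = 0 := by
      have : ⟪ν, x⟫ = ∑ v ∈ P.vertices, w v * ⟪ν, v⟫ := by
        conv_lhs => rw [hx', inner_sum]
        simp [inner_smul_right]
      simp only [mul_sub, Finset.sum_sub_distrib]
      rw [← Finset.sum_mul, hw1, ← this]; ring
    have hz := (Finset.sum_eq_zero_iff_of_nonneg fun v hv =>
      mul_nonneg (hw0 v hv) (sub_nonneg.2 (hx.2 v (subset_convexHull ℝ _ hv)))).1 hsum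
    rw [← hwx, ← Finset.centerMass_filter_ne_zero]
    refine Finset.centerMass_mem_convexHull _ (fun v hv => hw0 v (Finset.mem_filter.1 hv).1) ?_ ?_
    · rw [Finset.sum_filter_ne_zero, hw1]; exact one_pos
    · intro v hv
      obtain ⟨hv1, hv2⟩ := Finset.mem_filter.1 hv
      have hv3 : ⟪ν, x⟫ = ⟪ν, v⟫ := by
        have := (mul_eq_zero.1 (hz v hv1)).resolve_left hv2
        exact sub_eq_zero.1 this
      refine Finset.mem_coe.2 (Finset.mem_filter.2 ⟨hv1, subset_convexHull ℝ _ hv1, fun y hy => ?_⟩)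
      exact (hx.2 y hy).trans hv3.le
  · refine convexHull_min (fun v hv => (Finset.mem_filter.1 hv).2) ?_
    exact (ContinuousLinearMap.toExposed.isExposed (𝕜 := ℝ) (l := innerSL ℝ ν)).convex P.convex_body

lemma finite_range_supportSet : (range P.supportSet).Finite := by
  have : range P.supportSet ⊆ (fun T : Finset E3 => convexHull ℝ (T : Set E3)) ''
      (P.vertices.powerset : Set (Finset E3)) := by
    rintro _ ⟨ν, rfl⟩
    obtain ⟨T, hT, h⟩ := P.supportSet_eq_convexHull ν
    exact ⟨T, by simpa using hT, h.symm⟩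
  exact ((P.vertices.powerset.finite_toSet).image _).subset this

lemma isClosed_supportSet (ν : E3) : IsClosed (P.supportSet ν) :=
  (ContinuousLinearMap.toExposed.isExposed (𝕜 := ℝ) (l := innerSL ℝ ν)).isClosed P.isClosed_body

lemma vectorSpan_supportSet_le (ν : E3) :
    vectorSpan ℝ (P.supportSet ν) ≤ (Submodule.span ℝ {ν})ᗮ := by
  rw [vectorSpan_def, Submodule.span_le]
  rintro _ ⟨x, hx, y, hy, rfl⟩
  rw [SetLike.mem_coe, Submodule.mem_orthogonal_singleton_iff_inner_right]
  change ⟪ν, x - y⟫ = 0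
  rw [inner_sub_right, inner_eq_of_mem_supportSet hx hy, sub_self]

lemma finrank_orthogonal_singleton {ν : E3} (hν : ν ≠ 0) :
    Module.finrank ℝ (Submodule.span ℝ {ν})ᗮ = 2 := by
  have h := Submodule.finrank_add_finrank_orthogonal (Submodule.span ℝ {ν})
  rw [finrank_span_singleton hν] at h
  simp at h
  omega

lemma Face.norm_normal (c : P.Face) : ‖c.normal‖ = 1 := c.2.1

lemma Face.normal_ne_zero (c : P.Face) : c.normal ≠ 0 := by
  rw [← norm_pos_iff, c.norm_normal]; exact one_pos

/-- A face spans the plane orthogonal to its normal, which determines the normal up to sign. A point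
extreme for both signs would confine the polyhedron to a plane. Together with
`finite_range_supportSet` this makes the set of faces finite. -/
lemma Face.carrier_injective : Function.Injective (Face.carrier : P.Face → Set E3) := by
  intro c c' h
  have hV : vectorSpan ℝ (P.supportSet c.normal) = (Submodule.span ℝ {c.normal})ᗮ :=
    Submodule.eq_of_le_of_finrank_eq (vectorSpan_supportSet_le _)
      (by rw [finrank_orthogonal_singleton c.normal_ne_zero]; exact c.2.2)
  have hV' : vectorSpan ℝ (P.supportSet c'.normal) = (Submodule.span ℝ {c'.normal})ᗮ :=
    Submodule.eq_of_le_of_finrank_eq (vectorSpan_supportSet_le _)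
      (by rw [finrank_orthogonal_singleton c'.normal_ne_zero]; exact c'.2.2)
  have hspan : Submodule.span ℝ {c.normal} = Submodule.span ℝ {c'.normal} := by
    have : (Submodule.span ℝ {c.normal})ᗮ = (Submodule.span ℝ {c'.normal})ᗮ := by
      rw [← hV, ← hV']; exact congrArg _ h
    rw [← Submodule.orthogonal_orthogonal (Submodule.span ℝ {c.normal}), this,
      Submodule.orthogonal_orthogonal]
  obtain ⟨r, hr⟩ := Submodule.mem_span_singleton.1
    (hspan ▸ Submodule.mem_span_singleton_self c'.normal : c'.normal ∈ Submodule.span ℝ {c.normal})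
  have hr1 : |r| = 1 := by
    have := congrArg norm hr
    rwa [norm_smul, c.norm_normal, c'.norm_normal, mul_one] at this
  rcases (abs_eq one_pos.le).1 hr1 with h1 | h1
  · exact Subtype.ext (by rw [h1, one_smul] at hr; exact hr)
  · exfalso
    rw [h1, neg_one_smul] at hr
    have hne : (P.supportSet c.normal).Nonempty := by
      rw [nonempty_iff_ne_empty]
      intro he
      have := c.2.2
      change Module.finrank ℝ (vectorSpan ℝ (P.supportSet c.normal)) = 2 at this
      rw [he, vectorSpan_empty, finrank_bot] at this
      omega
    obtain ⟨z, hz⟩ := hne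
    have hz' : z ∈ P.supportSet c'.normal := by
      have : z ∈ c.carrier := hz
      rw [h] at this; exact this
    obtain ⟨x, hx⟩ := P.interior_nonempty
    obtain ⟨y, hy, hxy⟩ := exists_inner_lt_of_mem_interior c.normal_ne_zero hx
    have h1 := hz.2 y hy
    have h2 := hz'.2 x (interior_subset hx)
    rw [← hr] at h2
    simp only [innerSL_apply_apply, inner_neg_left] at h1 h2
    linarith

instance : Finite P.Face := by
  have : Finite (range P.supportSet) := P.finite_range_supportSet
  refine Finite.of_injective (fun c : P.Face => (⟨c.carrier, c.normal, rfl⟩ : range P.supportSet))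
    fun c c' h => Face.carrier_injective (Subtype.ext_iff.1 h)

/-- The boundary of the polyhedron is covered by its two-dimensional faces. -/
lemma exists_face_of_notMem_interior {x : E3} (hx : x ∈ P.body) (hxi : x ∉ interior P.body) :
    ∃ c : P.Face, x ∈ c.carrier := by
  -- A measure argument. Radial projection `ζ` from an interior point `x₀` sends points near `x` to
  -- boundary points, still off the closed union `D` of the faces. A boundary point off `D` lies in
  -- a support set of dimension at most one, which together with `x₀` spans a proper affine
  -- subspace. Finitely many such subspaces would then cover a neighbourhood of `x`, although their
  -- union `N` is a null set.
  by_contra! hno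
  obtain ⟨x₀, hx₀⟩ := P.interior_nonempty
  change x₀ ∈ interior P.body at hx₀
  set D : Set E3 := ⋃ c : P.Face, c.carrier with hD
  have hDc : IsClosed D := isClosed_iUnion_of_finite fun c => isClosed_supportSet _
  have hxD : x ∉ D := by simpa [hD] using hno
  set B : Set E3 := (fun y => x₀ + y) ⁻¹' P.body with hB
  have hBc : Convex ℝ B := P.convex_body.translate_preimage_right x₀
  have hB0 : B ∈ nhds (0 : E3) := by
    have : ContinuousAt (fun y : E3 => x₀ + y) 0 := by fun_prop
    refine this.preimage_mem_nhds ?_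
    rw [add_zero]
    exact mem_interior_iff_mem_nhds.1 hx₀
  have hfr : ∀ z, gauge B z = 1 → x₀ + z ∈ P.body ∧ x₀ + z ∉ interior P.body := by
    intro z hz
    have hz' := (gauge_eq_one_iff_mem_frontier hBc hB0).1 hz
    have e : frontier B = (Homeomorph.addLeft x₀) ⁻¹' frontier P.body :=
      ((Homeomorph.addLeft x₀).preimage_frontier P.body).symm
    rw [e, P.isClosed_body.frontier_eq] at hz'
    exact hz'
  have hgx : gauge B (x - x₀) = 1 := by
    rw [gauge_eq_one_iff_mem_frontier hBc hB0]
    have e : frontier B = (Homeomorph.addLeft x₀) ⁻¹' frontier P.body :=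
      ((Homeomorph.addLeft x₀).preimage_frontier P.body).symm
    rw [e, P.isClosed_body.frontier_eq]
    simpa using And.intro hx hxi
  set N : Set E3 := ⋃ S ∈ {S ∈ range P.supportSet | affineSpan ℝ (insert x₀ S) ≠ ⊤},
    (affineSpan ℝ (insert x₀ S) : Set E3) with hN
  have hN0 : volume N = 0 := by
    rw [hN, measure_biUnion_null_iff (P.finite_range_supportSet.subset (sep_subset _ _)).countable]
    exact fun S hS => Measure.addHaar_affineSubspace _ _ hS.2
  have hcov : ∀ z ∈ P.body, z ∉ interior P.body → z ∉ D →
      ∃ S ∈ {S ∈ range P.supportSet | affineSpan ℝ (insert x₀ S) ≠ ⊤}, z ∈ S := by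
    intro z hz hzi hzD
    obtain ⟨f, hf0, hf⟩ := geometric_hahn_banach_of_nonempty_interior_point P.convex_body hzi
      P.interior_nonempty
    set ν₀ : E3 := (InnerProductSpace.toDual ℝ E3).symm f with hν₀
    have hfν : ∀ y, ⟪ν₀, y⟫ = f y := fun y => InnerProductSpace.toDual_symm_apply
    have hν₀0 : ν₀ ≠ 0 := by simpa [hν₀] using hf0
    have hpos : 0 < ‖ν₀‖⁻¹ := by positivity
    set ν : E3 := ‖ν₀‖⁻¹ • ν₀ with hν
    have hν1 : ‖ν‖ = 1 := by
      rw [hν, norm_smul, norm_inv, norm_norm, inv_mul_cancel₀ (norm_ne_zero_iff.2 hν₀0)]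
    have hν0 : ν ≠ 0 := by rw [← norm_pos_iff, hν1]; exact one_pos
    have hzν : z ∈ P.supportSet ν := by
      refine mem_supportSet.2 ⟨hz, fun y hy => ?_⟩
      rw [hν, inner_smul_left, inner_smul_left, hfν, hfν]
      exact mul_le_mul_of_nonneg_left (hf y hy) hpos.le
    refine ⟨P.supportSet ν, ⟨⟨ν, rfl⟩, fun htop => ?_⟩, hzν⟩
    have hne : Module.finrank ℝ (vectorSpan ℝ (P.supportSet ν)) ≠ 2 := fun h2 =>
      hzD (mem_iUnion.2 ⟨⟨ν, hν1, h2⟩, hzν⟩)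
    have hle : Module.finrank ℝ (vectorSpan ℝ (P.supportSet ν)) ≤ 2 := by
      rw [← finrank_orthogonal_singleton hν0]
      exact Submodule.finrank_mono (vectorSpan_supportSet_le ν)
    have h3 := finrank_vectorSpan_insert_le_set ℝ (P.supportSet ν) x₀
    rw [← direction_affineSpan, htop, AffineSubspace.direction_top, finrank_top] at h3
    simp at h3
    omega
  have hgc : Continuous (gauge B) := continuous_gauge hBc hB0
  set ζ : E3 → E3 := fun y => x₀ + (gauge B (y - x₀))⁻¹ • (y - x₀) with hζ
  have hζx : ζ x = x := by simp [hζ, hgx]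
  have hζc : ContinuousAt ζ x := by
    have h1 : ContinuousAt (fun y => gauge B (y - x₀)) x := by fun_prop
    have h2 : ContinuousAt (fun y => (gauge B (y - x₀))⁻¹) x := h1.inv₀ (by rw [hgx]; simp)
    exact continuousAt_const.add (h2.smul (by fun_prop))
  have hev1 : ∀ᶠ y in nhds x, ζ y ∉ D :=
    hζc.eventually (by rw [hζx]; exact hDc.isOpen_compl.mem_nhds hxD)
  have hev2 : ∀ᶠ y in nhds x, 0 < gauge B (y - x₀) := by
    have h1 : ContinuousAt (fun y => gauge B (y - x₀)) x := by fun_prop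
    exact h1.eventually_const_lt (by simp [hgx])
  have hNx : N ∈ nhds x := by
    filter_upwards [hev1, hev2] with y hy1 hy2
    have hg1 : gauge B ((gauge B (y - x₀))⁻¹ • (y - x₀)) = 1 := by
      rw [gauge_smul_of_nonneg (inv_nonneg.2 hy2.le), smul_eq_mul, inv_mul_cancel₀ hy2.ne']
    obtain ⟨h1, h2⟩ := hfr _ hg1
    obtain ⟨S, hS, hzS⟩ := hcov _ h1 h2 hy1
    refine mem_biUnion hS ?_
    have e : y = AffineMap.lineMap x₀ (ζ y) (gauge B (y - x₀)) := by
      simp [AffineMap.lineMap_apply, hζ, smul_smul, mul_inv_cancel₀ hy2.ne']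
    rw [e]
    exact AffineMap.lineMap_mem _ (subset_affineSpan ℝ _ (mem_insert _ _))
      (subset_affineSpan ℝ _ (mem_insert_of_mem _ hzS))
  exact (Measure.measure_pos_of_mem_nhds volume hNx).ne' hN0

lemma CleavedSurface.norm_u {v : E3} (C : P.CleavedSurface v) : ‖C.u‖ = 1 := C.orthonormal.1 2

/-- The form `⟪C.u, ·⟫` attains its maximum over the body at `v`. This is what places the interior
inside `P.domain`. -/
lemma CleavedSurface.notMem_interior {v : E3} (C : P.CleavedSurface v) :
    v ∉ interior P.body := by
  intro hv
  have hu : C.u ≠ 0 := by rw [← norm_pos_iff, C.norm_u]; exact one_pos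
  obtain ⟨y, hy, hlt⟩ := exists_inner_lt_of_mem_interior hu hv
  refine hlt.not_ge (inner_le_of_forall_vertex (fun w hw => ?_) hy)
  by_cases hwv : w = v
  · rw [hwv]
  · exact (C.other_lt w hw hwv).le.trans C.lt_vertex.le

end ConvexPolyhedron

/-! ### Smooth weights approximating the characteristic function of a sector. -/

namespace ConvexPolyhedron

variable {P : ConvexPolyhedron}

instance : Fintype P.Face := Fintype.ofFinite _

/-- The linear forms that are positive on a sector. -/
def Sector.form (σ : P.Sector) (c : P.Face) (y : E3) : ℝ :=
  ((σ.1 c : SignType) : ℝ) * ⟪y, c.normal⟫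

lemma Sector.continuous_form (σ : P.Sector) (c : P.Face) : Continuous (σ.form c) := by
  unfold Sector.form; fun_prop

lemma Sector.form_smul (σ : P.Sector) (c : P.Face) (t : ℝ) (y : E3) :
    σ.form c (t • y) = t * σ.form c y := by
  simp only [Sector.form, inner_smul_left]; simp; ring

lemma Sector.form_pos_iff (σ : P.Sector) (c : P.Face) (y : E3) :
    0 < σ.form c y ↔ SignType.sign ⟪y, c.normal⟫ = σ.1 c := by
  have h := σ.2.1 c
  unfold Sector.form
  rcases hs : σ.1 c with _ | _ | _
  · exact absurd hs h
  · change 0 < ((-1 : SignType) : ℝ) * _ ↔ _ = (-1 : SignType)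
    rw [sign_eq_neg_one_iff]; simp
  · change 0 < ((1 : SignType) : ℝ) * _ ↔ _ = (1 : SignType)
    rw [sign_eq_one_iff]; simp

lemma Sector.mem_carrier_iff (σ : P.Sector) (s : E3) :
    s ∈ σ.carrier ↔ ‖s‖ = 1 ∧ ∀ c, 0 < σ.form c s := by
  simp only [σ.form_pos_iff]; rfl

lemma Sector.isOpen_cone (σ : P.Sector) : IsOpen {y : E3 | ∀ c, 0 < σ.form c y} := by
  simp only [ofPred_forall]
  exact isOpen_iInter_of_finite fun c => isOpen_lt continuous_const (σ.continuous_form c)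

/-- Weights on three-space that vanish away from the cone over the sector `σ`, and that are
homogeneous of degree `-3` away from the origin. -/
structure IsSectorWeight (σ : P.Sector) (F : E3 → ℝ) (κ : ℝ) : Prop where
  contDiff : ContDiff ℝ 1 F
  pos : 0 < κ
  nonneg : ∀ y, 0 ≤ F y
  zero : F 0 = 0
  -- The threshold leaves room for averages of nearly constant unit vectors, which are a little
  -- shorter than one.
  euler : ∀ y, 1 / 2 < ‖y‖ → fderiv ℝ F y y + 3 * F y = 0
  le : ∀ y, 1 / 2 < ‖y‖ → F y * ‖y‖ ^ 3 ≤ 1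
  -- A gap between the support of the weight and the walls of the cone: a continuous field tangent
  -- to a face stays below `κ` near that face.
  form_ge : ∀ y, F y ≠ 0 → ∀ c, κ ≤ σ.form c y

/-- Weights that approximate the characteristic function of the sector. -/
def Sector.weight (σ : P.Sector) (j : ℕ) (y : E3) : ℝ :=
  -- The first factor removes the singularity at the origin and equals one for `‖y‖ ≥ 1 / 2`; the
  -- product is homogeneous of degree zero on positive multiples.
  Real.smoothTransition (8 * ‖y‖ ^ 2 - 1) *
    (∏ c, Real.smoothTransition ((j + 1) * (σ.form c y * ‖y‖⁻¹) - 1)) * (‖y‖⁻¹) ^ 3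

lemma Sector.weight_nonneg (σ : P.Sector) (j : ℕ) (y : E3) : 0 ≤ σ.weight j y := by
  unfold Sector.weight
  have := fun x => Real.smoothTransition.nonneg x
  have h2 := Finset.prod_nonneg (s := Finset.univ) fun c (_ : c ∈ Finset.univ) =>
    this ((j + 1) * (σ.form c y * ‖y‖⁻¹) - 1)
  have := this (8 * ‖y‖ ^ 2 - 1)
  positivity

lemma Sector.weight_of_lt (σ : P.Sector) (j : ℕ) {y : E3} (hy : 1 / 2 < ‖y‖) :
    σ.weight j y = (∏ c, Real.smoothTransition ((j + 1) * (σ.form c y * ‖y‖⁻¹) - 1))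
      * (‖y‖⁻¹) ^ 3 := by
  rw [Sector.weight, Real.smoothTransition.one_of_one_le (by nlinarith), one_mul]

lemma Sector.weight_eq_zero (σ : P.Sector) (j : ℕ) {y : E3} (hy : 8 * ‖y‖ ^ 2 ≤ 1) :
    σ.weight j y = 0 := by
  rw [Sector.weight, Real.smoothTransition.zero_of_nonpos (by linarith), zero_mul, zero_mul]

lemma Sector.contDiff_weight (σ : P.Sector) (j : ℕ) : ContDiff ℝ 1 (σ.weight j) := by
  rw [contDiff_iff_contDiffAt]
  intro y
  by_cases hy : 8 * ‖y‖ ^ 2 < 1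
  · have : σ.weight j =ᶠ[nhds y] fun _ => 0 := by
      have ho : IsOpen {y : E3 | 8 * ‖y‖ ^ 2 < 1} :=
        isOpen_lt (by fun_prop) continuous_const
      filter_upwards [ho.mem_nhds hy] with z hz using σ.weight_eq_zero j (le_of_lt hz)
    exact contDiffAt_const.congr_of_eventuallyEq this
  · have hy0 : y ≠ 0 := by rintro rfl; simp at hy
    have hn : ContDiffAt ℝ 1 (fun y : E3 => ‖y‖) y := contDiffAt_norm ℝ hy0
    have hni : ContDiffAt ℝ 1 (fun y : E3 => ‖y‖⁻¹) y := hn.inv (norm_ne_zero_iff.2 hy0)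
    have hs : ContDiff ℝ 1 Real.smoothTransition := Real.smoothTransition.contDiff
    refine ContDiffAt.mul (ContDiffAt.mul ?_ ?_) (hni.pow 3)
    · exact hs.contDiffAt.comp y ((contDiffAt_const.mul (hn.pow 2)).sub contDiffAt_const)
    · refine contDiffAt_prod fun c _ => hs.contDiffAt.comp y ?_
      refine ContDiffAt.sub (contDiffAt_const.mul (ContDiffAt.mul ?_ hni)) contDiffAt_const
      exact contDiffAt_const.mul (contDiffAt_id.inner ℝ contDiffAt_const)

lemma Sector.isSectorWeight_weight (σ : P.Sector) (j : ℕ) :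
    IsSectorWeight σ (σ.weight j) (1 / (3 * (j + 1))) where
  contDiff := σ.contDiff_weight j
  pos := by positivity
  nonneg := σ.weight_nonneg j
  zero := σ.weight_eq_zero j (by simp)
  euler y hy := by
    have hy0 : 0 < ‖y‖ := by linarith
    have hd := (σ.contDiff_weight j).differentiable (by simp)
    have h1 : HasDerivAt (fun t : ℝ => σ.weight j (t • y)) (fderiv ℝ (σ.weight j) y y) 1 := by
      have e : HasDerivAt (fun t : ℝ => t • y) ((1 : ℝ) • y) 1 := (hasDerivAt_id 1).smul_const y
      have := ((hd ((1 : ℝ) • y)).hasFDerivAt).comp_hasDerivAt (1 : ℝ) e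
      simp only [one_smul] at this
      exact this
    -- Euler's identity: `t ^ 3 * F (t • y)` is constant near `t = 1`, and its derivative there is
    -- the claimed expression.
    have h2 := (hasDerivAt_pow 3 (1 : ℝ)).mul h1
    have h3 : (fun t : ℝ => t ^ 3 * σ.weight j (t • y)) =ᶠ[nhds 1] fun _ => σ.weight j y := by
      have hc : Continuous fun t : ℝ => ‖t • y‖ := by fun_prop
      have e1 : ∀ᶠ t : ℝ in nhds 1, 1 / 2 < ‖t • y‖ :=
        hc.continuousAt.eventually_const_lt (by simpa using hy)
      filter_upwards [e1, lt_mem_nhds (zero_lt_one (α := ℝ))] with t ht ht0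
      rw [σ.weight_of_lt j ht, σ.weight_of_lt j hy, norm_smul, Real.norm_of_nonneg ht0.le]
      have : ∀ c, σ.form c (t • y) * (t * ‖y‖)⁻¹ = σ.form c y * ‖y‖⁻¹ := by
        intro c; rw [σ.form_smul]; field_simp
      simp only [this]
      field_simp
    have h4 := h2.congr_of_eventuallyEq h3.symm
    have h5 := h4.unique (hasDerivAt_const _ _)
    norm_num at h5
    linarith
  le y hy := by
    have hy0 : 0 < ‖y‖ := by linarith
    rw [σ.weight_of_lt j hy, mul_assoc, ← mul_pow, inv_mul_cancel₀ hy0.ne', one_pow, mul_one]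
    exact Finset.prod_le_one (fun c _ => Real.smoothTransition.nonneg _)
      fun c _ => Real.smoothTransition.le_one _
  -- Where the weight is non-zero, the cutoff forces `‖y‖ > 1 / 3` and the `c`-th factor forces `(j
  -- + 1) * σ.form c y > ‖y‖`; this is the origin of `κ`.
  form_ge y hy c := by
    have h1 : 1 < 8 * ‖y‖ ^ 2 := by
      by_contra! h
      exact hy (σ.weight_eq_zero j h)
    have h2 : 1 / 3 < ‖y‖ := by
      by_contra! h
      nlinarith [norm_nonneg y]
    have h3 : 0 < (j + 1) * (σ.form c y * ‖y‖⁻¹) - 1 := by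
      by_contra! h
      refine hy ?_
      rw [Sector.weight, Finset.prod_eq_zero (Finset.mem_univ c)
        (Real.smoothTransition.zero_of_nonpos h), mul_zero, zero_mul]
    have hy0 : 0 < ‖y‖ := by linarith
    have h4 : ‖y‖ < (j + 1) * σ.form c y := by
      have : 1 < ((j + 1) * σ.form c y) / ‖y‖ := by
        rw [div_eq_mul_inv, mul_assoc]; linarith
      rwa [one_lt_div hy0] at this
    rw [div_le_iff₀ (by positivity)]
    linarith

/-- For fixed `s` the sequence is eventually constant: inside the sector all arguments of the
transitions finally exceed one, elsewhere some form is non-positive and every weight vanishes. -/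
lemma Sector.tendsto_weight (σ : P.Sector) {s : E3} (hs : ‖s‖ = 1) :
    Filter.Tendsto (fun j => σ.weight j s) Filter.atTop (nhds (σ.carrier.indicator 1 s)) := by
  have hs2 : 1 / 2 < ‖s‖ := by rw [hs]; norm_num
  refine tendsto_const_nhds.congr' ?_
  by_cases h : s ∈ σ.carrier
  · have h' := ((σ.mem_carrier_iff s).1 h).2
    have : ∀ᶠ j : ℕ in Filter.atTop, ∀ c, 2 ≤ ((j : ℝ) + 1) * σ.form c s := by
      rw [Filter.eventually_all]
      intro c
      have ht : Filter.Tendsto (fun j : ℕ => ((j : ℝ) + 1) * σ.form c s) Filter.atTop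
          Filter.atTop :=
        (Filter.tendsto_atTop_add_const_right _ _ tendsto_natCast_atTop_atTop).atTop_mul_const (h' c)
      exact ht.eventually_ge_atTop 2
    filter_upwards [this] with j hj
    rw [indicator_of_mem h, σ.weight_of_lt j hs2, hs]
    simp only [inv_one, mul_one, one_pow, Pi.one_apply]
    exact (Finset.prod_eq_one fun c _ =>
      Real.smoothTransition.one_of_one_le (by linarith [hj c])).symm
  · refine Filter.Eventually.of_forall fun j => ?_
    rw [indicator_of_notMem h, eq_comm]
    by_contra hne
    refine h ((σ.mem_carrier_iff s).2 ⟨hs, fun c => ?_⟩)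
    exact (σ.isSectorWeight_weight j).pos.trans_le ((σ.isSectorWeight_weight j).form_ge s hne c)

end ConvexPolyhedron

/-! ### Tame fields: vanishing flux away from the vertices. -/

namespace ConvexPolyhedron

variable {P : ConvexPolyhedron}

/-- Near `x` the map `M` takes its values in a closed convex set on which the form with weight `F`
is closed; this property is inherited by the averages of `M`. -/
def IsTameAt (F : E3 → ℝ) (M : E3 → E3) (x : E3) : Prop :=
  ∃ Q : Set E3, Convex ℝ Q ∧ IsClosed Q ∧ (∀ y ∈ Q, fderiv ℝ F y y + 3 * F y = 0) ∧
    ∀ᶠ y in nhds x, M y ∈ Q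

/-- The convex sets of tameness also contain the mollified values, so the mollified form is closed
near each point of the support. Compactness makes this uniform in a large ball, and outside it the
mollified field is zero. -/
lemma eventually_integral_fluxDensity_eq_zero {F : E3 → ℝ} {M : E3 → E3} {φ : E3 → ℝ}
    (hF : ContDiff ℝ 1 F) (hF0 : F 0 = 0) (hM : LocallyIntegrable M) (hMc : HasCompactSupport M)
    (hφ : ContDiff ℝ 1 φ) (h : ∀ x ∈ tsupport φ, IsTameAt F M x) :
    ∀ᶠ k in Filter.atTop, ∫ x, fluxDensity F (mollify k M) φ x = 0 := by
  obtain ⟨R, hR⟩ := hMc.isCompact.isBounded.subset_closedBall (0 : E3)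
  have hK : IsCompact (tsupport φ ∩ Metric.closedBall (0 : E3) (R + 1)) :=
    (isCompact_closedBall _ _).inter_left (isClosed_tsupport φ)
  have hev := hK.eventually_forall_of_eventually_prod (l := Filter.atTop)
    (p := fun k x => fderiv ℝ F (mollify k M x) (mollify k M x) + 3 * F (mollify k M x) = 0)
    (fun x hx => by
      obtain ⟨Q, hQ, hQc, hQF, hMQ⟩ := h x hx.1
      filter_upwards [eventually_mollify_mem hM hQ hQc hMQ] with z hz using hQF _ hz)
  filter_upwards [hev, tendsto_kernelRadius.eventually_lt_const one_pos] with k hk hk1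
  refine integral_fluxDensity_eq_zero hF ((contDiff_mollify k hM).of_le (by norm_cast))
    (hasCompactSupport_mollify k hMc) hφ fun x hx => ?_
  by_cases hxR : x ∈ Metric.closedBall (0 : E3) (R + 1)
  · exact hk x ⟨hx, hxR⟩
  · have h0 : mollify k M x = 0 := by
      refine mollify_mem (Q := {0}) hM (convex_singleton 0) isClosed_singleton fun y hy => ?_
      refine image_eq_zero_of_notMem_tsupport fun hy' => hxR ?_
      have h1 := hR hy'
      rw [mem_closedBall_zero_iff] at h1 ⊢
      rw [Metric.mem_ball, dist_eq_norm] at hy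
      have := norm_sub_norm_le x y
      rw [norm_sub_rev] at this
      linarith
    rw [h0]; simp [hF0]

lemma Sector.convex_form_le (σ : P.Sector) (c : P.Face) (a : ℝ) : Convex ℝ {y : E3 | σ.form c y ≤ a} := by
  have : IsLinearMap ℝ (σ.form c) :=
    ⟨fun x y => by simp [Sector.form, inner_add_left, mul_add], fun t y => σ.form_smul c t y⟩
  exact convex_halfSpace_le this a

lemma half_lt_norm_of_mem_closedBall {q y : E3} (hq : ‖q‖ = 1) (hy : y ∈ Metric.closedBall q (1 / 4)) :
    1 / 2 < ‖y‖ := by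
  rw [Metric.mem_closedBall, dist_eq_norm] at hy
  have := norm_sub_norm_le q y
  rw [norm_sub_rev] at this
  linarith

namespace IsSectorWeight

variable {σ : P.Sector} {F : E3 → ℝ} {κ : ℝ} (hF : IsSectorWeight σ F κ) {M : E3 → E3} {x : E3}

include hF

lemma eq_zero_of_form_lt {c : P.Face} {y : E3} (h : σ.form c y < κ) : F y = 0 := by
  by_contra hne
  exact (hF.form_ge y hne c).not_gt h

lemma euler_of_form_lt {c : P.Face} {y : E3} (h : σ.form c y < κ) :
    fderiv ℝ F y y + 3 * F y = 0 := by
  have h0 : F =ᶠ[nhds y] fun _ => 0 := by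
    filter_upwards [(isOpen_lt (σ.continuous_form c) continuous_const).mem_nhds h] with z hz
    exact hF.eq_zero_of_form_lt hz
  rw [h0.fderiv_eq, h0.self_of_nhds]; simp

lemma euler_zero : fderiv ℝ F 0 0 + 3 * F 0 = 0 := by simp [hF.zero]

lemma isTameAt_of_ball {q : E3} (hq : ‖q‖ = 1)
    (h : ∀ᶠ y in nhds x, M y ∈ Metric.closedBall q (1 / 4)) : IsTameAt F M x :=
  ⟨_, convex_closedBall q (1 / 4), Metric.isClosed_closedBall,
    fun _ hy => hF.euler _ (half_lt_norm_of_mem_closedBall hq hy), h⟩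

lemma isTameAt_of_form {c : P.Face} (h : ∀ᶠ y in nhds x, σ.form c (M y) ≤ κ / 2) :
    IsTameAt F M x :=
  ⟨_, σ.convex_form_le c (κ / 2), isClosed_le (σ.continuous_form c) continuous_const,
    fun _ hy => hF.euler_of_form_lt (lt_of_le_of_lt hy (half_lt_self hF.pos)), h⟩

lemma isTameAt_of_zero (h : ∀ᶠ y in nhds x, M y = 0) : IsTameAt F M x :=
  ⟨{0}, convex_singleton 0, isClosed_singleton, fun y hy => by rw [hy]; exact hF.euler_zero, h⟩

lemma eventually_mollify_eq_zero_of_form (hM : LocallyIntegrable M) {c : P.Face}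
    (h : ∀ᶠ y in nhds x, σ.form c (M y) ≤ κ / 2) :
    ∀ᶠ z : ℕ × E3 in Filter.atTop ×ˢ nhds x, F (mollify z.1 M z.2) = 0 := by
  filter_upwards [eventually_mollify_mem hM (σ.convex_form_le c (κ / 2))
    (isClosed_le (σ.continuous_form c) continuous_const) h] with z hz
  exact hF.eq_zero_of_form_lt (lt_of_le_of_lt hz (half_lt_self hF.pos))

lemma eventually_mollify_eq_zero (hM : LocallyIntegrable M)
    (h : ∀ᶠ y in nhds x, M y = 0) :
    ∀ᶠ z : ℕ × E3 in Filter.atTop ×ˢ nhds x, F (mollify z.1 M z.2) = 0 := by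
  filter_upwards [eventually_mollify_mem hM (convex_singleton (0 : E3)) isClosed_singleton h]
    with z hz
  rw [hz]; exact hF.zero

end IsSectorWeight

lemma Sector.form_eq_zero (σ : P.Sector) {c : P.Face} {y : E3} (h : ⟪y, c.normal⟫ = 0) :
    σ.form c y = 0 := by rw [Sector.form, h, mul_zero]

lemma Sector.form_zero (σ : P.Sector) (c : P.Face) : σ.form c 0 = 0 :=
  σ.form_eq_zero (inner_zero_left _)

lemma measurableSet_domain (P : ConvexPolyhedron) : MeasurableSet P.domain :=
  P.isClosed_body.measurableSet.diff P.vertices.finite_toSet.measurableSet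

lemma extend_eq_zero {n : E3 → E3} {x : E3} (hx : x ∉ P.body) : P.extend n x = 0 :=
  indicator_of_notMem (fun h => hx h.1) _

lemma extend_eq {n : E3 → E3} {x : E3} (hx : x ∈ P.domain) : P.extend n x = n x := indicator_of_mem hx _

lemma hasCompactSupport_extend {n : E3 → E3} : HasCompactSupport (P.extend n) :=
  HasCompactSupport.intro P.isCompact_body fun _ hx => extend_eq_zero hx

lemma eventually_extend_eq_zero {n : E3 → E3} {x : E3} (hx : x ∉ P.body) :
    ∀ᶠ y in nhds x, P.extend n y = 0 := by
  filter_upwards [P.isClosed_body.isOpen_compl.mem_nhds hx] with y hy using extend_eq_zero hy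

namespace IsTangentField

variable {n : E3 → E3} (hn : P.IsTangentField n)

include hn

lemma norm_extend_le (x : E3) : ‖P.extend n x‖ ≤ 1 := by
  by_cases hx : x ∈ P.domain
  · rw [extend, indicator_of_mem hx, hn.norm_eq_one x hx]
  · rw [extend, indicator_of_notMem hx]; simp

lemma stronglyMeasurable_extend : StronglyMeasurable (P.extend n) := by
  have h := P.measurableSet_domain
  refine Measurable.stronglyMeasurable ?_
  classical
  have := hn.continuousOn.measurable_piecewise (g := fun _ => (0 : E3)) continuousOn_const h
  rw [extend]
  convert this using 1
  ext1 x
  by_cases hx : x ∈ P.domain <;> simp [hx]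

lemma continuousAt_extend (hP : interior P.body ⊆ P.domain) {x : E3} (hx : x ∈ interior P.body) :
    ContinuousAt (P.extend n) x := by
  have h1 : ContinuousAt n x := (hn.continuousOn.mono hP).continuousAt
    (isOpen_interior.mem_nhds hx)
  refine h1.congr ?_
  filter_upwards [isOpen_interior.mem_nhds hx] with y hy
  rw [extend, indicator_of_mem (hP hy)]

lemma eventually_form_extend_le (σ : P.Sector) {x : E3} (hx : x ∈ P.domain) {c : P.Face}
    {κ : ℝ} (hκ : 0 < κ) (hc : σ.form c (n x) ≤ 0) :
    ∀ᶠ y in nhds x, σ.form c (P.extend n y) ≤ κ := by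
  have h1 : ContinuousWithinAt (fun y => σ.form c (n y)) P.domain x :=
    (σ.continuous_form c).continuousAt.comp_continuousWithinAt (hn.continuousOn x hx)
  have h2 := h1.eventually_lt_const (lt_of_le_of_lt hc hκ)
  rw [eventually_nhdsWithin_iff] at h2
  filter_upwards [h2] with y hy
  by_cases hyd : y ∈ P.domain
  · rw [extend_eq hyd]; exact (hy hyd).le
  · rw [extend, indicator_of_notMem hyd, σ.form_zero]; exact hκ.le

end IsTangentField

lemma integrable_of_norm_le_one {M : E3 → E3} (hM : StronglyMeasurable M)
    (hMc : HasCompactSupport M) (h : ∀ x, ‖M x‖ ≤ 1) : Integrable M := by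
  rw [← integrableOn_iff_integrable_of_support_subset (subset_tsupport M)]
  exact Measure.integrableOn_of_bounded hMc.isCompact.measure_lt_top.ne
    hM.aestronglyMeasurable (Filter.Eventually.of_forall h)

lemma IsTangentField.integrable_extend {n : E3 → E3} (hn : P.IsTangentField n) :
    Integrable (P.extend n) :=
  integrable_of_norm_le_one hn.stronglyMeasurable_extend hasCompactSupport_extend
    hn.norm_extend_le

/-- In the interior continuity gives a small ball about a unit vector. At a boundary point the form
of a face through it vanishes on `n x` by tangency, so the field inside and the value zero outside
share a half-space on which the weight is zero. -/
lemma IsTangentField.isTameAt_extend {n : E3 → E3} (hn : P.IsTangentField n)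
    (hP : interior P.body ⊆ P.domain) {σ : P.Sector} {F : E3 → ℝ} {κ : ℝ}
    (hF : IsSectorWeight σ F κ) {x : E3} (hx : x ∉ P.vertices) : IsTameAt F (P.extend n) x := by
  by_cases hxb : x ∈ P.body
  · have hxd : x ∈ P.domain := ⟨hxb, hx⟩
    by_cases hxi : x ∈ interior P.body
    · refine hF.isTameAt_of_ball (hn.norm_eq_one x hxd) ?_
      have := (hn.continuousAt_extend hP hxi).eventually
        (Metric.closedBall_mem_nhds _ (show (0 : ℝ) < 1 / 4 by norm_num))
      rwa [extend_eq hxd] at this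
    · obtain ⟨c, hc⟩ := exists_face_of_notMem_interior hxb hxi
      exact hF.isTameAt_of_form (hn.eventually_form_extend_le σ hxd (half_pos hF.pos)
        (σ.form_eq_zero (hn.tangent c x ⟨hc, hxd⟩)).le)
  · exact hF.isTameAt_of_zero (eventually_extend_eq_zero hxb)

end ConvexPolyhedron

/-! ### Gluing a homotopy below a cleaved surface. -/

namespace ConvexPolyhedron

variable {P : ConvexPolyhedron}

namespace CleavedSurface

variable {v : E3} (C : P.CleavedSurface v)

/-- The orthonormal frame of a cleaved surface as a basis. -/
def basis : OrthonormalBasis (Fin 3) ℝ E3 :=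
  OrthonormalBasis.mk C.orthonormal
    (C.orthonormal.linearIndependent.span_eq_top_of_card_eq_finrank (by simp)).ge

lemma basis_zero : C.basis 0 = C.e₁ := by simp [basis]
lemma basis_one : C.basis 1 = C.e₂ := by simp [basis]
lemma basis_two : C.basis 2 = C.u := by simp [basis]

/-- The coordinates of the orthogonal projection to the plane of the cleaved surface. -/
def proj : E3 →L[ℝ] ℝ × ℝ := (innerSL ℝ C.e₁).prod (innerSL ℝ C.e₂)

lemma proj_apply (x : E3) : C.proj x = (⟪C.e₁, x⟫, ⟪C.e₂, x⟫) := rfl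

lemma inner_e₁_e₂ : ⟪C.e₁, C.e₂⟫ = 0 := C.orthonormal.2 (i := 0) (j := 1) (by decide)
lemma inner_u_e₁ : ⟪C.u, C.e₁⟫ = 0 := C.orthonormal.2 (i := 2) (j := 0) (by decide)
lemma inner_u_e₂ : ⟪C.u, C.e₂⟫ = 0 := C.orthonormal.2 (i := 2) (j := 1) (by decide)
lemma norm_e₁ : ‖C.e₁‖ = 1 := C.orthonormal.1 0
lemma norm_e₂ : ‖C.e₂‖ = 1 := C.orthonormal.1 1

lemma proj_e₁ : C.proj C.e₁ = (1, 0) := by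
  rw [proj_apply, real_inner_self_eq_norm_sq, C.norm_e₁, real_inner_comm, C.inner_e₁_e₂]; simp

lemma proj_e₂ : C.proj C.e₂ = (0, 1) := by
  rw [proj_apply, real_inner_self_eq_norm_sq, C.norm_e₂, C.inner_e₁_e₂]; simp

lemma param_proj (x : E3) : C.param (C.proj x) = x + (C.offset - ⟪C.u, x⟫) • C.u := by
  have h := C.basis.sum_repr' x
  rw [Fin.sum_univ_three, C.basis_zero, C.basis_one, C.basis_two] at h
  conv_rhs => rw [← h]
  simp only [param, proj_apply]
  rw [inner_add_right, inner_add_right, inner_smul_right, inner_smul_right, inner_smul_right,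
    C.inner_u_e₁, C.inner_u_e₂, real_inner_self_eq_norm_sq, C.norm_u]
  module

lemma continuous_param : Continuous C.param := by unfold param; fun_prop

lemma isClosed_region : IsClosed C.region := P.isClosed_body.preimage C.continuous_param

lemma proj_param (p : ℝ × ℝ) : C.proj (C.param p) = p := by
  have h1 : ⟪C.e₁, C.param p⟫ = p.1 := by
    rw [param, inner_add_right, inner_add_right, inner_smul_right, inner_smul_right,
      inner_smul_right, real_inner_comm, C.inner_u_e₁, C.inner_e₁_e₂, real_inner_self_eq_norm_sq,
      C.norm_e₁]; simp
  have h2 : ⟪C.e₂, C.param p⟫ = p.2 := by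
    rw [param, inner_add_right, inner_add_right, inner_smul_right, inner_smul_right,
      inner_smul_right, real_inner_comm, C.inner_u_e₂, real_inner_comm, C.inner_e₁_e₂,
      real_inner_self_eq_norm_sq, C.norm_e₂]; simp
  rw [proj_apply, h1, h2]

lemma isCompact_region : IsCompact C.region := by
  have h : IsCompact (C.proj '' P.body) := P.isCompact_body.image C.proj.continuous
  exact h.of_isClosed_subset C.isClosed_region fun p hp => ⟨C.param p, hp, C.proj_param p⟩

lemma region_mem_nhds {p : ℝ × ℝ} (hp : C.param p ∈ interior P.body) : C.region ∈ nhds p :=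
  C.continuous_param.continuousAt.preimage_mem_nhds (mem_interior_iff_mem_nhds.1 hp)

lemma inner_lt_or_mem (x : E3) : x ∈ P.vertices → ⟪C.u, x⟫ < C.offset ∨ x = v := fun hx => by
  by_cases h : x = v
  · exact Or.inr h
  · exact Or.inl (C.other_lt x hx h)

lemma notMem_vertices {x : E3} (h1 : C.offset ≤ ⟪C.u, x⟫) (h2 : ⟪C.u, x⟫ < ⟪C.u, v⟫) :
    x ∉ P.vertices := fun hx => by
  rcases C.inner_lt_or_mem x hx with h | h
  · exact h.not_ge h1
  · rw [h] at h2; exact lt_irrefl _ h2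

/-- The homotopy `H` of fields on the cleaved surface, as a map below the surface. -/
def homotopyField (H : ℝ × (ℝ × ℝ) → E3) : E3 → E3 :=
  -- The depth below the plane is the homotopy time, so from depth one downwards the field is `H (1,
  -- ·)`, independent of depth.
  (C.proj ⁻¹' C.region).indicator fun x => H (min 1 (max 0 (C.offset - ⟪C.u, x⟫)), C.proj x)

/-- The field above the cleaved surface, glued to a homotopy below it. -/
def gluedField (n : E3 → E3) (H : ℝ × (ℝ × ℝ) → E3) (x : E3) : E3 :=
  {x | C.offset ≤ ⟪C.u, x⟫}.indicator (P.extend n) x +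
    -- Cutting at depth 4 gives compact support; the flux is probed only down to depth 3.
    {x | C.offset - 4 ≤ ⟪C.u, x⟫ ∧ ⟪C.u, x⟫ < C.offset}.indicator (C.homotopyField H) x

section Homotopy

variable {n : E3 → E3} {H : ℝ × (ℝ × ℝ) → E3}
  (hH : ContinuousOn H (Icc (0 : ℝ) 1 ×ˢ C.region))
  (hT : ∀ t ∈ Icc (0 : ℝ) 1, C.IsTangent fun p => H (t, p))

lemma clamp_mem (s : ℝ) : min 1 (max 0 s) ∈ Icc (0 : ℝ) 1 :=
  ⟨le_min zero_le_one (le_max_left _ _), min_le_left _ _⟩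

lemma homotopyField_of_mem {x : E3} (hx : C.proj x ∈ C.region) :
    C.homotopyField H x = H (min 1 (max 0 (C.offset - ⟪C.u, x⟫)), C.proj x) :=
  indicator_of_mem (s := C.proj ⁻¹' C.region) hx _

lemma homotopyField_of_notMem {x : E3} (hx : C.proj x ∉ C.region) :
    C.homotopyField H x = 0 := indicator_of_notMem (s := C.proj ⁻¹' C.region) hx _

include hH in
lemma continuousOn_homotopyField : ContinuousOn
    (fun x => H (min 1 (max 0 (C.offset - ⟪C.u, x⟫)), C.proj x)) (C.proj ⁻¹' C.region) := by
  refine hH.comp (Continuous.continuousOn (by fun_prop)) fun x hx => ⟨clamp_mem _, hx⟩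

include hT in
lemma norm_homotopyField_of_mem {x : E3} (hx : C.proj x ∈ C.region) :
    ‖C.homotopyField H x‖ = 1 := by
  rw [C.homotopyField_of_mem hx]
  exact (hT _ (clamp_mem _)).1 _ hx

include hT in
lemma norm_homotopyField_le (x : E3) : ‖C.homotopyField H x‖ ≤ 1 := by
  by_cases hx : C.proj x ∈ C.region
  · exact (C.norm_homotopyField_of_mem hT hx).le
  · rw [C.homotopyField_of_notMem hx]; simp

include hH in
lemma stronglyMeasurable_homotopyField : StronglyMeasurable (C.homotopyField H) := by
  have h : MeasurableSet (C.proj ⁻¹' C.region) :=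
    (C.isClosed_region.preimage C.proj.continuous).measurableSet
  refine Measurable.stronglyMeasurable ?_
  classical
  have := (C.continuousOn_homotopyField hH).measurable_piecewise (g := fun _ => (0 : E3))
    continuousOn_const h
  rw [homotopyField]
  convert this using 1
  ext1 x
  by_cases hx : x ∈ C.proj ⁻¹' C.region <;> simp [hx]

include hH in
lemma continuousAt_homotopyField {x : E3} (hx : C.param (C.proj x) ∈ interior P.body) :
    ContinuousAt (C.homotopyField H) x := by
  have h0 : C.proj ⁻¹' C.region ∈ nhds x :=
    C.proj.continuous.continuousAt.preimage_mem_nhds (C.region_mem_nhds hx)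
  refine ((C.continuousOn_homotopyField hH).continuousAt h0).congr ?_
  filter_upwards [h0] with y hy
  rw [C.homotopyField_of_mem hy]

include hH hT in
lemma eventually_form_homotopyField_le (σ : P.Sector) {x : E3} {c : P.Face}
    (hx : C.param (C.proj x) ∈ c.carrier) {κ : ℝ} (hκ : 0 < κ) :
    ∀ᶠ y in nhds x, σ.form c (C.homotopyField H y) ≤ κ := by
  have hx' : C.proj x ∈ C.region := hx.1
  have h1 := (σ.continuous_form c).continuousAt.comp_continuousWithinAt
    ((C.continuousOn_homotopyField hH) x hx')
  have h0 : σ.form c (H (min 1 (max 0 (C.offset - ⟪C.u, x⟫)), C.proj x)) < κ := by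
    rw [σ.form_eq_zero ((hT _ (clamp_mem _)).2 c _ hx' hx)]; exact hκ
  have h2 := h1.eventually_lt_const h0
  rw [eventually_nhdsWithin_iff] at h2
  filter_upwards [h2] with y hy
  by_cases hyd : C.proj y ∈ C.region
  · rw [C.homotopyField_of_mem hyd]; exact (hy hyd).le
  · rw [C.homotopyField_of_notMem hyd, σ.form_zero]; exact hκ.le

lemma eventually_homotopyField_eq_zero {x : E3} (hx : C.param (C.proj x) ∉ P.body) :
    ∀ᶠ y in nhds x, C.homotopyField H y = 0 := by
  have : IsOpen (C.proj ⁻¹' C.region)ᶜ :=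
    (C.isClosed_region.preimage C.proj.continuous).isOpen_compl
  filter_upwards [this.mem_nhds hx] with y hy using C.homotopyField_of_notMem hy

-- The walls of the cylinder are not faces of the polyhedron, but above and below a boundary point
-- of the region the values are tangent to the face through that point, which is all that the weight
-- sees.
include hH hT in
lemma isTameAt_homotopyField {σ : P.Sector} {F : E3 → ℝ} {κ : ℝ} (hF : IsSectorWeight σ F κ)
    (x : E3) : IsTameAt F (C.homotopyField H) x := by
  by_cases hxb : C.param (C.proj x) ∈ P.body
  · by_cases hxi : C.param (C.proj x) ∈ interior P.body
    · exact hF.isTameAt_of_ball (C.norm_homotopyField_of_mem hT hxb)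
        ((C.continuousAt_homotopyField hH hxi).eventually
          (Metric.closedBall_mem_nhds _ (show (0 : ℝ) < 1 / 4 by norm_num)))
    · obtain ⟨c, hc⟩ := exists_face_of_notMem_interior hxb hxi
      exact hF.isTameAt_of_form (C.eventually_form_homotopyField_le hH hT σ hc (half_pos hF.pos))
  · exact hF.isTameAt_of_zero (C.eventually_homotopyField_eq_zero hxb)

lemma gluedField_of_ge {x : E3} (hx : C.offset ≤ ⟪C.u, x⟫) :
    C.gluedField n H x = P.extend n x := by
  rw [gluedField, indicator_of_mem (show x ∈ {x | C.offset ≤ ⟪C.u, x⟫} from hx),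
    indicator_of_notMem (fun h => h.2.not_ge hx), add_zero]

lemma gluedField_of_lt {x : E3} (h1 : C.offset - 4 ≤ ⟪C.u, x⟫) (h2 : ⟪C.u, x⟫ < C.offset) :
    C.gluedField n H x = C.homotopyField H x := by
  rw [gluedField, indicator_of_notMem (show x ∉ {x | C.offset ≤ ⟪C.u, x⟫} from h2.not_ge),
    indicator_of_mem (show x ∈ {x | C.offset - 4 ≤ ⟪C.u, x⟫ ∧ ⟪C.u, x⟫ < C.offset} from ⟨h1, h2⟩), zero_add]

lemma gluedField_of_lt_sub {x : E3} (h1 : ⟪C.u, x⟫ < C.offset - 4) :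
    C.gluedField n H x = 0 := by
  rw [gluedField, indicator_of_notMem (show x ∉ {x | C.offset ≤ ⟪C.u, x⟫} from
    fun h : C.offset ≤ ⟪C.u, x⟫ => by linarith), indicator_of_notMem (fun h => h.1.not_gt h1),
    add_zero]

lemma continuous_inner_u : Continuous fun x : E3 => ⟪C.u, x⟫ := by fun_prop

-- Off the plane one of the two pieces is present alone. On the plane they meet with the common
-- value `n x`, because the homotopy starts at `n`, and both satisfy the same convex constraint. The
-- bound `h2` keeps the vertex `v` away, and `h1` the artificial cut.
include hH hT in
lemma isTameAt_gluedField (hn : P.IsTangentField n) (hP : interior P.body ⊆ P.domain)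
    (h0 : ∀ p ∈ C.region, H (0, p) = n (C.param p)) {σ : P.Sector} {F : E3 → ℝ} {κ : ℝ}
    (hF : IsSectorWeight σ F κ) {x : E3} (h1 : C.offset - 4 < ⟪C.u, x⟫)
    (h2 : ⟪C.u, x⟫ < ⟪C.u, v⟫) : IsTameAt F (C.gluedField n H) x := by
  have hev : ∀ᶠ y in nhds x, C.offset - 4 < ⟪C.u, y⟫ :=
    C.continuous_inner_u.continuousAt.eventually_const_lt h1
  rcases lt_trichotomy ⟪C.u, x⟫ C.offset with hlt | heq | hgt
  · obtain ⟨Q, hQ, hQc, hQF, hQM⟩ := C.isTameAt_homotopyField hH hT hF x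
    refine ⟨Q, hQ, hQc, hQF, ?_⟩
    filter_upwards [hQM, hev, C.continuous_inner_u.continuousAt.eventually_lt_const hlt]
      with y hy hy1 hy2
    rwa [C.gluedField_of_lt hy1.le hy2]
  · have hxv : x ∉ P.vertices := C.notMem_vertices heq.ge h2
    have hpx : C.param (C.proj x) = x := by rw [C.param_proj, heq]; simp
    have hglue : ∀ {p : E3 → Prop}, (∀ᶠ y in nhds x, p (P.extend n y)) →
        (∀ᶠ y in nhds x, p (C.homotopyField H y)) → ∀ᶠ y in nhds x, p (C.gluedField n H y) := by
      intro p ha hb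
      filter_upwards [ha, hb, hev] with y hya hyb hy1
      by_cases hy : C.offset ≤ ⟪C.u, y⟫
      · rwa [C.gluedField_of_ge hy]
      · rwa [C.gluedField_of_lt hy1.le (not_le.1 hy)]
    by_cases hxb : x ∈ P.body
    · have hxd : x ∈ P.domain := ⟨hxb, hxv⟩
      have hxr : C.proj x ∈ C.region := by change C.param (C.proj x) ∈ P.body; rwa [hpx]
      by_cases hxi : x ∈ interior P.body
      · refine hF.isTameAt_of_ball (hn.norm_eq_one x hxd) (hglue ?_ ?_)
        · have := (hn.continuousAt_extend hP hxi).eventually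
            (Metric.closedBall_mem_nhds _ (show (0 : ℝ) < 1 / 4 by norm_num))
          rwa [extend_eq hxd] at this
        · have := (C.continuousAt_homotopyField hH (by rwa [hpx])).eventually
            (Metric.closedBall_mem_nhds _ (show (0 : ℝ) < 1 / 4 by norm_num))
          rw [C.homotopyField_of_mem hxr, heq, sub_self, max_self, min_eq_right zero_le_one,
            h0 _ hxr, hpx] at this
          exact this
      · obtain ⟨c, hc⟩ := exists_face_of_notMem_interior hxb hxi
        exact hF.isTameAt_of_form (hglue (p := fun z => σ.form c z ≤ κ / 2)
          (hn.eventually_form_extend_le σ hxd (half_pos hF.pos)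
            (σ.form_eq_zero (hn.tangent c x ⟨hc, hxd⟩)).le)
          (C.eventually_form_homotopyField_le hH hT σ (by rwa [hpx]) (half_pos hF.pos)))
    · exact hF.isTameAt_of_zero (hglue (p := (· = 0)) (eventually_extend_eq_zero hxb)
        (C.eventually_homotopyField_eq_zero (by rwa [hpx])))
  · obtain ⟨Q, hQ, hQc, hQF, hQM⟩ :=
      hn.isTameAt_extend hP hF (C.notMem_vertices hgt.le h2)
    refine ⟨Q, hQ, hQc, hQF, ?_⟩
    filter_upwards [hQM, C.continuous_inner_u.continuousAt.eventually_const_lt hgt] with y hy hy1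
    rwa [C.gluedField_of_ge hy1.le]

include hH in
lemma stronglyMeasurable_gluedField (hn : P.IsTangentField n) :
    StronglyMeasurable (C.gluedField n H) := by
  have h1 : MeasurableSet {x | C.offset ≤ ⟪C.u, x⟫} :=
    measurableSet_le measurable_const C.continuous_inner_u.measurable
  have h2 : MeasurableSet {x | C.offset - 4 ≤ ⟪C.u, x⟫ ∧ ⟪C.u, x⟫ < C.offset} :=
    (measurableSet_le measurable_const C.continuous_inner_u.measurable).inter
      (measurableSet_lt C.continuous_inner_u.measurable measurable_const)
  exact (hn.stronglyMeasurable_extend.indicator h1).add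
    ((C.stronglyMeasurable_homotopyField hH).indicator h2)

include hT in
lemma norm_gluedField_le (hn : P.IsTangentField n) (x : E3) : ‖C.gluedField n H x‖ ≤ 1 := by
  by_cases h : C.offset ≤ ⟪C.u, x⟫
  · rw [C.gluedField_of_ge h]; exact hn.norm_extend_le x
  · by_cases h' : C.offset - 4 ≤ ⟪C.u, x⟫
    · rw [C.gluedField_of_lt h' (not_le.1 h)]; exact C.norm_homotopyField_le hT x
    · rw [C.gluedField_of_lt_sub (not_le.1 h')]; simp

/-- A radius of a ball that contains the polyhedron and the part of the cylinder below the cleaved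
surface that is used. -/
lemma exists_radius : ∃ R : ℝ, 0 < R ∧ P.body ⊆ Metric.closedBall 0 R ∧
    ∀ x, C.proj x ∈ C.region → C.offset - 4 ≤ ⟪C.u, x⟫ → ⟪C.u, x⟫ ≤ C.offset →
      x ∈ Metric.closedBall (0 : E3) R := by
  obtain ⟨R, hR0, hR⟩ := P.isCompact_body.isBounded.subset_closedBall_lt 0 (0 : E3)
  refine ⟨R + 4, by linarith, hR.trans (Metric.closedBall_subset_closedBall (by linarith)),
    fun x hx h1 h2 => ?_⟩
  have h3 := hR (show C.param (C.proj x) ∈ P.body from hx)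
  rw [mem_closedBall_zero_iff] at h3 ⊢
  have h4 : x = C.param (C.proj x) - (C.offset - ⟪C.u, x⟫) • C.u := by rw [C.param_proj]; abel
  have h5 : ‖(C.offset - ⟪C.u, x⟫) • C.u‖ ≤ 4 := by
    rw [norm_smul, C.norm_u, mul_one, Real.norm_of_nonneg (by linarith)]; linarith
  calc ‖x‖ = ‖C.param (C.proj x) - (C.offset - ⟪C.u, x⟫) • C.u‖ := by rw [← h4]
    _ ≤ _ := norm_sub_le _ _
    _ ≤ R + 4 := by linarith

lemma gluedField_eq_zero {R : ℝ} (hR1 : P.body ⊆ Metric.closedBall 0 R)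
    (hR2 : ∀ x, C.proj x ∈ C.region → C.offset - 4 ≤ ⟪C.u, x⟫ → ⟪C.u, x⟫ ≤ C.offset →
      x ∈ Metric.closedBall (0 : E3) R) {x : E3} (hx : x ∉ Metric.closedBall (0 : E3) R) :
    C.gluedField n H x = 0 := by
  by_cases h : C.offset ≤ ⟪C.u, x⟫
  · rw [C.gluedField_of_ge h]; exact extend_eq_zero fun h => hx (hR1 h)
  · by_cases h' : C.offset - 4 ≤ ⟪C.u, x⟫
    · rw [C.gluedField_of_lt h' (not_le.1 h)]
      exact C.homotopyField_of_notMem fun hr => hx (hR2 x hr h' (not_le.1 h).le)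
    · rw [C.gluedField_of_lt_sub (not_le.1 h')]

lemma hasCompactSupport_gluedField : HasCompactSupport (C.gluedField n H) := by
  obtain ⟨R, -, hR1, hR2⟩ := C.exists_radius
  exact HasCompactSupport.intro (isCompact_closedBall (0 : E3) R)
    fun x hx => C.gluedField_eq_zero hR1 hR2 hx

include hH hT in
lemma integrable_gluedField (hn : P.IsTangentField n) : Integrable (C.gluedField n H) :=
  integrable_of_norm_le_one (C.stronglyMeasurable_gluedField hH hn)
    C.hasCompactSupport_gluedField (C.norm_gluedField_le hT hn)

end Homotopy

end CleavedSurface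

end ConvexPolyhedron

/-! ### Step functions and coordinates adapted to a cleaved surface. -/

namespace ConvexPolyhedron

variable {P : ConvexPolyhedron}

namespace CleavedSurface

variable {v : E3} (C : P.CleavedSurface v)

/-- The distance of the vertex to the plane of the cleaved surface. -/
def height : ℝ := ⟪C.u, v⟫ - C.offset

lemma height_pos : 0 < C.height := sub_pos.2 C.lt_vertex

/-- A smooth step function that increases above the cleaved surface. -/
def upperStep (s : ℝ) : ℝ := Real.smoothTransition (3 * (s - C.offset) / C.height - 1)

/-- A smooth step function that increases below the cleaved surface. -/
def lowerStep (s : ℝ) : ℝ := Real.smoothTransition (s - C.offset + 3)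

lemma contDiff_upperStep : ContDiff ℝ ∞ C.upperStep :=
  Real.smoothTransition.contDiff.comp
    (((contDiff_const.mul (contDiff_id.sub contDiff_const)).div_const _).sub contDiff_const)

lemma contDiff_lowerStep : ContDiff ℝ ∞ C.lowerStep :=
  Real.smoothTransition.contDiff.comp ((contDiff_id.sub contDiff_const).add contDiff_const)

lemma upperStep_eq_zero {s : ℝ} (h : s ≤ C.offset + C.height / 3) : C.upperStep s = 0 := by
  refine Real.smoothTransition.zero_of_nonpos ?_
  rw [sub_nonpos, div_le_one C.height_pos]; linarith

lemma upperStep_eq_one {s : ℝ} (h : C.offset + 2 * C.height / 3 ≤ s) : C.upperStep s = 1 := by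
  refine Real.smoothTransition.one_of_one_le ?_
  rw [le_sub_iff_add_le, le_div_iff₀ C.height_pos]; linarith

lemma lowerStep_eq_zero {s : ℝ} (h : s ≤ C.offset - 3) : C.lowerStep s = 0 :=
  Real.smoothTransition.zero_of_nonpos (by linarith)

lemma lowerStep_eq_one {s : ℝ} (h : C.offset - 2 ≤ s) : C.lowerStep s = 1 :=
  Real.smoothTransition.one_of_one_le (by linarith)

lemma deriv_upperStep_eq_zero {s : ℝ} (h : s < C.offset + C.height / 3) :
    deriv C.upperStep s = 0 := by
  have : C.upperStep =ᶠ[nhds s] fun _ => 0 := by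
    filter_upwards [Iio_mem_nhds h] with t ht using C.upperStep_eq_zero (le_of_lt ht)
  rw [this.deriv_eq]; simp

lemma deriv_lowerStep_eq_zero {s : ℝ} (h : s ∉ Icc (C.offset - 3) (C.offset - 2)) :
    deriv C.lowerStep s = 0 := by
  rw [mem_Icc, not_and_or, not_le, not_le] at h
  rcases h with h | h
  · have : C.lowerStep =ᶠ[nhds s] fun _ => 0 := by
      filter_upwards [Iio_mem_nhds h] with t ht using C.lowerStep_eq_zero (le_of_lt ht)
    rw [this.deriv_eq]; simp
  · have : C.lowerStep =ᶠ[nhds s] fun _ => 1 := by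
      filter_upwards [Ioi_mem_nhds h] with t ht using C.lowerStep_eq_one (le_of_lt ht)
    rw [this.deriv_eq]; simp

lemma continuous_deriv_lowerStep : Continuous (deriv C.lowerStep) :=
  C.contDiff_lowerStep.continuous_deriv (by simp)

lemma hasCompactSupport_deriv_lowerStep : HasCompactSupport (deriv C.lowerStep) :=
  HasCompactSupport.intro (isCompact_Icc (a := C.offset - 3) (b := C.offset - 2))
    fun _ hs => C.deriv_lowerStep_eq_zero hs

lemma integral_deriv_lowerStep : ∫ s, deriv C.lowerStep s = 1 := by
  have := integral_of_hasDerivAt_of_tendsto (f := C.lowerStep) (f' := deriv C.lowerStep)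
    (m := 0) (n := 1)
    (fun s => ((C.contDiff_lowerStep.differentiable (by simp)) s).hasDerivAt)
    (C.continuous_deriv_lowerStep.integrable_of_hasCompactSupport
      C.hasCompactSupport_deriv_lowerStep)
    (tendsto_const_nhds.congr' (by
      filter_upwards [Filter.eventually_le_atBot (C.offset - 3)] with s hs
      exact (C.lowerStep_eq_zero hs).symm))
    (tendsto_const_nhds.congr' (by
      filter_upwards [Filter.eventually_ge_atTop (C.offset - 2)] with s hs
      exact (C.lowerStep_eq_one hs).symm))
  rw [this, sub_zero]

/-- Volume preserving coordinates adapted to the cleaved surface. -/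
def coordinates : E3 ≃ᵐ ℝ × (ℝ × ℝ) :=
  C.basis.measurableEquiv.trans ((MeasurableEquiv.toLp 2 (Fin 3 → ℝ)).symm.trans
    ((MeasurableEquiv.piFinSuccAbove (fun _ : Fin 3 => ℝ) 2).trans
      (MeasurableEquiv.prodCongr (MeasurableEquiv.refl ℝ) MeasurableEquiv.finTwoArrow)))

lemma coordinates_apply (x : E3) : C.coordinates x = (⟪C.u, x⟫, C.proj x) := by
  rw [C.proj_apply, ← C.basis_zero, ← C.basis_one, ← C.basis_two]
  simp only [← OrthonormalBasis.repr_apply_apply]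
  rfl

lemma measurePreserving_coordinates : MeasurePreserving C.coordinates := by
  refine (C.basis.measurePreserving_measurableEquiv).trans
    ((EuclideanSpace.volume_preserving_symm_measurableEquiv_toLp (Fin 3)).trans
      ((volume_preserving_piFinSuccAbove (fun _ : Fin 3 => ℝ) 2).trans ?_))
  exact (MeasurePreserving.id volume).prod (volume_preserving_finTwoArrow ℝ)

lemma integral_coordinates (f : ℝ → ℝ) (h : ℝ × ℝ → ℝ) :
    ∫ x, f ⟪C.u, x⟫ * h (C.proj x) = (∫ s, f s) * ∫ p, h p := by
  have := C.measurePreserving_coordinates.integral_comp' (fun z : ℝ × (ℝ × ℝ) => f z.1 * h z.2)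
  simp only [C.coordinates_apply] at this
  rw [this]
  exact integral_prod_mul f h

end CleavedSurface

end ConvexPolyhedron

/-! ### The flux through a cleaved surface in the limit of vanishing mollification. -/

open Filter Topology in
lemma eventually_eventually_snd {X ι : Type*} [TopologicalSpace X] {l : Filter ι} {x : X}
    {p : ι × X → Prop} (h : ∀ᶠ z in l ×ˢ 𝓝 x, p z) :
    ∀ᶠ z in l ×ˢ 𝓝 x, ∀ᶠ y in 𝓝 z.2, p (z.1, y) := by
  obtain ⟨pa, ha, pb, hb, hab⟩ := eventually_prod_iff.1 h
  filter_upwards [ha.prod_mk (eventually_eventually_nhds.2 hb)] with z hz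
  filter_upwards [hz.2] with y hy using hab hz.1 hy

open Filter Topology in
/-- Maps that agree near `x` have mollifications that agree near `x`. -/
lemma eventually_mollify_eventuallyEq {G : Type*} [NormedAddCommGroup G] [NormedSpace ℝ G]
    {M N : E3 → G} {x : E3} (h : M =ᶠ[𝓝 x] N) :
    ∀ᶠ z : ℕ × E3 in atTop ×ˢ 𝓝 x, mollify z.1 M =ᶠ[𝓝 z.2] mollify z.1 N := by
  filter_upwards [eventually_eventually_snd (eventually_ball_kernelRadius h)] with z hz
  filter_upwards [hz] with y hy using mollify_congr fun w hw => hy hw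

/-- The pullback of the form with weight `F`, evaluated on two tangent vectors. -/
def pullbackWeight {V : Type*} [NormedAddCommGroup V] [NormedSpace ℝ V] (F : E3 → ℝ)
    (m : V → E3) (e₁ e₂ x : V) : ℝ :=
  F (m x) * tripleProduct (m x) (fderiv ℝ m x e₁) (fderiv ℝ m x e₂)

lemma Filter.EventuallyEq.pullbackWeight_eq {V : Type*} [NormedAddCommGroup V] [NormedSpace ℝ V]
    {m m' : V → E3} {x : V} (h : m =ᶠ[nhds x] m') (F : E3 → ℝ) (e₁ e₂ : V) :
    pullbackWeight F m e₁ e₂ x = pullbackWeight F m' e₁ e₂ x := by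
  rw [pullbackWeight, pullbackWeight, h.fderiv_eq, h.self_of_nhds]

lemma continuous_pullbackWeight {V : Type*} [NormedAddCommGroup V] [NormedSpace ℝ V]
    {F : E3 → ℝ} (hF : Continuous F) {m : V → E3} (hm : ContDiff ℝ 1 m) (e₁ e₂ : V) :
    Continuous (pullbackWeight F m e₁ e₂) :=
  (hF.comp hm.continuous).mul (Continuous.tripleProduct hm.continuous
    ((hm.continuous_fderiv one_ne_zero).clm_apply continuous_const)
    ((hm.continuous_fderiv one_ne_zero).clm_apply continuous_const))

lemma tendsto_pullbackWeight_mollify {F : E3 → ℝ} (hF : Continuous F) {m : E3 → E3}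
    (hm : ContDiff ℝ 1 m) (hmc : HasCompactSupport m) (e₁ e₂ x : E3) :
    Filter.Tendsto (fun k => pullbackWeight F (mollify k m) e₁ e₂ x) Filter.atTop
      (nhds (pullbackWeight F m e₁ e₂ x)) := by
  have h : ∀ e, Continuous fun y => fderiv ℝ m y e := fun e =>
    (hm.continuous_fderiv one_ne_zero).clm_apply continuous_const
  have hc : Continuous fun z : E3 × E3 × E3 => F z.1 * tripleProduct z.1 z.2.1 z.2.2 :=
    (hF.comp continuous_fst).mul (Continuous.tripleProduct continuous_fst
      (continuous_fst.comp continuous_snd) (continuous_snd.comp continuous_snd))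
  have ht := (tendsto_mollify hm.continuous x).prodMk_nhds
    ((tendsto_mollify (h e₁) x).prodMk_nhds (tendsto_mollify (h e₂) x))
  have := (hc.tendsto _).comp ht
  refine this.congr fun k => ?_
  simp only [Function.comp, pullbackWeight, fderiv_mollify_apply_eq_mollify k hm hmc]

/-- Averaging does not increase the suprema of `m` and of its derivatives. The bound serves as a
majorant for dominated convergence. -/
lemma exists_bound_pullbackWeight_mollify {F : E3 → ℝ} (hF : Continuous F) {m : E3 → E3}
    (hm : ContDiff ℝ 1 m) (hmc : HasCompactSupport m) (e₁ e₂ : E3) :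
    ∃ B : ℝ, ∀ k x, ‖pullbackWeight F (mollify k m) e₁ e₂ x‖ ≤ B := by
  have h : ∀ e, Continuous fun y => fderiv ℝ m y e := fun e =>
    (hm.continuous_fderiv one_ne_zero).clm_apply continuous_const
  obtain ⟨a, ha⟩ := hmc.exists_bound_of_continuous hm.continuous
  obtain ⟨b, hb⟩ := (hmc.fderiv_apply ℝ e₁).exists_bound_of_continuous (h e₁)
  obtain ⟨c, hc⟩ := (hmc.fderiv_apply ℝ e₂).exists_bound_of_continuous (h e₂)
  have hcont : Continuous fun z : E3 × E3 × E3 => F z.1 * tripleProduct z.1 z.2.1 z.2.2 :=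
    (hF.comp continuous_fst).mul (Continuous.tripleProduct continuous_fst
      (continuous_fst.comp continuous_snd) (continuous_snd.comp continuous_snd))
  have hK : IsCompact (Metric.closedBall (0 : E3) a ×ˢ
      (Metric.closedBall (0 : E3) b ×ˢ Metric.closedBall (0 : E3) c)) :=
    (isCompact_closedBall _ _).prod ((isCompact_closedBall _ _).prod (isCompact_closedBall _ _))
  obtain ⟨B, hB⟩ := hK.exists_bound_of_continuousOn hcont.continuousOn
  refine ⟨B, fun k x => ?_⟩
  rw [pullbackWeight, fderiv_mollify_apply_eq_mollify k hm hmc,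
    fderiv_mollify_apply_eq_mollify k hm hmc]
  refine hB (_, _, _) ⟨?_, ?_, ?_⟩
  · exact mem_closedBall_zero_iff.2 (norm_mollify_le hm.continuous.locallyIntegrable ha)
  · exact mem_closedBall_zero_iff.2 (norm_mollify_le (h e₁).locallyIntegrable hb)
  · exact mem_closedBall_zero_iff.2 (norm_mollify_le (h e₂).locallyIntegrable hc)

namespace ConvexPolyhedron

variable {P : ConvexPolyhedron}

namespace CleavedSurface

variable {v : E3} (C : P.CleavedSurface v)

lemma fluxDensity_step {F : E3 → ℝ} {m : E3 → E3} {θ : ℝ → ℝ} (hθ : ContDiff ℝ ∞ θ) (x : E3) :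
    fluxDensity F m (fun x => θ ⟪C.u, x⟫) x =
      deriv θ ⟪C.u, x⟫ * pullbackWeight F m C.e₁ C.e₂ x :=
  fluxDensity_comp_inner C.orthonormal C.positive (hθ.differentiable (by simp) _)

lemma contDiff_step {θ : ℝ → ℝ} (hθ : ContDiff ℝ ∞ θ) :
    ContDiff ℝ 1 fun x : E3 => θ ⟪C.u, x⟫ :=
  (hθ.of_le (by norm_cast)).comp (contDiff_const.inner ℝ contDiff_id)

lemma abs_inner_u_sub_le (x y : E3) : |⟪C.u, x⟫ - ⟪C.u, y⟫| ≤ dist x y := by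
  rw [← inner_sub_right, dist_eq_norm]
  refine (abs_real_inner_le_norm _ _).trans ?_
  rw [C.norm_u, one_mul]

/-- The derivative of the step vanishes below height `C.height / 3`, so small kernels meet only
points above the plane, where the two fields coincide. -/
lemma eventually_integral_upperStep (n : E3 → E3) (H : ℝ × (ℝ × ℝ) → E3) (F : E3 → ℝ) :
    ∀ᶠ k in Filter.atTop,
      ∫ x, fluxDensity F (mollify k (P.extend n)) (fun x => C.upperStep ⟪C.u, x⟫) x =
      ∫ x, fluxDensity F (mollify k (C.gluedField n H)) (fun x => C.upperStep ⟪C.u, x⟫) x := by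
  have h6 : 0 < C.height / 6 := by have := C.height_pos; positivity
  filter_upwards [tendsto_kernelRadius.eventually_lt_const h6] with k hk
  congr 1
  ext1 x
  rw [C.fluxDensity_step C.contDiff_upperStep, C.fluxDensity_step C.contDiff_upperStep]
  by_cases hx : ⟪C.u, x⟫ < C.offset + C.height / 3
  · rw [C.deriv_upperStep_eq_zero hx, zero_mul, zero_mul]
  · congr 1
    refine Filter.EventuallyEq.pullbackWeight_eq ?_ F _ _
    have hev : ∀ᶠ y in nhds x, C.offset + C.height / 6 < ⟪C.u, y⟫ :=
      C.continuous_inner_u.continuousAt.eventually_const_lt (by linarith)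
    filter_upwards [hev] with y hy
    refine mollify_congr fun w hw => (C.gluedField_of_ge ?_).symm
    have h1 := (abs_le.1 (C.abs_inner_u_sub_le w y)).1
    rw [Metric.mem_ball] at hw
    linarith

section Homotopy

variable {n : E3 → E3} {H : ℝ × (ℝ × ℝ) → E3}
  (hH : ContinuousOn H (Icc (0 : ℝ) 1 ×ˢ C.region))
  (hT : ∀ t ∈ Icc (0 : ℝ) 1, C.IsTangent fun p => H (t, p))

include hH hT

/-- The difference of the two steps is supported in a slab that stays below the vertex and above the
cut, where the glued field is tame; hence the same flux crosses both levels. -/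
lemma eventually_integral_lowerStep (hn : P.IsTangentField n) (hP : interior P.body ⊆ P.domain)
    (h0 : ∀ p ∈ C.region, H (0, p) = n (C.param p)) {σ : P.Sector} {F : E3 → ℝ} {κ : ℝ}
    (hF : IsSectorWeight σ F κ) :
    ∀ᶠ k in Filter.atTop,
      ∫ x, fluxDensity F (mollify k (C.gluedField n H)) (fun x => C.lowerStep ⟪C.u, x⟫) x =
      ∫ x, fluxDensity F (mollify k (C.gluedField n H)) (fun x => C.upperStep ⟪C.u, x⟫) x := by
  have c1 := C.contDiff_step C.contDiff_lowerStep
  have c2 := C.contDiff_step C.contDiff_upperStep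
  have hM := (C.integrable_gluedField hH hT hn).locallyIntegrable
  have hMc := C.hasCompactSupport_gluedField (n := n) (H := H)
  have hsupp : tsupport (fun x : E3 => C.lowerStep ⟪C.u, x⟫ - C.upperStep ⟪C.u, x⟫) ⊆
      {x | C.offset - 3 ≤ ⟪C.u, x⟫ ∧ ⟪C.u, x⟫ ≤ C.offset + 2 * C.height / 3} := by
    refine closure_minimal (fun x hx => ?_) ((isClosed_le continuous_const
      C.continuous_inner_u).inter (isClosed_le C.continuous_inner_u continuous_const))
    have hh := C.height_pos
    by_contra hcon
    rw [mem_ofPred_eq, not_and_or, not_le, not_le] at hcon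
    refine hx ?_
    rcases hcon with h | h
    · change C.lowerStep _ - C.upperStep _ = 0
      rw [C.lowerStep_eq_zero h.le, C.upperStep_eq_zero (by linarith), sub_zero]
    · change C.lowerStep _ - C.upperStep _ = 0
      rw [C.lowerStep_eq_one (by linarith), C.upperStep_eq_one h.le, sub_self]
  have hev := eventually_integral_fluxDensity_eq_zero hF.contDiff hF.zero hM hMc (c1.sub c2)
    (fun x hx => by
      have h := hsupp hx
      have hh := C.height_pos
      refine C.isTameAt_gluedField hH hT hn hP h0 hF (by linarith [h.1]) ?_
      have : ⟪C.u, v⟫ = C.offset + C.height := by rw [height]; ring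
      linarith [h.2])
  filter_upwards [hev] with k hk
  have cm : ContDiff ℝ 2 (mollify k (C.gluedField n H)) :=
    (contDiff_mollify k hM).of_le (by norm_cast)
  have hmc := hasCompactSupport_mollify k hMc
  rw [← sub_eq_zero, ← integral_sub (integrable_fluxDensity hF.contDiff cm hmc c1)
    (integrable_fluxDensity hF.contDiff cm hmc c2), ← hk]
  congr 1
  ext1 x
  exact (fluxDensity_sub (c1.differentiable (by simp) x) (c2.differentiable (by simp) x)).symm

/-- At these depths the glued field is `g ∘ C.proj` inside the cylinder, whose mollifications
converge together with their derivatives. By Fubini along `C.u`, where the derivative of the step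
has integral one, the limit is the surface integral. -/
lemma tendsto_integral_lowerStep (hn : P.IsTangentField n) {g : ℝ × ℝ → E3} (hg : ContDiff ℝ 1 g)
    (h1 : ∀ p ∈ C.region, H (1, p) = g p) {σ : P.Sector} {F : E3 → ℝ} {κ : ℝ}
    (hF : IsSectorWeight σ F κ) :
    Filter.Tendsto (fun k =>
      ∫ x, fluxDensity F (mollify k (C.gluedField n H)) (fun x => C.lowerStep ⟪C.u, x⟫) x)
      Filter.atTop (nhds (∫ p in C.region, pullbackWeight F g (1, 0) (0, 1) p)) := by
  have hM := (C.integrable_gluedField hH hT hn).locallyIntegrable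
  obtain ⟨R, hR0, hR1, hR2⟩ := C.exists_radius
  let χ : ContDiffBump (0 : E3) := ⟨R + 2, R + 3, by linarith, by linarith⟩
  set gc : E3 → E3 := fun x => χ x • g (C.proj x) with hgc
  have gc1 : ContDiff ℝ 1 gc := χ.contDiff.smul (hg.comp C.proj.contDiff)
  have gcc : HasCompactSupport gc := χ.hasCompactSupport.smul_right
  have gcl : LocallyIntegrable gc := gc1.continuous.locallyIntegrable
  have gc_near : ∀ {x : E3}, ‖x‖ < R + 2 → gc =ᶠ[nhds x] fun y => g (C.proj y) := by
    intro x hx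
    filter_upwards [Metric.isOpen_ball.mem_nhds (mem_ball_zero_iff.2 hx)] with y hy
    rw [hgc]
    simp only
    rw [χ.one_of_mem_closedBall (Metric.ball_subset_closedBall hy), one_smul]
  set ψ : ℕ → E3 → ℝ := fun k x => deriv C.lowerStep ⟪C.u, x⟫ *
    (C.proj ⁻¹' C.region).indicator (pullbackWeight F (mollify k gc) C.e₁ C.e₂) x with hψ
  -- the mollified glued field may be replaced by the mollification of a differentiable map
  have hev : ∀ᶠ k in Filter.atTop, ∀ x ∈ Metric.closedBall (0 : E3) (R + 1) ∩
      {x | C.offset - 3 ≤ ⟪C.u, x⟫ ∧ ⟪C.u, x⟫ ≤ C.offset - 2},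
      pullbackWeight F (mollify k (C.gluedField n H)) C.e₁ C.e₂ x =
        (C.proj ⁻¹' C.region).indicator (pullbackWeight F (mollify k gc) C.e₁ C.e₂) x := by
    refine IsCompact.eventually_forall_of_eventually_prod ?_ ?_
    · exact (isCompact_closedBall _ _).inter_right ((isClosed_le continuous_const
        C.continuous_inner_u).inter (isClosed_le C.continuous_inner_u continuous_const))
    rintro x ⟨hxR, hx3, hx2⟩
    rw [mem_closedBall_zero_iff] at hxR
    have hglue : C.gluedField n H =ᶠ[nhds x] C.homotopyField H := by
      filter_upwards [C.continuous_inner_u.continuousAt.eventually_const_lt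
          (show C.offset - 4 < ⟪C.u, x⟫ by linarith),
        C.continuous_inner_u.continuousAt.eventually_lt_const
          (show ⟪C.u, x⟫ < C.offset by linarith)] with y hy1 hy2
      exact C.gluedField_of_lt hy1.le hy2
    by_cases hxb : C.param (C.proj x) ∈ P.body
    · by_cases hxi : C.param (C.proj x) ∈ interior P.body
      · have hreg : ∀ᶠ y in nhds x, C.proj y ∈ C.region :=
          C.proj.continuous.continuousAt.preimage_mem_nhds (C.region_mem_nhds hxi)
        have heq : C.gluedField n H =ᶠ[nhds x] gc := by
          filter_upwards [hglue, gc_near (show ‖x‖ < R + 2 by linarith), hreg,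
            C.continuous_inner_u.continuousAt.eventually_lt_const
              (show ⟪C.u, x⟫ < C.offset - 1 by linarith)] with y hy1 hy2 hy3 hy4
          rw [hy1, hy2, C.homotopyField_of_mem hy3, min_eq_left (le_max_of_le_right (by linarith)),
            h1 _ hy3]
        filter_upwards [eventually_mollify_eventuallyEq heq, hreg.prod_inr Filter.atTop]
          with z hz hz2
        rw [indicator_of_mem (show z.2 ∈ C.proj ⁻¹' C.region from hz2)]
        exact hz.pullbackWeight_eq F _ _
      -- At the rim of the region the two mollified maps differ, but both stay near the great circle
      -- of a face and the weight annihilates both.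
      · obtain ⟨c, hc⟩ := exists_face_of_notMem_interior hxb hxi
        have e1 : ∀ᶠ y in nhds x, σ.form c (C.gluedField n H y) ≤ κ / 2 := by
          filter_upwards [hglue, C.eventually_form_homotopyField_le hH hT σ hc (half_pos hF.pos)]
            with y hy1 hy2
          rwa [hy1]
        have e2 : ∀ᶠ y in nhds x, σ.form c (gc y) ≤ κ / 2 := by
          have h0 : σ.form c (g (C.proj x)) < κ / 2 := by
            rw [← h1 _ hxb, σ.form_eq_zero ((hT 1 ⟨zero_le_one, le_rfl⟩).2 c _ hxb hc)]
            exact half_pos hF.pos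
          have hcont : Continuous fun y => σ.form c (g (C.proj y)) :=
            (σ.continuous_form c).comp (hg.continuous.comp C.proj.continuous)
          filter_upwards [gc_near (show ‖x‖ < R + 2 by linarith),
            hcont.continuousAt.eventually_lt_const h0] with y hy1 hy2
          rw [hy1]; exact hy2.le
        filter_upwards [hF.eventually_mollify_eq_zero_of_form hM e1,
          hF.eventually_mollify_eq_zero_of_form gcl e2] with z hz1 hz2
        rw [pullbackWeight, hz1, zero_mul]
        by_cases hz : z.2 ∈ C.proj ⁻¹' C.region
        · rw [indicator_of_mem hz, pullbackWeight, hz2, zero_mul]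
        · rw [indicator_of_notMem hz]
    · have e1 : ∀ᶠ y in nhds x, C.gluedField n H y = 0 := by
        filter_upwards [hglue, C.eventually_homotopyField_eq_zero hxb] with y hy1 hy2
        rw [hy1, hy2]
      have e2 : ∀ᶠ y in nhds x, C.proj y ∉ C.region :=
        C.proj.continuous.continuousAt.preimage_mem_nhds
          (C.isClosed_region.isOpen_compl.mem_nhds hxb)
      filter_upwards [hF.eventually_mollify_eq_zero hM e1, e2.prod_inr Filter.atTop] with z hz1 hz2
      rw [pullbackWeight, hz1, zero_mul,
        indicator_of_notMem (show z.2 ∉ C.proj ⁻¹' C.region from hz2)]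
  have hψeq : ∀ᶠ k in Filter.atTop, ∫ x, ψ k x =
      ∫ x, fluxDensity F (mollify k (C.gluedField n H)) (fun x => C.lowerStep ⟪C.u, x⟫) x := by
    filter_upwards [hev, tendsto_kernelRadius.eventually_lt_const one_pos] with k hk hk1
    congr 1
    ext1 x
    rw [C.fluxDensity_step C.contDiff_lowerStep]
    by_cases hs : ⟪C.u, x⟫ ∈ Icc (C.offset - 3) (C.offset - 2)
    · by_cases hxR : x ∈ Metric.closedBall (0 : E3) (R + 1)
      · rw [hk x ⟨hxR, hs⟩]
      · have hxr : C.proj x ∉ C.region := fun h => hxR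
          (Metric.closedBall_subset_closedBall (by linarith)
            (hR2 x h (by linarith [hs.1]) (by linarith [hs.2])))
        have h0 : mollify k (C.gluedField n H) x = 0 := by
          refine mollify_mem (Q := {0}) hM (convex_singleton 0) isClosed_singleton fun y hy => ?_
          refine C.gluedField_eq_zero hR1 hR2 fun hy' => hxR ?_
          rw [mem_closedBall_zero_iff] at hy' ⊢
          rw [Metric.mem_ball, dist_eq_norm] at hy
          have := norm_sub_norm_le x y
          rw [norm_sub_rev] at this
          linarith
        simp only [hψ]
        rw [indicator_of_notMem (show x ∉ C.proj ⁻¹' C.region from hxr), pullbackWeight, h0,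
          hF.zero, zero_mul]
    · simp only [hψ]
      rw [C.deriv_lowerStep_eq_zero hs, zero_mul, zero_mul]
  refine Filter.Tendsto.congr' hψeq ?_
  have hlim : ∫ p in C.region, pullbackWeight F g (1, 0) (0, 1) p =
      ∫ x, deriv C.lowerStep ⟪C.u, x⟫ *
        C.region.indicator (pullbackWeight F g (1, 0) (0, 1)) (C.proj x) := by
    rw [C.integral_coordinates, C.integral_deriv_lowerStep, one_mul,
      integral_indicator C.isClosed_region.measurableSet]
  rw [hlim]
  obtain ⟨B, hB⟩ := exists_bound_pullbackWeight_mollify hF.contDiff.continuous gc1 gcc C.e₁ C.e₂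
  obtain ⟨L, hL⟩ :=
    C.hasCompactSupport_deriv_lowerStep.exists_bound_of_continuous C.continuous_deriv_lowerStep
  have hmeas : MeasurableSet (C.proj ⁻¹' C.region) :=
    (C.isClosed_region.preimage C.proj.continuous).measurableSet
  set A : Set E3 := Metric.closedBall (0 : E3) R with hA
  have hout : ∀ x ∉ A, deriv C.lowerStep ⟪C.u, x⟫ = 0 ∨ C.proj x ∉ C.region := by
    intro x hx
    by_contra! h
    have hs : ⟪C.u, x⟫ ∈ Icc (C.offset - 3) (C.offset - 2) := by
      by_contra hs
      exact h.1 (C.deriv_lowerStep_eq_zero hs)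
    exact hx (hR2 x h.2 (by linarith [hs.1]) (by linarith [hs.2]))
  refine tendsto_integral_of_dominated_convergence (A.indicator fun _ => L * B) ?_ ?_ ?_ ?_
  · intro k
    refine ((C.continuous_deriv_lowerStep.comp C.continuous_inner_u).aestronglyMeasurable).mul ?_
    exact (continuous_pullbackWeight hF.contDiff.continuous
      ((contDiff_mollify k gcl).of_le (by norm_cast)) _ _).aestronglyMeasurable.indicator hmeas
  · rw [integrable_indicator_iff Metric.isClosed_closedBall.measurableSet]
    exact integrableOn_const (isCompact_closedBall _ _).measure_lt_top.ne
  · refine fun k => Filter.Eventually.of_forall fun x => ?_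
    have hB0 : 0 ≤ B := (norm_nonneg _).trans (hB 0 0)
    by_cases hx : x ∈ A
    · rw [indicator_of_mem hx, norm_mul]
      refine mul_le_mul (hL _) ?_ (norm_nonneg _) ((norm_nonneg _).trans (hL 0))
      exact (norm_indicator_le_norm_self _ _).trans (hB k x)
    · rw [indicator_of_notMem hx]
      rcases hout x hx with h | h
      · simp [hψ, h]
      · simp only [hψ]
        rw [indicator_of_notMem (show x ∉ C.proj ⁻¹' C.region from h)]; simp
  · refine Filter.Eventually.of_forall fun x => ?_
    by_cases hx : x ∈ A
    · refine Filter.Tendsto.const_mul _ ?_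
      by_cases hr : C.proj x ∈ C.region
      · simp only [indicator_of_mem (show x ∈ C.proj ⁻¹' C.region from hr), indicator_of_mem hr]
        have hxR : ‖x‖ < R + 2 := by
          have := mem_closedBall_zero_iff.1 hx
          linarith
        have hd : ∀ e, fderiv ℝ (fun y => g (C.proj y)) x e = fderiv ℝ g (C.proj x) (C.proj e) := by
          intro e
          rw [fderiv_fun_comp x (hg.differentiable (by simp) _) C.proj.differentiableAt]
          simp
        have := tendsto_pullbackWeight_mollify hF.contDiff.continuous gc1 gcc C.e₁ C.e₂ x
        rw [(gc_near hxR).pullbackWeight_eq] at this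
        rw [pullbackWeight, ← C.proj_e₁, ← C.proj_e₂, ← hd, ← hd]
        exact this
      · simp only [indicator_of_notMem (show x ∉ C.proj ⁻¹' C.region from hr),
          indicator_of_notMem hr]
        exact tendsto_const_nhds
    · rcases hout x hx with h | h
      · simp only [hψ, h, zero_mul]; exact tendsto_const_nhds
      · simp only [hψ, indicator_of_notMem (show x ∉ C.proj ⁻¹' C.region from h),
          indicator_of_notMem h]
        exact tendsto_const_nhds

/-- The flux of the mollified field near a vertex is given by the differentiable representative of
the field on the cleaved surface. -/
lemma tendsto_integral_upperStep (hn : P.IsTangentField n) (hP : interior P.body ⊆ P.domain)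
    (h0 : ∀ p ∈ C.region, H (0, p) = n (C.param p)) {g : ℝ × ℝ → E3} (hg : ContDiff ℝ 1 g)
    (h1 : ∀ p ∈ C.region, H (1, p) = g p) {σ : P.Sector} {F : E3 → ℝ} {κ : ℝ}
    (hF : IsSectorWeight σ F κ) :
    Filter.Tendsto (fun k =>
      ∫ x, fluxDensity F (mollify k (P.extend n)) (fun x => C.upperStep ⟪C.u, x⟫) x)
      Filter.atTop (nhds (∫ p in C.region, pullbackWeight F g (1, 0) (0, 1) p)) := by
  refine (C.tendsto_integral_lowerStep hH hT hn hg h1 hF).congr' ?_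
  filter_upwards [C.eventually_integral_upperStep n H F,
    C.eventually_integral_lowerStep hH hT hn hP h0 hF] with k hk1 hk2
  rw [hk1, hk2]

end Homotopy

end CleavedSurface

end ConvexPolyhedron

/-! ### The energy bound in one sector. -/

open Filter Topology in
lemma eventually_closedBall_kernelRadius {x : E3} {N : Set E3} (hN : N ∈ 𝓝 x) :
    ∀ᶠ z : ℕ × E3 in atTop ×ˢ 𝓝 x, Metric.closedBall z.2 (kernelRadius z.1) ⊆ N := by
  obtain ⟨r, hr, hrN⟩ := Metric.mem_nhds_iff.1 hN
  have h1 : ∀ᶠ k in atTop, kernelRadius k < r / 2 :=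
    tendsto_kernelRadius.eventually_lt_const (by positivity)
  have h2 : ∀ᶠ y in 𝓝 x, dist y x < r / 2 := Metric.ball_mem_nhds x (by positivity)
  filter_upwards [h1.prod_mk h2] with z hz
  refine subset_trans (Metric.closedBall_subset_ball' ?_) hrN
  linarith [hz.1, hz.2]

namespace ConvexPolyhedron

variable {P : ConvexPolyhedron}

/-- The set of interior points at which the field lies in a given sector. -/
def sectorPreimage (P : ConvexPolyhedron) (n : E3 → E3) (σ : P.Sector) : Set E3 :=
  interior P.body ∩ n ⁻¹' {y | ∀ c, 0 < σ.form c y}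

lemma IsTangentField.isOpen_sectorPreimage {n : E3 → E3} (hn : P.IsTangentField n)
    (hP : interior P.body ⊆ P.domain) (σ : P.Sector) : IsOpen (P.sectorPreimage n σ) :=
  (hn.continuousOn.mono hP).isOpen_inter_preimage isOpen_interior σ.isOpen_cone

/-- The Dirichlet energy density, given the gradient. -/
def energyDensity (G : Fin 3 → E3 → E3) (x : E3) : ℝ≥0∞ := ∑ i, ‖G i x‖ₑ ^ 2

lemma integrable_indicator_of_energy {n : E3 → E3} {G : Fin 3 → E3 → E3}
    (hG : P.IsWeakGradient n G) {V : Set E3} (hV : MeasurableSet V) (hVi : V ⊆ interior P.body)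
    (hE : ∫⁻ x in V, energyDensity G x < ⊤) (i : Fin 3) : Integrable (V.indicator (G i)) := by
  rw [integrable_indicator_iff hV]
  have hmeas : AEStronglyMeasurable (G i) (volume.restrict V) :=
    (hG i).1.aestronglyMeasurable.mono_measure (Measure.restrict_mono hVi le_rfl)
  have hfin : volume V < ⊤ :=
    (measure_mono (hVi.trans interior_subset)).trans_lt P.isCompact_body.measure_lt_top
  have : IsFiniteMeasure (volume.restrict V) := ⟨by simpa using hfin⟩
  refine MemLp.integrable (q := 2) (by norm_num) ⟨hmeas, ?_⟩
  rw [eLpNorm_lt_top_iff_lintegral_rpow_enorm_lt_top (by norm_num) (by norm_num)]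
  refine lt_of_le_of_lt (lintegral_mono fun x => ?_) hE
  simp only [ENNReal.toReal_ofNat, ENNReal.rpow_ofNat]
  exact Finset.single_le_sum (f := fun i => ‖G i x‖ₑ ^ 2) (fun _ _ => zero_le) (Finset.mem_univ i)

/-- Where the flux density of the mollified field does not vanish, the field nearby takes values in
the cone over the sector. -/
lemma IsTangentField.eventually_closedBall_subset {n : E3 → E3} (hn : P.IsTangentField n)
    (hP : interior P.body ⊆ P.domain)
    {σ : P.Sector} {F : E3 → ℝ} {κ : ℝ} (hF : IsSectorWeight σ F κ) {ξ : E3 → ℝ}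
    (hξv : ∀ v ∈ P.vertices, ∀ᶠ x in nhds v, ξ x = ξ v) {δ : ℝ} (hδ0 : 0 < δ) :
    ∀ᶠ k in Filter.atTop, ∀ x, fluxDensity F (mollify k (P.extend n)) ξ x ≠ 0 →
      1 - δ ≤ ‖mollify k (P.extend n) x‖ ∧
        Metric.closedBall x (kernelRadius k) ⊆ P.sectorPreimage n σ := by
  have hVo : IsOpen (P.sectorPreimage n σ) := hn.isOpen_sectorPreimage hP σ
  have hM := hn.integrable_extend.locallyIntegrable
  obtain ⟨R, hR⟩ := P.isCompact_body.isBounded.subset_closedBall (0 : E3)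
  have hev : ∀ᶠ k in Filter.atTop, ∀ x ∈ Metric.closedBall (0 : E3) (R + 1),
      fderiv ℝ ξ x = 0 ∨ F (mollify k (P.extend n) x) = 0 ∨
      (1 - δ ≤ ‖mollify k (P.extend n) x‖ ∧
        Metric.closedBall x (kernelRadius k) ⊆ P.sectorPreimage n σ) := by
    refine (isCompact_closedBall _ _).eventually_forall_of_eventually_prod fun x _ => ?_
    -- The field has no limit to control at a vertex; there the density vanishes because `ξ` is
    -- locally constant. Elsewhere outside the preimage the weight vanishes.
    by_cases hxv : x ∈ P.vertices
    · filter_upwards [(eventually_eventually_nhds.2 (hξv x hxv)).prod_inr Filter.atTop] with z hz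
      left
      have : ξ =ᶠ[nhds z.2] fun _ => ξ x := hz
      rw [this.fderiv_eq]; simp
    by_cases hxb : x ∈ P.body
    · have hxd : x ∈ P.domain := ⟨hxb, hxv⟩
      by_cases hxi : x ∈ interior P.body
      · by_cases hxV : x ∈ P.sectorPreimage n σ
        · have h1 := (hn.continuousAt_extend hP hxi).eventually (Metric.closedBall_mem_nhds _ hδ0)
          filter_upwards [eventually_mollify_mem hM (convex_closedBall _ _)
            Metric.isClosed_closedBall h1, eventually_closedBall_kernelRadius (hVo.mem_nhds hxV)]
            with z hz1 hz2
          refine Or.inr (Or.inr ⟨?_, hz2⟩)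
          rw [extend_eq hxd, Metric.mem_closedBall, dist_eq_norm, norm_sub_rev] at hz1
          have := norm_sub_norm_le (n x) (mollify z.1 (P.extend n) z.2)
          rw [hn.norm_eq_one x hxd] at this
          linarith
        · have : ∃ c, σ.form c (n x) ≤ 0 := by
            by_contra! h
            exact hxV ⟨hxi, h⟩
          obtain ⟨c, hc⟩ := this
          filter_upwards [hF.eventually_mollify_eq_zero_of_form hM
            (hn.eventually_form_extend_le σ hxd (half_pos hF.pos) hc)] with z hz
          exact Or.inr (Or.inl hz)
      · obtain ⟨c, hc⟩ := exists_face_of_notMem_interior hxb hxi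
        filter_upwards [hF.eventually_mollify_eq_zero_of_form hM
          (hn.eventually_form_extend_le σ hxd (half_pos hF.pos)
            (σ.form_eq_zero (hn.tangent c x ⟨hc, hxd⟩)).le)] with z hz
        exact Or.inr (Or.inl hz)
    · filter_upwards [hF.eventually_mollify_eq_zero hM (eventually_extend_eq_zero hxb)] with z hz
      exact Or.inr (Or.inl hz)
  filter_upwards [hev, tendsto_kernelRadius.eventually_lt_const one_pos] with k hk hk1 x h0
  have hFx : F (mollify k (P.extend n) x) ≠ 0 := fun h => h0 (by rw [fluxDensity, h, zero_mul])
  have hξx : fderiv ℝ ξ x ≠ 0 := fun h => h0 (by simp [fluxDensity, partialDeriv, h])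
  refine ((hk x ?_).resolve_left hξx).resolve_left hFx
  by_contra hxR
  refine hFx ?_
  have : mollify k (P.extend n) x = 0 := by
    refine mollify_mem (Q := {0}) hM (convex_singleton 0) isClosed_singleton fun y hy => ?_
    refine extend_eq_zero fun hy' => hxR ?_
    have h1 := hR hy'
    rw [mem_closedBall_zero_iff] at h1 ⊢
    rw [Metric.mem_ball, dist_eq_norm] at hy
    have := norm_sub_norm_le x y
    rw [norm_sub_rev] at this
    linarith
  rw [this, hF.zero]

/-- By homogeneity `F ‖m‖ ≤ ‖m‖⁻²`, so a mollified field slightly shorter than one costs only a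
factor `(1 - δ)⁻²`. -/
lemma IsSectorWeight.abs_fluxDensity_le {σ : P.Sector} {F : E3 → ℝ} {κ : ℝ}
    (hF : IsSectorWeight σ F κ) {m : E3 → E3} {ξ : E3 → ℝ} {x : E3} (hξ1 : ‖fderiv ℝ ξ x‖ ≤ 1)
    {δ : ℝ} (hδ : δ < 1 / 2) (hm : 1 - δ ≤ ‖m x‖) :
    2 * (1 - δ) ^ 2 * |fluxDensity F m ξ x| ≤ ∑ i, ‖partialDeriv i m x‖ ^ 2 := by
  have h1 := _root_.abs_fluxDensity_le (F := F) (m := m) hξ1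
  rw [abs_of_nonneg (hF.nonneg _)] at h1
  have h2 := hF.le (m x) (by linarith)
  have h3 : 0 ≤ ∑ i, ‖partialDeriv i m x‖ ^ 2 := Finset.sum_nonneg fun _ _ => sq_nonneg _
  have h4 : (1 - δ) ^ 2 * (F (m x) * ‖m x‖) ≤ 1 := by
    refine le_trans ?_ h2
    have h5 : (1 - δ) ^ 2 ≤ ‖m x‖ ^ 2 := pow_le_pow_left₀ (by linarith) hm 2
    have h6 : 0 ≤ F (m x) * ‖m x‖ := mul_nonneg (hF.nonneg _) (norm_nonneg _)
    calc (1 - δ) ^ 2 * (F (m x) * ‖m x‖) ≤ ‖m x‖ ^ 2 * (F (m x) * ‖m x‖) :=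
          mul_le_mul_of_nonneg_right h5 h6
      _ = F (m x) * ‖m x‖ ^ 3 := by ring
  calc 2 * (1 - δ) ^ 2 * |fluxDensity F m ξ x|
      = (1 - δ) ^ 2 * (2 * |fluxDensity F m ξ x|) := by ring
    _ ≤ (1 - δ) ^ 2 * (F (m x) * ‖m x‖ * ∑ i, ‖partialDeriv i m x‖ ^ 2) :=
        mul_le_mul_of_nonneg_left h1 (sq_nonneg _)
    _ = ((1 - δ) ^ 2 * (F (m x) * ‖m x‖)) * ∑ i, ‖partialDeriv i m x‖ ^ 2 := by ring
    _ ≤ 1 * ∑ i, ‖partialDeriv i m x‖ ^ 2 := mul_le_mul_of_nonneg_right h4 h3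
    _ = _ := one_mul _

/-- Jensen's inequality for the gradient of the mollified field. -/
lemma ofReal_sum_partialDeriv_le {n : E3 → E3} {G : Fin 3 → E3 → E3}
    (hP : interior P.body ⊆ P.domain) (hG : P.IsWeakGradient n G)
    (hn : LocallyIntegrable (P.extend n)) {V : Set E3} (hVi : V ⊆ interior P.body)
    (hint : ∀ i, Integrable (V.indicator (G i))) {k : ℕ} {x : E3}
    (hball : Metric.closedBall x (kernelRadius k) ⊆ V) :
    ENNReal.ofReal (∑ i, ‖partialDeriv i (mollify k (P.extend n)) x‖ ^ 2) ≤
      ∫⁻ y, ENNReal.ofReal (kernel k (x - y)) * V.indicator (energyDensity G) y := by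
  have hpd : ∀ i, partialDeriv i (mollify k (P.extend n)) x = mollify k (V.indicator (G i)) x := by
    intro i
    rw [partialDeriv_mollify_extend hP hG hn (hball.trans hVi), mollify_apply,
      ← integral_indicator isOpen_interior.measurableSet]
    congr 1
    ext1 y
    by_cases hy : kernel k (x - y) = 0
    · by_cases hyi : y ∈ interior P.body
      · rw [indicator_of_mem hyi, hy, zero_smul, zero_smul]
      · rw [indicator_of_notMem hyi, hy, zero_smul]
    · have hyV : y ∈ V := hball (Metric.ball_subset_closedBall (mem_ball_of_kernel_ne_zero hy))
      rw [indicator_of_mem (hVi hyV), indicator_of_mem hyV]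
  rw [ENNReal.ofReal_sum_of_nonneg fun _ _ => sq_nonneg _]
  have hJ : ∀ i, ENNReal.ofReal (‖partialDeriv i (mollify k (P.extend n)) x‖ ^ 2) ≤
      ∫⁻ y, ENNReal.ofReal (kernel k (x - y)) * ‖V.indicator (G i) y‖ₑ ^ 2 := by
    intro i
    rw [ENNReal.ofReal_pow (norm_nonneg _), ofReal_norm, hpd i]
    exact enorm_mollify_sq_le (hint i).locallyIntegrable x
  refine (Finset.sum_le_sum fun i _ => hJ i).trans (le_of_eq ?_)
  rw [← lintegral_finsetSum' _ fun i _ => ?_]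
  · refine lintegral_congr fun y => ?_
    rw [← Finset.mul_sum]
    by_cases hy : y ∈ V
    · simp only [indicator_of_mem hy, energyDensity]
    · simp [indicator_of_notMem hy]
  · exact (measurable_ofReal_kernel k x).aemeasurable.mul
      ((hint i).aestronglyMeasurable.enorm.pow_const 2)

/-- The mollified field satisfies the energy bound, localized to the preimage of a sector. -/
lemma IsTangentField.eventually_two_mul_integral_le {n : E3 → E3} (hn : P.IsTangentField n)
    (hP : interior P.body ⊆ P.domain) {G : Fin 3 → E3 → E3} (hG : P.IsWeakGradient n G)
    {σ : P.Sector} {F : E3 → ℝ} {κ : ℝ} (hF : IsSectorWeight σ F κ)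
    (hE : ∫⁻ x in P.sectorPreimage n σ, energyDensity G x < ⊤) {ξ : E3 → ℝ}
    (hξ : ContDiff ℝ 1 ξ) (hξ1 : ∀ x, ‖fderiv ℝ ξ x‖ ≤ 1)
    (hξv : ∀ v ∈ P.vertices, ∀ᶠ x in nhds v, ξ x = ξ v) {δ : ℝ} (hδ0 : 0 < δ) (hδ : δ < 1 / 2) :
    ∀ᶠ k in Filter.atTop,
      2 * (1 - δ) ^ 2 * ∫ x, fluxDensity F (mollify k (P.extend n)) ξ x ≤
        (∫⁻ x in P.sectorPreimage n σ, energyDensity G x).toReal := by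
  have hVo : IsOpen (P.sectorPreimage n σ) := hn.isOpen_sectorPreimage hP σ
  have hVi : P.sectorPreimage n σ ⊆ interior P.body := inter_subset_left
  have hM := hn.integrable_extend.locallyIntegrable
  have hint := integrable_indicator_of_energy hG hVo.measurableSet hVi hE
  filter_upwards [hn.eventually_closedBall_subset hP hF hξv hδ0] with k hk
  have hcm : ContDiff ℝ 2 (mollify k (P.extend n)) := (contDiff_mollify k hM).of_le (by norm_cast)
  have hfi : Integrable (fluxDensity F (mollify k (P.extend n)) ξ) :=
    integrable_fluxDensity hF.contDiff hcm (hasCompactSupport_mollify k hasCompactSupport_extend) hξ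
  have hδ2 : 0 ≤ 2 * (1 - δ) ^ 2 := mul_nonneg zero_le_two (sq_nonneg _)
  have hpt : ∀ x, ENNReal.ofReal
      (2 * (1 - δ) ^ 2 * |fluxDensity F (mollify k (P.extend n)) ξ x|) ≤
      ∫⁻ y, ENNReal.ofReal (kernel k (x - y)) *
        (P.sectorPreimage n σ).indicator (energyDensity G) y := by
    intro x
    by_cases h0 : fluxDensity F (mollify k (P.extend n)) ξ x = 0
    · rw [h0]; simp
    obtain ⟨hm1, hball⟩ := hk x h0
    exact (ENNReal.ofReal_le_ofReal (hF.abs_fluxDensity_le (hξ1 x) hδ hm1)).trans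
      (ofReal_sum_partialDeriv_le hP hG hM hVi hint hball)
  have hmeas : AEMeasurable ((P.sectorPreimage n σ).indicator (energyDensity G)) := by
    have : (P.sectorPreimage n σ).indicator (energyDensity G) =
        fun x => ∑ i, ‖(P.sectorPreimage n σ).indicator (G i) x‖ₑ ^ 2 := by
      ext1 x
      by_cases hx : x ∈ P.sectorPreimage n σ <;> simp [hx, energyDensity]
    rw [this]
    exact Finset.aemeasurable_fun_sum _ fun i _ =>
      (hint i).aestronglyMeasurable.enorm.pow_const 2
  -- By Tonelli the kernel integrates to one in `x` as well, so averaging preserves the total of the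
  -- energy density.
  have htot : ENNReal.ofReal
      (2 * (1 - δ) ^ 2 * ∫ x, |fluxDensity F (mollify k (P.extend n)) ξ x|) ≤
      ∫⁻ x in P.sectorPreimage n σ, energyDensity G x := by
    rw [← integral_const_mul, ofReal_integral_eq_lintegral_ofReal (hfi.abs.const_mul _)
      (Filter.Eventually.of_forall fun x => mul_nonneg hδ2 (abs_nonneg _))]
    refine (lintegral_mono hpt).trans ?_
    rw [lintegral_lintegral_kernel k hmeas, lintegral_indicator hVo.measurableSet]
  calc 2 * (1 - δ) ^ 2 * ∫ x, fluxDensity F (mollify k (P.extend n)) ξ x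
      ≤ 2 * (1 - δ) ^ 2 * ∫ x, |fluxDensity F (mollify k (P.extend n)) ξ x| :=
        mul_le_mul_of_nonneg_left (integral_mono hfi hfi.abs fun x => le_abs_self _) hδ2
    _ ≤ _ := (ENNReal.ofReal_le_iff_le_toReal hE.ne).1 htot

lemma CleavedSurface.tendsto_integral_pullbackWeight {v : E3} (C : P.CleavedSurface v)
    {g : ℝ × ℝ → E3} (hg : ContDiff ℝ 1 g) (hgT : C.IsTangent g) (σ : P.Sector) :
    Filter.Tendsto (fun j => ∫ p in C.region, pullbackWeight (σ.weight j) g (1, 0) (0, 1) p)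
      Filter.atTop (nhds (C.pullbackArea g σ.carrier)) := by
  have hT : Continuous fun p => tripleProduct (g p) (fderiv ℝ g p (1, 0)) (fderiv ℝ g p (0, 1)) :=
    Continuous.tripleProduct hg.continuous
      ((hg.continuous_fderiv one_ne_zero).clm_apply continuous_const)
      ((hg.continuous_fderiv one_ne_zero).clm_apply continuous_const)
  refine tendsto_integral_of_dominated_convergence
    (fun p => ‖tripleProduct (g p) (fderiv ℝ g p (1, 0)) (fderiv ℝ g p (0, 1))‖) ?_ ?_ ?_ ?_
  · exact fun j => (continuous_pullbackWeight (σ.contDiff_weight j).continuous hg _ _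
      ).aestronglyMeasurable
  · exact hT.norm.continuousOn.integrableOn_compact C.isCompact_region
  · refine fun j => (ae_restrict_mem C.isClosed_region.measurableSet).mono fun p hp => ?_
    have h1 := (σ.isSectorWeight_weight j).le (g p) (by rw [hgT.1 p hp]; norm_num)
    rw [hgT.1 p hp, one_pow, mul_one] at h1
    rw [pullbackWeight, norm_mul, Real.norm_of_nonneg (σ.weight_nonneg j _)]
    exact mul_le_of_le_one_left (norm_nonneg _) h1
  · refine (ae_restrict_mem C.isClosed_region.measurableSet).mono fun p hp => ?_
    have := (σ.tendsto_weight (hgT.1 p hp)).mul_const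
      (tripleProduct (g p) (fderiv ℝ g p (1, 0)) (fderiv ℝ g p (0, 1)))
    have e : σ.carrier.indicator
        (fun s => tripleProduct s (fderiv ℝ g p (1, 0)) (fderiv ℝ g p (0, 1))) (g p) =
        σ.carrier.indicator 1 (g p) *
          tripleProduct (g p) (fderiv ℝ g p (1, 0)) (fderiv ℝ g p (0, 1)) := by
      by_cases hc : g p ∈ σ.carrier <;> simp [hc]
    rw [e]
    exact this

/-- The energy in the preimage of a sector bounds the pairing of the wrapping numbers with a
Lipschitz function that is constant near the vertices. -/
lemma two_mul_area_mul_sum_le {n : E3 → E3} (hn : P.IsTangentField n) {G : Fin 3 → E3 → E3}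
    (hG : P.IsWeakGradient n G) {σ : P.Sector} {w : P.vertices → ℤ}
    (hw : ∀ v : P.vertices, P.IsWrappingNumber n v σ (w v)) (hA : σ.area.toReal ≠ 0)
    (hE : ∫⁻ x in P.sectorPreimage n σ, energyDensity G x < ⊤) {ξ : E3 → ℝ}
    (hξ : ContDiff ℝ 1 ξ) (hξ1 : ∀ x, ‖fderiv ℝ ξ x‖ ≤ 1)
    (hξv : ∀ v ∈ P.vertices, ∀ᶠ x in nhds v, ξ x = ξ v) :
    2 * σ.area.toReal * ∑ v : P.vertices, ξ v * w v ≤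
      (∫⁻ x in P.sectorPreimage n σ, energyDensity G x).toReal := by
  choose C g hg hgT hhom hwC using hw
  choose H hH hHT hH0 hH1 using hhom
  have hP : interior P.body ⊆ P.domain := fun x hx =>
    ⟨interior_subset hx, fun hxv => (C ⟨x, hxv⟩).notMem_interior hx⟩
  have hM := hn.integrable_extend.locallyIntegrable
  -- The combination `∑ ξ v * η v` agrees with `ξ` near every vertex. The difference carries no
  -- flux, so the flux integral of `ξ` splits into the contributions of the cleaved surfaces.
  set η : P.vertices → E3 → ℝ := fun v x => (C v).upperStep ⟪(C v).u, x⟫ with hη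
  have hη1 : ∀ v, ContDiff ℝ 1 (η v) := fun v => (C v).contDiff_step (C v).contDiff_upperStep
  have hsum1 : ContDiff ℝ 1 fun x => ∑ v : P.vertices, ξ v * η v x :=
    ContDiff.sum fun v _ => contDiff_const.mul (hη1 v)
  have hηself : ∀ v, ∀ᶠ x in nhds (v : E3), η v x = 1 := by
    intro v
    have hh := (C v).height_pos
    have : (C v).offset + 2 * (C v).height / 3 < ⟪(C v).u, (v : E3)⟫ := by
      have : ⟪(C v).u, (v : E3)⟫ = (C v).offset + (C v).height := by
        rw [CleavedSurface.height]; ring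
      linarith
    filter_upwards [(C v).continuous_inner_u.continuousAt.eventually_const_lt this] with x hx
    exact (C v).upperStep_eq_one hx.le
  have hηother : ∀ v v' : P.vertices, v' ≠ v → ∀ᶠ x in nhds (v' : E3), η v x = 0 := by
    intro v v' hne
    have hh := (C v).height_pos
    have : ⟪(C v).u, (v' : E3)⟫ < (C v).offset :=
      (C v).other_lt v' v'.2 fun h => hne (Subtype.ext h)
    filter_upwards [(C v).continuous_inner_u.continuousAt.eventually_lt_const this] with x hx
    exact (C v).upperStep_eq_zero (by linarith)
  have hnear : ∀ x ∈ tsupport (fun x => ξ x - ∑ v : P.vertices, ξ v * η v x), x ∉ P.vertices := by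
    intro x hx hxv
    refine notMem_tsupport_iff_eventuallyEq.2 ?_ hx
    have hall : ∀ᶠ y in nhds x, ∀ v, v ≠ ⟨x, hxv⟩ → η v y = 0 := by
      refine Filter.eventually_all.2 fun v => ?_
      by_cases hv : v = ⟨x, hxv⟩
      · exact Filter.Eventually.of_forall fun y h => absurd hv h
      · filter_upwards [hηother v ⟨x, hxv⟩ (Ne.symm hv)] with y hy _ using hy
    filter_upwards [hξv x hxv, hηself ⟨x, hxv⟩, hall] with y hy1 hy2 hy3
    rw [Finset.sum_eq_single (⟨x, hxv⟩ : P.vertices) (fun v _ hv => by rw [hy3 v hv, mul_zero])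
      (fun h => absurd (Finset.mem_univ _) h), hy1, hy2]
    simp
  -- Order of the limits: the mollification is removed first, then `δ → 0`, and only afterwards `j →
  -- ∞`, since the admissible kernels depend on both `δ` and the weight.
  have key : ∀ j, 2 * ∑ v : P.vertices, ξ v *
      (∫ p in (C v).region, pullbackWeight (σ.weight j) (g v) (1, 0) (0, 1) p) ≤
      (∫⁻ x in P.sectorPreimage n σ, energyDensity G x).toReal := by
    intro j
    have hF := σ.isSectorWeight_weight j
    have hlim : Filter.Tendsto (fun k => ∫ x, fluxDensity (σ.weight j) (mollify k (P.extend n)) ξ x)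
        Filter.atTop (nhds (∑ v : P.vertices, ξ v *
          (∫ p in (C v).region, pullbackWeight (σ.weight j) (g v) (1, 0) (0, 1) p))) := by
      have h1 := tendsto_finsetSum (Finset.univ : Finset P.vertices) fun v _ =>
        ((C v).tendsto_integral_upperStep (hH v) (hHT v) hn hP (hH0 v) (hg v) (hH1 v)
          hF).const_mul (ξ v)
      refine h1.congr' ?_
      filter_upwards [eventually_integral_fluxDensity_eq_zero hF.contDiff hF.zero hM
        hasCompactSupport_extend (hξ.sub hsum1) fun x hx =>
          hn.isTameAt_extend hP hF (hnear x hx)] with k hk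
      have cm : ContDiff ℝ 2 (mollify k (P.extend n)) :=
        (contDiff_mollify k hM).of_le (by norm_cast)
      have hmc := hasCompactSupport_mollify k (hasCompactSupport_extend (P := P) (n := n))
      have hi := fun {φ : E3 → ℝ} (hφ : ContDiff ℝ 1 φ) =>
        integrable_fluxDensity hF.contDiff cm hmc hφ
      have e1 : ∀ x, fluxDensity (σ.weight j) (mollify k (P.extend n))
          (fun x => ξ x - ∑ v : P.vertices, ξ v * η v x) x =
          fluxDensity (σ.weight j) (mollify k (P.extend n)) ξ x -
          ∑ v : P.vertices, ξ v * fluxDensity (σ.weight j) (mollify k (P.extend n)) (η v) x := by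
        intro x
        rw [fluxDensity_sub (hξ.differentiable (by simp) x) (hsum1.differentiable (by simp) x),
          fluxDensity_sum _ _ fun v _ => (hη1 v).differentiable (by simp) x]
      have hk' : ∫ x, (fluxDensity (σ.weight j) (mollify k (P.extend n)) ξ x -
          ∑ v : P.vertices, ξ v * fluxDensity (σ.weight j) (mollify k (P.extend n)) (η v) x) = 0 := by
        rw [← hk]; exact integral_congr_ae (Filter.Eventually.of_forall fun x => (e1 x).symm)
      rw [integral_sub (hi hξ) (integrable_finsetSum _ fun v _ => (hi (hη1 v)).const_mul _),
        integral_finsetSum _ fun v _ => (hi (hη1 v)).const_mul _, sub_eq_zero] at hk'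
      rw [hk']
      simp only [integral_const_mul]
      rfl
    have hδ : ∀ δ ∈ Ioo (0 : ℝ) (1 / 2), 2 * (1 - δ) ^ 2 * ∑ v : P.vertices, ξ v *
        (∫ p in (C v).region, pullbackWeight (σ.weight j) (g v) (1, 0) (0, 1) p) ≤
        (∫⁻ x in P.sectorPreimage n σ, energyDensity G x).toReal := fun δ hδ =>
      le_of_tendsto (hlim.const_mul _)
        (hn.eventually_two_mul_integral_le hP hG hF hE hξ hξ1 hξv hδ.1 hδ.2)
    have hc : Filter.Tendsto (fun δ : ℝ => 2 * (1 - δ) ^ 2 * ∑ v : P.vertices, ξ v *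
        (∫ p in (C v).region, pullbackWeight (σ.weight j) (g v) (1, 0) (0, 1) p))
        (nhdsWithin 0 (Ioi 0)) (nhds (2 * (1 - 0) ^ 2 * ∑ v : P.vertices, ξ v *
        (∫ p in (C v).region, pullbackWeight (σ.weight j) (g v) (1, 0) (0, 1) p))) :=
      (Continuous.tendsto (by fun_prop) (0 : ℝ)).mono_left nhdsWithin_le_nhds
    have := le_of_tendsto hc (by
      filter_upwards [Ioo_mem_nhdsGT (show (0 : ℝ) < 1 / 2 by norm_num)] with δ h using hδ δ h)
    simpa using this
  have hlim2 := (tendsto_finsetSum (Finset.univ : Finset P.vertices) fun v _ =>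
    ((C v).tendsto_integral_pullbackWeight (hg v) (hgT v) σ).const_mul (ξ v)).const_mul 2
  have hfin := le_of_tendsto hlim2 (Filter.Eventually.of_forall key)
  refine le_trans (le_of_eq ?_) hfin
  rw [mul_assoc, Finset.mul_sum]
  congr 1
  refine Finset.sum_congr rfl fun v _ => ?_
  rw [hwC v]
  field_simp

end ConvexPolyhedron

/-! ### Duality for minimal connections and smooth potentials. -/

lemma exists_pos_forall_le {ι : Type*} [Finite ι] (f : ι → ℝ) :
    ∃ ε : ℝ, 0 < ε ∧ ∀ i, 0 < f i → ε ≤ f i := by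
  rcases isEmpty_or_nonempty ι with hι | hι
  · exact ⟨1, one_pos, fun i => hι.elim i⟩
  · obtain ⟨i, hi⟩ := Finite.exists_min fun i => if 0 < f i then f i else 1
    refine ⟨_, ?_, fun j hj => (hi j).trans (by rw [if_pos hj])⟩
    split_ifs with h
    · exact h
    · exact one_pos

/-- The infimal convolution of finitely many values with a `1`-Lipschitz cost. -/
lemma exists_lipschitz_inf {X ι : Type*} [PseudoMetricSpace X] (s : Finset ι) (hs : s.Nonempty)
    (c : ι → X → ℝ) (hc : ∀ i ∈ s, ∀ x y, c i x ≤ c i y + dist x y) :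
    ∃ ξ : X → ℝ, LipschitzWith 1 ξ ∧ (∀ i ∈ s, ∀ x, ξ x ≤ c i x) ∧
      ∀ x a, (∀ i ∈ s, a ≤ c i x) → a ≤ ξ x := by
  refine ⟨fun x => s.inf' hs fun i => c i x, ?_, fun i hi x => Finset.inf'_le _ hi,
    fun x a h => Finset.le_inf' _ _ h⟩
  refine LipschitzWith.of_le_add fun x y => ?_
  obtain ⟨i, hi, he⟩ := Finset.exists_mem_eq_inf' hs fun i => c i y
  rw [he]
  exact (Finset.inf'_le _ hi).trans (hc i hi x y)

/-- A feasible pair of dual variables gives a `1`-Lipschitz potential. -/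
lemma exists_lipschitz_potential {X α β : Type*} [PseudoMetricSpace X] [Fintype β] [Nonempty β]
    (p : α → X) (q : β → X) {f : α → ℝ} {g : β → ℝ} (h : ∀ j k, f j - g k ≤ dist (p j) (q k)) :
    ∃ ξ : X → ℝ, LipschitzWith 1 ξ ∧ (∀ j, f j ≤ ξ (p j)) ∧ ∀ k, ξ (q k) ≤ g k := by
  obtain ⟨ξ, h1, h2, h3⟩ := exists_lipschitz_inf (Finset.univ : Finset β) Finset.univ_nonempty
    (fun k x => g k + dist x (q k)) (fun k _ x y => by
      have := dist_triangle x y (q k)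
      linarith)
  refine ⟨ξ, h1, fun j => h3 _ _ fun k _ => by linarith [h j k], fun k => ?_⟩
  simpa using h2 k (Finset.mem_univ k) (q k)

/-- A maximal potential exists. -/
lemma exists_maximal_potential {X α β : Type*} [PseudoMetricSpace X] [Fintype α] [Fintype β]
    [Nonempty β] (hcard : Fintype.card α = Fintype.card β) (p : α → X) (q : β → X) :
    ∃ ξ : X → ℝ, LipschitzWith 1 ξ ∧ ∀ ζ : X → ℝ, LipschitzWith 1 ζ →
      ∑ j, ζ (p j) - ∑ k, ζ (q k) ≤ ∑ j, ξ (p j) - ∑ k, ξ (q k) := by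
  obtain ⟨k₀⟩ := ‹Nonempty β›
  set z : α ⊕ β → X := Sum.elim p q with hz
  -- The objective depends only on the values at the points and, since the tuples have equal length,
  -- not on additive constants. Normalising at `k₀` therefore loses nothing and makes the feasible
  -- set compact.
  set B : Set (α ⊕ β → ℝ) := {ξ | (∀ i j, ξ i - ξ j ≤ dist (z i) (z j)) ∧ ξ (Sum.inr k₀) = 0}
    with hB
  have hBcl : IsClosed B := by
    refine IsClosed.inter ?_ (isClosed_eq (continuous_apply _) continuous_const)
    show IsClosed {ξ : α ⊕ β → ℝ | ∀ i j, ξ i - ξ j ≤ dist (z i) (z j)}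
    simp only [ofPred_forall]
    exact isClosed_iInter fun i => isClosed_iInter fun j =>
      isClosed_le ((continuous_apply i).sub (continuous_apply j)) continuous_const
  have hBc : IsCompact B := by
    refine (isCompact_univ_pi fun i => isCompact_Icc (a := -dist (z (Sum.inr k₀)) (z i))
      (b := dist (z i) (z (Sum.inr k₀)))).of_isClosed_subset hBcl fun ξ hξ i _ => ?_
    have h1 := hξ.1 i (Sum.inr k₀)
    have h2 := hξ.1 (Sum.inr k₀) i
    have h3 := hξ.2
    constructor <;> linarith
  have hBmem : ∀ ζ : X → ℝ, LipschitzWith 1 ζ → (fun i => ζ (z i) - ζ (q k₀)) ∈ B := by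
    intro ζ hζ
    refine ⟨fun i j => ?_, sub_self _⟩
    have := hζ.dist_le_mul (z i) (z j)
    rw [Real.dist_eq, NNReal.coe_one, one_mul] at this
    linarith [le_abs_self (ζ (z i) - ζ (z j))]
  obtain ⟨ξ₀, hξ₀, hmax⟩ := hBc.exists_isMaxOn ⟨_, hBmem (fun _ => 0) (LipschitzWith.const' 0)⟩
    (f := fun ξ : α ⊕ β → ℝ => ∑ j, ξ (Sum.inl j) - ∑ k, ξ (Sum.inr k))
    (Continuous.continuousOn (by fun_prop))
  have : Nonempty β := ⟨k₀⟩
  -- Extending the optimal values to the whole space can only raise them at `p` and lower them at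
  -- `q`.
  obtain ⟨ξ, hξ, hξp, hξq⟩ := exists_lipschitz_potential p q
    (f := fun j => ξ₀ (Sum.inl j)) (g := fun k => ξ₀ (Sum.inr k)) fun j k => hξ₀.1 _ _
  refine ⟨ξ, hξ, fun ζ hζ => ?_⟩
  have h1 := hmax (hBmem ζ hζ)
  simp only [mem_ofPred_eq, hz, Sum.elim_inl, Sum.elim_inr, Finset.sum_sub_distrib,
    Finset.sum_const, Finset.card_univ, hcard] at h1
  have h2 := Finset.sum_le_sum fun j (_ : j ∈ Finset.univ) => hξp j
  have h3 := Finset.sum_le_sum fun k (_ : k ∈ Finset.univ) => hξq k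
  linarith

/-- Duality for the minimal connection: its length is attained by a `1`-Lipschitz potential. -/
lemma exists_lipschitz_minimalConnection_le {α β : Type} [Fintype α] [Fintype β]
    (hcard : Fintype.card α = Fintype.card β) (p : α → E3) (q : β → E3) :
    ∃ ξ : E3 → ℝ, LipschitzWith 1 ξ ∧
      minimalConnection p q ≤ ENNReal.ofReal (∑ j, ξ (p j) - ∑ k, ξ (q k)) := by
  classical
  rcases isEmpty_or_nonempty β with hβ | hβ
  · have hα : IsEmpty α := Fintype.card_eq_zero_iff.1 (by rw [hcard]; exact Fintype.card_eq_zero)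
    refine ⟨fun _ => 0, LipschitzWith.const' 0, ?_⟩
    exact (iInf_le _ (Equiv.equivOfIsEmpty α β)).trans (by simp)
  obtain ⟨ξ, hξ, hmax⟩ := exists_maximal_potential hcard p q
  have hL : ∀ x y, ξ x - ξ y ≤ dist x y := fun x y => by
    have := hξ.dist_le_mul x y
    rw [Real.dist_eq, NNReal.coe_one, one_mul] at this
    exact (le_abs_self _).trans this
  set t : α → Finset β := fun j =>
    Finset.univ.filter fun k => ξ (p j) - ξ (q k) = dist (p j) (q k) with ht
  -- Hall's condition for the graph of tight pairs. If `s` violated it, raising the potential by a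
  -- small `ε` on `s` and on its tight partners would stay feasible and increase the objective by
  -- `ε` times the deficiency. A perfect matching by tight pairs then has total length equal to the
  -- objective.
  have hHall : ∀ s : Finset α, s.card ≤ (s.biUnion t).card := by
    by_contra! hcon
    obtain ⟨s, hs⟩ := hcon
    obtain ⟨ε, hε, hεle⟩ := exists_pos_forall_le
      fun jk : α × β => dist (p jk.1) (q jk.2) - (ξ (p jk.1) - ξ (q jk.2))
    obtain ⟨ζ, hζ, hζp, hζq⟩ := exists_lipschitz_potential p q
      (f := fun j => ξ (p j) + if j ∈ s then ε else 0)
      (g := fun k => ξ (q k) + if k ∈ s.biUnion t then ε else 0) (fun j k => by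
        have h0 := hL (p j) (q k)
        by_cases hj : j ∈ s
        · by_cases hk : k ∈ s.biUnion t
          · rw [if_pos hj, if_pos hk]; linarith
          · rw [if_pos hj, if_neg hk]
            have hne : ξ (p j) - ξ (q k) ≠ dist (p j) (q k) := fun h =>
              hk (Finset.mem_biUnion.2 ⟨j, hj, Finset.mem_filter.2 ⟨Finset.mem_univ _, h⟩⟩)
            have := hεle (j, k) (sub_pos.2 (lt_of_le_of_ne h0 hne))
            simp only at this
            linarith
        · rw [if_neg hj]
          split_ifs <;> linarith)
    have h1 := hmax ζ hζ
    have h2 := Finset.sum_le_sum fun j (_ : j ∈ Finset.univ) => hζp j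
    have h3 := Finset.sum_le_sum fun k (_ : k ∈ Finset.univ) => hζq k
    simp only [Finset.sum_add_distrib, Finset.sum_ite_mem, Finset.univ_inter, Finset.sum_const,
      nsmul_eq_mul] at h2 h3
    have h4 : ((s.biUnion t).card : ℝ) * ε < s.card * ε :=
      mul_lt_mul_of_pos_right (by exact_mod_cast hs) hε
    linarith
  obtain ⟨f, hfinj, hft⟩ := (Finset.all_card_le_biUnion_card_iff_exists_injective t).1 hHall
  have hbij : Function.Bijective f := (Fintype.bijective_iff_injective_and_card f).2 ⟨hfinj, hcard⟩
  refine ⟨ξ, hξ, (iInf_le _ (Equiv.ofBijective f hbij)).trans (le_of_eq ?_)⟩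
  have hsum : ∑ k, ξ (q k) = ∑ j, ξ (q (f j)) :=
    (Equiv.sum_comp (Equiv.ofBijective f hbij) fun k => ξ (q k)).symm
  rw [hsum, ← Finset.sum_sub_distrib]
  have heq : ∀ j, ξ (p j) - ξ (q (f j)) = dist (p j) (q (f j)) := fun j =>
    (Finset.mem_filter.1 (hft j)).2
  simp only [heq, Equiv.ofBijective_apply, edist_dist]
  rw [ENNReal.ofReal_sum_of_nonneg fun _ _ => dist_nonneg]

/-- A Lipschitz function can be replaced by a smooth one that is constant near finitely many points,
with nearly the same values at these points. -/
lemma exists_smooth_lipschitz {V : Finset E3} (hV : V.Nonempty) {f : E3 → ℝ}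
    (hf : LipschitzWith 1 f) {c : ℝ} (hc0 : 0 < c) (hc1 : c < 1) :
    ∃ ξ : E3 → ℝ, ContDiff ℝ 1 ξ ∧ (∀ x, ‖fderiv ℝ ξ x‖ ≤ 1) ∧
      ∀ v ∈ V, ξ v = c * f v ∧ ∀ᶠ x in nhds v, ξ x = ξ v := by
  -- Scaling by `c < 1` leaves a slack `(1 - c) * dist a b` between distinct points, enough for
  -- plateaus of radius `ε / 2` around both. A kernel of radius below half of that then preserves
  -- smaller plateaus.
  obtain ⟨ε, hε, hεle⟩ := exists_pos_forall_le
    fun ab : V × V => (1 - c) * dist (ab.1 : E3) ab.2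
  set ρ : ℝ := ε / 2 with hρ
  have hρ0 : 0 < ρ := half_pos hε
  obtain ⟨g, hg, hgle, hleg⟩ := exists_lipschitz_inf V hV
    (fun a x => c * f a + max 0 (dist x a - ρ)) (fun a _ x y => by
      have h1 := dist_triangle x y a
      have h2 : (0 : ℝ) ≤ dist x y := dist_nonneg
      have h3 : max 0 (dist x a - ρ) ≤ max 0 (dist y a - ρ) + dist x y :=
        max_le (by linarith [le_max_left 0 (dist y a - ρ)])
          (by linarith [le_max_right 0 (dist y a - ρ)])
      linarith)
  have hgv : ∀ v ∈ V, ∀ x, dist x v ≤ ρ → g x = c * f v := by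
    intro v hv x hx
    refine le_antisymm ?_ (hleg x _ fun b hb => ?_)
    · have := hgle v hv x
      rwa [max_eq_left (by linarith), add_zero] at this
    · by_cases hbv : v = b
      · rw [← hbv]; linarith [le_max_left 0 (dist x v - ρ)]
      · have h1 := hεle (⟨v, hv⟩, ⟨b, hb⟩)
          (mul_pos (sub_pos.2 hc1) (dist_pos.2 hbv))
        simp only at h1
        have h2 := hf.dist_le_mul v b
        rw [Real.dist_eq, NNReal.coe_one, one_mul] at h2
        have h3 := (le_abs_self _).trans h2
        have h4 : dist v b ≤ dist x v + dist x b := dist_triangle_left v b x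
        have h5 := le_max_right 0 (dist x b - ρ)
        nlinarith
  obtain ⟨k, hk⟩ := (tendsto_kernelRadius.eventually_lt_const (half_pos hρ0)).exists
  have hgl : LocallyIntegrable g := hg.continuous.locallyIntegrable
  have hnear : ∀ v ∈ V, ∀ x, dist x v < ρ / 2 → mollify k g x = c * f v := by
    intro v hv x hx
    refine mollify_mem (Q := {c * f v}) hgl (convex_singleton _) isClosed_singleton fun y hy => ?_
    refine hgv v hv y ?_
    have := dist_triangle y x v
    rw [Metric.mem_ball] at hy
    linarith
  refine ⟨mollify k g, (contDiff_mollify k hgl).of_le (by norm_cast), fun x => ?_,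
    fun v hv => ⟨hnear v hv v (by rw [dist_self]; exact half_pos hρ0), ?_⟩⟩
  · simpa using norm_fderiv_le_of_lipschitz ℝ (x₀ := x) (lipschitzWith_mollify k hg)
  · filter_upwards [Metric.ball_mem_nhds v (half_pos hρ0)] with x hx
    rw [hnear v hv x hx, hnear v hv v (by rw [dist_self]; exact half_pos hρ0)]

/-! ### The minimal connection of one sector, and disjointness of the sectors' preimages. -/

namespace ConvexPolyhedron

variable {P : ConvexPolyhedron}

lemma nonempty_vertices (P : ConvexPolyhedron) : P.vertices.Nonempty := by
  rw [Finset.nonempty_iff_ne_empty]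
  intro h
  obtain ⟨x, hx⟩ := P.interior_nonempty
  have := interior_subset hx
  simp [h] at this

lemma Sector.area_ne_top (σ : P.Sector) : σ.area ≠ ⊤ := measure_ne_top _ _

/-- The contribution of a sector to the lower bound. -/
lemma two_mul_area_mul_minimalConnection_le {h : P.WrappingNumbers} {n : E3 → E3}
    (hn : n ∈ P.homotopyClass h) {G : Fin 3 → E3 → E3} (hG : P.IsWeakGradient n G)
    (σ : P.Sector) :
    2 * σ.area * minimalConnection (P.positivePoints h σ) (P.negativePoints h σ) ≤
      ∫⁻ x in P.sectorPreimage n σ, energyDensity G x := by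
  by_cases hE : ∫⁻ x in P.sectorPreimage n σ, energyDensity G x = ⊤
  · rw [hE]; exact le_top
  by_cases hA : σ.area = 0
  · rw [hA]; simp
  have hA' : σ.area.toReal ≠ 0 := ENNReal.toReal_ne_zero.2 ⟨hA, σ.area_ne_top⟩
  have hApos : 0 < σ.area.toReal := lt_of_le_of_ne ENNReal.toReal_nonneg hA'.symm
  set E := (∫⁻ x in P.sectorPreimage n σ, energyDensity G x).toReal with hEdef
  have main := fun {ξ : E3 → ℝ} => two_mul_area_mul_sum_le hn.1 hG (w := fun v => h v σ)
    (fun v => hn.2 v σ) hA' (lt_top_iff_ne_top.2 hE) (ξ := ξ)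
  -- Constant potentials of arbitrary size and sign are allowed, so finite energy forces the total
  -- wrapping number to vanish; the two tuples then have the same length.
  have hsum0 : ∑ v : P.vertices, (h v σ : ℝ) = 0 := by
    by_contra hne
    have hc := fun c : ℝ => main (ξ := fun _ => c) contDiff_const
      (fun x => by simp) (fun v _ => Filter.Eventually.of_forall fun _ => rfl)
    have := hc ((E + 1) / (2 * σ.area.toReal * ∑ v : P.vertices, (h v σ : ℝ)))
    rw [← Finset.mul_sum] at this
    have e : 2 * σ.area.toReal * ((E + 1) / (2 * σ.area.toReal * ∑ v : P.vertices, (h v σ : ℝ)) *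
        ∑ v : P.vertices, (h v σ : ℝ)) = E + 1 := by
      field_simp
    rw [e] at this
    linarith
  have hsplit : ∀ ζ : E3 → ℝ, ∑ j, ζ (P.positivePoints h σ j) - ∑ k, ζ (P.negativePoints h σ k) =
      ∑ v : P.vertices, ζ v * h v σ := by
    intro ζ
    rw [Fintype.sum_sigma, Fintype.sum_sigma, ← Finset.sum_sub_distrib]
    refine Finset.sum_congr rfl fun v _ => ?_
    simp only [positivePoints, negativePoints, Finset.sum_const, Finset.card_univ,
      Fintype.card_fin, nsmul_eq_mul]
    rw [← sub_mul, mul_comm]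
    congr 1
    exact_mod_cast Int.toNat_sub_toNat_neg (h v σ)
  have hcard : Fintype.card (Σ v : P.vertices, Fin (h v σ).toNat) =
      Fintype.card (Σ v : P.vertices, Fin (-h v σ).toNat) := by
    have := hsplit fun _ => 1
    simp only [one_mul, hsum0, Finset.sum_const, Finset.card_univ, nsmul_eq_mul, mul_one] at this
    exact_mod_cast sub_eq_zero.1 this
  obtain ⟨f, hf, hle⟩ := exists_lipschitz_minimalConnection_le hcard (P.positivePoints h σ)
    (P.negativePoints h σ)
  rw [hsplit] at hle
  -- The optimal potential is only Lipschitz. Its smooth replacement loses the factor `c`, which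
  -- tends to one afterwards.
  have hc : ∀ c ∈ Ioo (0 : ℝ) 1, c * (2 * σ.area.toReal * ∑ v : P.vertices, f v * h v σ) ≤ E := by
    intro c hc
    obtain ⟨ξ, hξ, hξ1, hξv⟩ := exists_smooth_lipschitz P.nonempty_vertices hf hc.1 hc.2
    refine le_trans (le_of_eq ?_) (main hξ hξ1 fun v hv => (hξv v hv).2)
    rw [mul_left_comm, Finset.mul_sum]
    congr 1
    exact Finset.sum_congr rfl fun v _ => by rw [(hξv v v.2).1, mul_assoc]
  have hfin : 2 * σ.area.toReal * ∑ v : P.vertices, f v * h v σ ≤ E := by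
    have ht : Filter.Tendsto
        (fun c : ℝ => c * (2 * σ.area.toReal * ∑ v : P.vertices, f v * h v σ))
        (nhdsWithin 1 (Iio 1)) (nhds (1 * (2 * σ.area.toReal * ∑ v : P.vertices, f v * h v σ))) :=
      (Continuous.tendsto (by fun_prop) (1 : ℝ)).mono_left nhdsWithin_le_nhds
    have := le_of_tendsto ht (by
      filter_upwards [Ioo_mem_nhdsLT (show (0 : ℝ) < 1 by norm_num)] with c h using hc c h)
    rwa [one_mul] at this
  calc 2 * σ.area * minimalConnection (P.positivePoints h σ) (P.negativePoints h σ)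
      ≤ 2 * σ.area * ENNReal.ofReal (∑ v : P.vertices, f v * h v σ) := by gcongr
    _ = ENNReal.ofReal (2 * σ.area.toReal * ∑ v : P.vertices, f v * h v σ) := by
      rw [ENNReal.ofReal_mul (by positivity), ENNReal.ofReal_mul zero_le_two,
        ENNReal.ofReal_toReal σ.area_ne_top]
      simp
    _ ≤ ENNReal.ofReal E := ENNReal.ofReal_le_ofReal hfin
    _ = _ := ENNReal.ofReal_toReal hE

lemma pairwise_disjoint_sectorPreimage (n : E3 → E3) :
    Pairwise (Function.onFun Disjoint fun σ : P.Sector => P.sectorPreimage n σ) := by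
  intro σ τ hne
  refine disjoint_left.2 fun x hx hx' => hne (Subtype.ext (funext fun c => ?_))
  rw [← (σ.form_pos_iff c (n x)).1 (hx.2 c), (τ.form_pos_iff c (n x)).1 (hx'.2 c)]

end ConvexPolyhedron

end

theorem theorem1 (P : ConvexPolyhedron) (h : P.WrappingNumbers) (hadm : P.Admissible h) :
    P.lowerEnergy h ≤ P.infEnergy h := by
  refine le_iInf₂ fun n hn => le_iInf₂ fun G hG => ?_
  rw [ConvexPolyhedron.lowerEnergy, ENNReal.tsum_eq_iSup_sum]
  refine iSup_le fun s => ?_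
  -- A sector is needed to obtain a cleaved surface at each vertex from the wrapping numbers;
  -- without one the sum is empty.
  rcases s.eq_empty_or_nonempty with rfl | ⟨σ₀, -⟩
  · simp
  have hP : interior P.body ⊆ P.domain := fun x hx => ⟨interior_subset hx, fun hxv => by
    obtain ⟨C, -⟩ := hn.1.2 ⟨x, hxv⟩ σ₀
    exact C.notMem_interior hx⟩
  refine (Finset.sum_le_sum fun σ _ =>
    ConvexPolyhedron.two_mul_area_mul_minimalConnection_le hn.1 hG σ).trans ?_
  rw [← lintegral_biUnion_finset ((ConvexPolyhedron.pairwise_disjoint_sectorPreimage n).set_pairwise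
    _) fun σ _ => (hn.1.1.isOpen_sectorPreimage hP σ).measurableSet]
  exact lintegral_mono_set (iUnion₂_subset fun σ _ => inter_subset_left)
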